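/- **Conventions.** $2$-categories, $2$-functors, $2$-natural transformations, $2$-monads and $2$-adjunctions are strict. For a $2$-category $\mathbb S$, $\mathbb S^{\mathrm{op}}$ is obtained by reversing $1$-cells only. **Lax algebras.** Let $(\mathcal T,m,\eta)$ be a $2$-monad on a $2$-category $\mathbb B$. A *lax $\mathcal T$-algebra* is $\mathtt y=(Y,a_{\mathtt y},\overline{\mathtt y},\overline{\mathtt y}_0)$ with $Y$ an object, $a_{\mathtt y}:\mathcal TY\to Y$ a $1$-cell and $2$-cells $\overline{\mathtt y}:a_{\mathtt y}\,\mathcal T(a_{\mathtt y})\Rightarrow a_{\mathtt y}\,m_Y$, $\overline{\mathtt y}_0:\mathrm{id}_Y\Rightarrow a_{\mathtt y}\eta_Y$ such that $$(\overline{\mathtt y}\ast\mathcal T(m_Y))\cdot(a_{\mathtt y}\ast\mathcal T(\overline{\mathtt y}))=(\overline{\mathtt y}\ast m_{\mathcal TY})\cdot(\overline{\mathtt y}\ast\mathcal T^2(a_{\mathtt y})),$$ $$(\overline{\mathtt y}\ast\eta_{\mathcal TY})\cdot(\overline{\mathtt y}_0\ast a_{\mathtt y})=\mathrm{id}_{a_{\mathtt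 y}}=(\overline{\mathtt y}\ast\mathcal T(\eta_Y))\cdot(a_{\mathtt y}\ast\mathcal T(\overline{\mathtt y}_0)).$$ A *lax morphism* $\mathtt y\to\mathtt z$ is a pair $(f,\langle f\rangle)$ with $f:Y\to Z$ and $\langle f\rangle:a_{\mathtt z}\mathcal T(f)\Rightarrow f a_{\mathtt y}$ such that $$(\langle f\rangle\ast m_Y)\cdot(\overline{\mathtt z}\ast\mathcal T^2(f))=(f\ast\overline{\mathtt y})\cdot(\langle f\rangle\ast\mathcal T(a_{\mathtt y}))\cdot(a_{\mathtt z}\ast\mathcal T(\langle f\rangle)),\qquad (\langle f\rangle\ast\eta_Y)\cdot(\overline{\mathtt z}_0\ast f)=f\ast\overline{\mathtt y}_0 .$$ It is a *pseudomorphism* if $\langle f\rangle$ is invertible and a *strict morphism* if $\langle f\rangle$ is an identity. A *$\mathcal T$-transformation* $(f,\langle f\rangle)\Rightarrow(h,\langle h\rangle)$ is a $2$-cell $\mathfrak m:f\Rightarrow h$ with $\langle h\rangle\cdot(a_{\mathtt z}\ast\mathcal T(\mathfrak m))=(\mathfrak m\ast a_{\mathtt y})\cdot\langle f\rangle$. With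 $\mathcal T$-transformations as $2$-cells, lax algebras and lax morphisms, pseudomorphisms and strict morphisms form $2$-categories $\mathsf{Lax}\text{-}\mathcal T\text{-}\mathrm{Alg}_\ell$, $\mathsf{Lax}\text{-}\mathcal T\text{-}\mathrm{Alg}$ and $\mathsf{Lax}\text{-}\mathcal T\text{-}\mathrm{Alg}_{\mathrm s}$; let $\ell:\mathsf{Lax}\text{-}\mathcal T\text{-}\mathrm{Alg}\to\mathsf{Lax}\text{-}\mathcal T\text{-}\mathrm{Alg}_\ell$ be the inclusion and $U:\mathsf{Lax}\text{-}\mathcal T\text{-}\mathrm{Alg}\to\mathbb B$ the forgetful $2$-functor. **Codescent objects.** Let $\Delta_\ell$ be the $2$-category freely generated by objects $\mathsf 1,\mathsf 2,\mathsf 3$, arrows $d^0,d^1:\mathsf 1\to\mathsf 2$, $s^0:\mathsf 2\to\mathsf 1$, $\partial^0,\partial^1,\partial^2:\mathsf 2\to\mathsf 3$ and $2$-cells $\sigma_{00}:\partial^0d^0\Rightarrow\partial^1d^0$, $\sigma_{20}:\partial^2d^0\Rightarrow\partial^0d^1$, $\sigma_{21}:\partial^2d^1\Rightarrow\partial^1d^1$,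 $n_0:\mathrm{id}_{\mathsf 1}\Rightarrow s^0d^0$, $n_1:\mathrm{id}_{\mathsf 1}\Rightarrow s^0d^1$. The $2$-category $\dot\Delta_\ell$ is presented by these generators together with an object $\mathsf 0$, an arrow $d:\mathsf 0\to\mathsf 1$ and a $2$-cell $\vartheta:d^1d\Rightarrow d^0d$, subject to $$(\sigma_{00}\ast d)\cdot(\partial^0\ast\vartheta)\cdot(\sigma_{20}\ast d)\cdot(\partial^2\ast\vartheta)=(\partial^1\ast\vartheta)\cdot(\sigma_{21}\ast d),\qquad (s^0\ast\vartheta)\cdot(n_1\ast d)=n_0\ast d ;$$ $\dot\Delta$ is obtained from $\dot\Delta_\ell$ by freely adjoining an inverse of $\vartheta$. Write $t:\Delta_\ell\to\dot\Delta_\ell$ and $j:\Delta_\ell\to\dot\Delta$ for the inclusions. For a $2$-functor $\mathcal A:\Delta_\ell^{\mathrm{op}}\to\mathbb A$, the *strict lax codescent object* and the *strict codescent object* of $\mathcal A$ are, if they exist, the (strict) weighted colimits $\dot\Delta_\ell(\mathsf 0,t-)\ast\mathcal A$ and $\dot\Delta(\mathsf 0,j-)\ast\mathcal A$. (The weighted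 colimit $W\ast\mathcal A$ is an object $c$ with a $2$-natural transformation $W\to\mathbb A(\mathcal A-,c)$ that induces, for each object $X$, an isomorphism of categories $\mathbb A(c,X)\cong[\Delta_\ell,\mathrm{Cat}](W,\mathbb A(\mathcal A-,X))$.) **Setting.** Let $(E\dashv R,\rho,\varepsilon)$ be a $2$-adjunction with $R:\mathbb A\to\mathbb B$, let $(\mathcal T,m,\eta)$ be a $2$-monad on $\mathbb B$, and let $J:\mathbb A\to\mathsf{Lax}\text{-}\mathcal T\text{-}\mathrm{Alg}$ be a $2$-functor such that $UJ=R$ and such that $J$ is the composite of a $2$-functor $\widetilde J:\mathbb A\to\mathsf{Lax}\text{-}\mathcal T\text{-}\mathrm{Alg}_{\mathrm s}$ with the inclusion $\mathsf{Lax}\text{-}\mathcal T\text{-}\mathrm{Alg}_{\mathrm s}\to\mathsf{Lax}\text{-}\mathcal T\text{-}\mathrm{Alg}$. For an object $X$ of $\mathbb B$ put $b_X:=\varepsilon_{EX}\,E(a_{JEX}\,\mathcal T(\rho_X)):E\mathcal TX\to EX$. For each lax algebra $\mathtt y=(Y,a_{\mathtt y},\overline{\mathtt y},\overline{\mathtt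 y}_0)$ let $\mathcal A_{\mathtt y}:\Delta_\ell^{\mathrm{op}}\to\mathbb A$ be the $2$-functor with $\mathsf 1\mapsto EY$, $\mathsf 2\mapsto E\mathcal TY$, $\mathsf 3\mapsto E\mathcal T^2Y$, $$d^0\mapsto E(a_{\mathtt y}),\quad d^1\mapsto b_Y,\quad s^0\mapsto E(\eta_Y),\quad \partial^0\mapsto E(\mathcal T(a_{\mathtt y})),\quad \partial^1\mapsto E(m_Y),\quad \partial^2\mapsto b_{\mathcal TY},$$ $$\sigma_{00}\mapsto E(\overline{\mathtt y}),\quad \sigma_{21}\mapsto\varepsilon_{EY}\ast E(\overline{JEY}\ast\mathcal T^2(\rho_Y)),\quad n_0\mapsto E(\overline{\mathtt y}_0),\quad n_1\mapsto\varepsilon_{EY}\ast E(\overline{JEY}_0\ast\rho_Y),$$ and $\sigma_{20}$ sent to the identity of $E(a_{\mathtt y})\,b_{\mathcal TY}=b_Y\,E(\mathcal T(a_{\mathtt y}))$. **Theorem.** 1. The $2$-functor $\ell\circ J$ has a left $2$-adjoint if and only if $\mathbb A$ has the strict lax codescent object of $\mathcal A_{\mathtt y}$ for every lax $\mathcal T$-algebra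 $\mathtt y$. In this case the left $2$-adjoint $G$ is given by $G\mathtt y=\dot\Delta_\ell(\mathsf 0,t-)\ast\mathcal A_{\mathtt y}$: for every left $2$-adjoint $G$ of $\ell\circ J$, each $G\mathtt y$ is a strict lax codescent object of $\mathcal A_{\mathtt y}$, and every choice of strict lax codescent objects $C_{\mathtt y}$ of the $\mathcal A_{\mathtt y}$ is the object function of some left $2$-adjoint of $\ell\circ J$. 2. The $2$-functor $J$ has a left $2$-adjoint if and only if $\mathbb A$ has the strict codescent object of $\mathcal A_{\mathtt y}$ for every lax $\mathcal T$-algebra $\mathtt y$. -/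

import Mathlib

open CategoryTheory Bicategory Opposite

universe w v u w₁ v₁ u₁ w₂ v₂

namespace LaxAlgebras

section Computads

variable {V : Type} [Quiver.{0} V]

/-- A family of generating `2`-cells between parallel paths of a quiver; together with the quiver
it is a (small) computad. -/
abbrev GenCells (V : Type) [Quiver.{0} V] : Type 1 :=
  ∀ ⦃a b : V⦄, Quiver.Path a b → Quiver.Path a b → Type

/-- Formal pastings of generating `2`-cells. -/
inductive PreCell (C : GenCells V) : ∀ {a b : V}, Quiver.Path a b → Quiver.Path a b → Type
  | gen {a b : V} {f g : Quiver.Path a b} (x : C f g) : PreCell C f g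
  | ofEq {a b : V} {f g : Quiver.Path a b} (h : f = g) : PreCell C f g
  | vcomp {a b : V} {f g h : Quiver.Path a b} (x : PreCell C f g) (y : PreCell C g h) :
      PreCell C f h
  | wl {a b c : V} (f : Quiver.Path a b) {g h : Quiver.Path b c} (x : PreCell C g h) :
      PreCell C (f.comp g) (f.comp h)
  | wr {a b c : V} {f g : Quiver.Path a b} (x : PreCell C f g) (h : Quiver.Path b c) :
      PreCell C (f.comp h) (g.comp h)

/-- Relations to be imposed between parallel formal pastings. -/
abbrev CellRel (C : GenCells V) : Type :=
  ∀ ⦃a b : V⦄ ⦃f g : Quiver.Path a b⦄, PreCell C f g → PreCell C f g → Prop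

open PreCell in
/-- The congruence on formal pastings generated by the axioms of a (strict) `2`-category and by
the relations `E`. -/
inductive CellEq {C : GenCells V} (E : CellRel C) : ∀ {a b : V} {f g : Quiver.Path a b},
    PreCell C f g → PreCell C f g → Prop
  | rel {a b : V} {f g : Quiver.Path a b} {x y : PreCell C f g} (h : E x y) : CellEq E x y
  | refl {a b : V} {f g : Quiver.Path a b} (x : PreCell C f g) : CellEq E x x
  | symm {a b : V} {f g : Quiver.Path a b} {x y : PreCell C f g} (h : CellEq E x y) : CellEq E y x
  | trans {a b : V} {f g : Quiver.Path a b} {x y z : PreCell C f g} (h : CellEq E x y)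
      (h' : CellEq E y z) : CellEq E x z
  | vcomp_congr {a b : V} {f g h : Quiver.Path a b} {x x' : PreCell C f g} {y y' : PreCell C g h}
      (hx : CellEq E x x') (hy : CellEq E y y') : CellEq E (vcomp x y) (vcomp x' y')
  | wl_congr {a b c : V} (f : Quiver.Path a b) {g h : Quiver.Path b c} {x x' : PreCell C g h}
      (hx : CellEq E x x') : CellEq E (wl f x) (wl f x')
  | wr_congr {a b c : V} {f g : Quiver.Path a b} {x x' : PreCell C f g} (h : Quiver.Path b c)
      (hx : CellEq E x x') : CellEq E (wr x h) (wr x' h)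
  | id_comp {a b : V} {f g : Quiver.Path a b} (x : PreCell C f g) :
      CellEq E (vcomp (ofEq rfl) x) x
  | comp_id {a b : V} {f g : Quiver.Path a b} (x : PreCell C f g) :
      CellEq E (vcomp x (ofEq rfl)) x
  | assoc {a b : V} {f g h k : Quiver.Path a b} (x : PreCell C f g) (y : PreCell C g h)
      (z : PreCell C h k) : CellEq E (vcomp (vcomp x y) z) (vcomp x (vcomp y z))
  | wl_id {a b c : V} (f : Quiver.Path a b) (g : Quiver.Path b c) :
      CellEq E (wl f (ofEq (rfl : g = g))) (ofEq rfl)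
  | wl_comp {a b c : V} (f : Quiver.Path a b) {g h k : Quiver.Path b c} (x : PreCell C g h)
      (y : PreCell C h k) : CellEq E (wl f (vcomp x y)) (vcomp (wl f x) (wl f y))
  | id_wr {a b c : V} (f : Quiver.Path a b) (g : Quiver.Path b c) :
      CellEq E (wr (ofEq (rfl : f = f)) g) (ofEq rfl)
  | comp_wr {a b c : V} {f g h : Quiver.Path a b} (x : PreCell C f g)
      (y : PreCell C g h) (k : Quiver.Path b c) :
      CellEq E (wr (vcomp x y) k) (vcomp (wr x k) (wr y k))
  | nil_wl {a b : V} {f g : Quiver.Path a b} (x : PreCell C f g) :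
      CellEq E (wl Quiver.Path.nil x)
        (vcomp (ofEq (Quiver.Path.nil_comp f)) (vcomp x (ofEq (Quiver.Path.nil_comp g).symm)))
  | comp_wl {a b c d : V} (f : Quiver.Path a b) (g : Quiver.Path b c) {h k : Quiver.Path c d}
      (x : PreCell C h k) : CellEq E (wl (f.comp g) x)
        (vcomp (ofEq (Quiver.Path.comp_assoc f g h))
          (vcomp (wl f (wl g x)) (ofEq (Quiver.Path.comp_assoc f g k).symm)))
  | wr_nil {a b : V} {f g : Quiver.Path a b} (x : PreCell C f g) :
      CellEq E (wr x Quiver.Path.nil)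
        (vcomp (ofEq (Quiver.Path.comp_nil f)) (vcomp x (ofEq (Quiver.Path.comp_nil g).symm)))
  | wr_comp {a b c d : V} {f g : Quiver.Path a b} (x : PreCell C f g) (h : Quiver.Path b c)
      (k : Quiver.Path c d) : CellEq E (wr x (h.comp k))
        (vcomp (ofEq (Quiver.Path.comp_assoc f h k).symm)
          (vcomp (wr (wr x h) k) (ofEq (Quiver.Path.comp_assoc g h k))))
  | wl_wr {a b c d : V} (f : Quiver.Path a b) {g h : Quiver.Path b c} (x : PreCell C g h)
      (k : Quiver.Path c d) : CellEq E (wr (wl f x) k)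
        (vcomp (ofEq (Quiver.Path.comp_assoc f g k))
          (vcomp (wl f (wr x k)) (ofEq (Quiver.Path.comp_assoc f h k).symm)))
  | exchange {a b c : V} {f g : Quiver.Path a b} {h k : Quiver.Path b c} (x : PreCell C f g)
      (y : PreCell C h k) :
      CellEq E (vcomp (wl f y) (wr x k)) (vcomp (wr x h) (wl g y))

/-- The `2`-category presented by a computad and a family of relations `E` between its formal
pastings: its underlying category is the free category on the quiver. If `E` is empty, it is the
`2`-category freely generated by the computad. -/
def Presented {C : GenCells V} (_ : CellRel C) : Type := V

namespace Presented

variable {C : GenCells V} {E : CellRel C}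

instance : CategoryStruct.{0} (Presented E) where
  Hom a b := Quiver.Path (V := V) a b
  id a := Quiver.Path.nil (V := V) (a := a)
  comp f g := Quiver.Path.comp (V := V) f g

/-- `2`-cells: formal pastings modulo the axioms of a `2`-category and the relations. -/
abbrev Cell (E : CellRel C) {a b : V} (f g : Quiver.Path a b) : Type :=
  Quot (fun x y : PreCell C f g => CellEq E x y)

/-- The `2`-cell given by a formal pasting. -/
abbrev mk₂ {a b : V} {f g : Quiver.Path a b} (x : PreCell C f g) : Cell E f g :=
  Quot.mk _ x

/-- Whiskering on the left. -/
def wl₂ {a b c : V} (f : Quiver.Path a b) {g h : Quiver.Path b c} (x : Cell E g h) :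
    Cell E (f.comp g) (f.comp h) :=
  Quot.map (PreCell.wl f) (fun _ _ hx => CellEq.wl_congr f hx) x

/-- Whiskering on the right. -/
def wr₂ {a b c : V} {f g : Quiver.Path a b} (x : Cell E f g) (h : Quiver.Path b c) :
    Cell E (f.comp h) (g.comp h) :=
  Quot.map (fun y => PreCell.wr y h) (fun _ _ hx => CellEq.wr_congr h hx) x

instance homCategory (a b : Presented E) : Category.{0} (a ⟶ b) where
  Hom f g := Cell (V := V) E f g
  id f := mk₂ (V := V) (.ofEq rfl)
  comp x y := Quot.map₂ PreCell.vcomp (fun _ _ _ h => .vcomp_congr (.refl _) h)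
    (fun _ _ _ h => .vcomp_congr h (.refl _)) x y
  id_comp x := by
    induction x using Quot.inductionOn with | _ x => exact Quot.sound (.id_comp x)
  comp_id x := by
    induction x using Quot.inductionOn with | _ x => exact Quot.sound (.comp_id x)
  assoc x y z := by
    induction x using Quot.inductionOn with | _ x
    induction y using Quot.inductionOn with | _ y
    induction z using Quot.inductionOn with | _ z
    exact Quot.sound (.assoc x y z)

theorem eqToHom_eq {a b : Presented E} {f g : a ⟶ b} (h : f = g) :
    eqToHom h = (mk₂ (V := V) (.ofEq h) : f ⟶ g) := by
  subst h; rfl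

theorem wl₂_eqToHom {a b c : Presented E} (f : a ⟶ b) {g h : b ⟶ c} (e : g = h) :
    (wl₂ (V := V) f (eqToHom e : g ⟶ h) : f ≫ g ⟶ f ≫ h) =
      eqToHom (congrArg (f ≫ ·) e) := by
  subst e; exact Quot.sound (.wl_id (V := V) f g)

theorem wr₂_eqToHom {a b c : Presented E} {f g : a ⟶ b} (e : f = g) (h : b ⟶ c) :
    (wr₂ (V := V) (eqToHom e : f ⟶ g) h : f ≫ h ⟶ g ≫ h) =
      eqToHom (congrArg (· ≫ h) e) := by
  subst e; exact Quot.sound (.id_wr (V := V) f h)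

/-- Presented `2`-categories. -/
instance bicategory : Bicategory.{0, 0} (Presented E) where
  homCategory := homCategory
  whiskerLeft f _ _ x := wl₂ (V := V) f x
  whiskerRight x h := wr₂ (V := V) x h
  associator f g h := eqToIso (Quiver.Path.comp_assoc (V := V) f g h)
  leftUnitor f := eqToIso (Quiver.Path.nil_comp (V := V) f)
  rightUnitor f := eqToIso (Quiver.Path.comp_nil (V := V) f)
  whiskerLeft_id f g := Quot.sound (.wl_id (V := V) f g)
  whiskerLeft_comp f _ _ _ x y := by
    induction x using Quot.inductionOn with | _ x
    induction y using Quot.inductionOn with | _ y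
    exact Quot.sound (.wl_comp (V := V) f x y)
  id_whiskerLeft x := by
    induction x using Quot.inductionOn with | _ x
    rw [eqToIso.hom, eqToIso.inv, eqToHom_eq, eqToHom_eq]
    exact Quot.sound (.nil_wl (V := V) x)
  comp_whiskerLeft f g _ _ x := by
    induction x using Quot.inductionOn with | _ x
    rw [eqToIso.hom, eqToIso.inv, eqToHom_eq, eqToHom_eq]
    exact Quot.sound (.comp_wl (V := V) f g x)
  id_whiskerRight f g := Quot.sound (.id_wr (V := V) f g)
  comp_whiskerRight x y h := by
    induction x using Quot.inductionOn with | _ x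
    induction y using Quot.inductionOn with | _ y
    exact Quot.sound (.comp_wr (V := V) x y h)
  whiskerRight_id x := by
    induction x using Quot.inductionOn with | _ x
    rw [eqToIso.hom, eqToIso.inv, eqToHom_eq, eqToHom_eq]
    exact Quot.sound (.wr_nil (V := V) x)
  whiskerRight_comp x g h := by
    induction x using Quot.inductionOn with | _ x
    rw [eqToIso.hom, eqToIso.inv, eqToHom_eq, eqToHom_eq]
    exact Quot.sound (.wr_comp (V := V) x g h)
  whisker_assoc f _ _ x h := by
    induction x using Quot.inductionOn with | _ x
    rw [eqToIso.hom, eqToIso.inv, eqToHom_eq, eqToHom_eq]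
    exact Quot.sound (.wl_wr (V := V) f x h)
  whisker_exchange x y := by
    induction x using Quot.inductionOn with | _ x
    induction y using Quot.inductionOn with | _ y
    exact Quot.sound (.exchange (V := V) x y)
  pentagon f g h i := by
    simp only [eqToIso.hom, wl₂_eqToHom, wr₂_eqToHom]
    exact (congrArg _ (eqToHom_trans _ _)).trans ((eqToHom_trans _ _).trans (eqToHom_trans _ _).symm)
  triangle f g := by
    simp only [eqToIso.hom, wl₂_eqToHom, wr₂_eqToHom]
    exact eqToHom_trans _ _

instance : Bicategory.Strict (Presented E) where
  id_comp f := Quiver.Path.nil_comp (V := V) f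
  comp_id f := Quiver.Path.comp_nil (V := V) f
  assoc f g h := Quiver.Path.comp_assoc (V := V) f g h
  leftUnitor_eqToIso _ := rfl
  rightUnitor_eqToIso _ := rfl
  associator_eqToIso _ _ _ := rfl

end Presented

end Computads

section Lift

variable {V : Type} [Quiver.{0} V] {C : GenCells V} {E : CellRel C}
  {B : Type u} [Bicategory.{w, v} B]

/-- The value on paths of an assignment of `1`-cells to arrows. -/
def pathMap (F : V ⥤q B) {a : V} :
    ∀ {b : V}, Quiver.Path a b → (F.obj a ⟶ F.obj b)
  | _, .nil => 𝟙 (F.obj a)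
  | _, .cons p e => pathMap F p ≫ F.map e

theorem pathMap_comp [Bicategory.Strict B] (F : V ⥤q B) {a b c : V}
    (p : Quiver.Path a b) (q : Quiver.Path b c) :
    pathMap F (p.comp q) = pathMap F p ≫ pathMap F q := by
  induction q with
  | nil => exact (Bicategory.Strict.comp_id _).symm
  | cons q e ih =>
    change pathMap F (p.comp q) ≫ F.map e = _ ≫ pathMap F q ≫ F.map e
    rw [ih, Bicategory.Strict.assoc]

/-- The value on formal pastings of an assignment of `2`-cells to generating `2`-cells. -/
def cellMap [Bicategory.Strict B] (F : V ⥤q B)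
    (cell : ∀ ⦃a b : V⦄ ⦃f g : Quiver.Path a b⦄, C f g → (pathMap F f ⟶ pathMap F g)) :
    ∀ {a b : V} {f g : Quiver.Path a b}, PreCell C f g → (pathMap F f ⟶ pathMap F g)
  | _, _, _, _, .gen x => cell x
  | _, _, _, _, .ofEq h => eqToHom (congrArg _ h)
  | _, _, _, _, .vcomp x y => cellMap F cell x ≫ cellMap F cell y
  | _, _, _, _, .wl f x => eqToHom (pathMap_comp F _ _) ≫
      pathMap F f ◁ cellMap F cell x ≫ eqToHom (pathMap_comp F _ _).symm
  | _, _, _, _, .wr x h => eqToHom (pathMap_comp F _ _) ≫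
      cellMap F cell x ▷ pathMap F h ≫ eqToHom (pathMap_comp F _ _).symm

theorem cellMap_eq [Bicategory.Strict B] (F : V ⥤q B)
    (cell : ∀ ⦃a b : V⦄ ⦃f g : Quiver.Path a b⦄, C f g → (pathMap F f ⟶ pathMap F g))
    (hE : ∀ ⦃a b : V⦄ ⦃f g : Quiver.Path a b⦄ (x y : PreCell C f g), E x y →
      cellMap F cell x = cellMap F cell y)
    {a b : V} {f g : Quiver.Path a b} {x y : PreCell C f g} (h : CellEq E x y) :
    cellMap F cell x = cellMap F cell y := by
  induction h with
  | rel h => exact hE _ _ h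
  | refl x => rfl
  | symm _ ih => exact ih.symm
  | trans _ _ ih ih' => exact ih.trans ih'
  | vcomp_congr _ _ ih ih' => simp only [cellMap, ih, ih']
  | wl_congr _ _ ih => simp only [cellMap, ih]
  | wr_congr _ _ ih => simp only [cellMap, ih]
  | id_comp x => simp [cellMap]
  | comp_id x => simp [cellMap]
  | assoc x y z => simp [cellMap]
  | wl_id f g => simp [cellMap]
  | wl_comp f x y => simp [cellMap]
  | id_wr f g => simp [cellMap]
  | comp_wr x y k => simp [cellMap]
  | nil_wl x =>
    simp only [cellMap]
    rw [Bicategory.congr_whiskerLeft (show pathMap F Quiver.Path.nil = 𝟙 _ from rfl)]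
    simp [Bicategory.Strict.leftUnitor_eqToIso]
  | comp_wl f g x =>
    simp [cellMap, Bicategory.congr_whiskerLeft (pathMap_comp F f g),
      Bicategory.Strict.associator_eqToIso]
  | wr_nil x =>
    simp only [cellMap]
    rw [Bicategory.whiskerRight_congr (show pathMap F Quiver.Path.nil = 𝟙 _ from rfl)]
    simp only [whiskerRight_id, Bicategory.Strict.rightUnitor_eqToIso, eqToIso.hom, eqToIso.inv,
      Category.assoc, eqToHom_trans, eqToHom_trans_assoc]
  | wr_comp x h k =>
    simp [cellMap, Bicategory.whiskerRight_congr (pathMap_comp F h k),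
      Bicategory.Strict.associator_eqToIso]
  | wl_wr f x k =>
    simp [cellMap, Bicategory.Strict.associator_eqToIso]
  | exchange x y => simp [cellMap, whisker_exchange_assoc]

/-- The universal property of a presented `2`-category. -/
def Presented.lift [Bicategory.Strict B] (F : V ⥤q B)
    (cell : ∀ ⦃a b : V⦄ ⦃f g : Quiver.Path a b⦄, C f g → (pathMap F f ⟶ pathMap F g))
    (hE : ∀ ⦃a b : V⦄ ⦃f g : Quiver.Path a b⦄ (x y : PreCell C f g), E x y →
      cellMap F cell x = cellMap F cell y) :
    StrictPseudofunctor (Presented E) B :=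
  StrictPseudofunctor.mk''
    { obj := F.obj
      map := fun p => pathMap F p
      map₂ := fun x => Quot.lift (cellMap F cell)
        (fun _ _ h => cellMap_eq F cell hE h) x
      map₂_id := fun _ => rfl
      map₂_comp := fun x y => by
        induction x using Quot.inductionOn with | _ x
        induction y using Quot.inductionOn with | _ y
        rfl
      map_id := fun _ => rfl
      map_comp := fun p q => pathMap_comp F p q
      map₂_whisker_left := fun f _ _ x => by
        induction x using Quot.inductionOn with | _ x
        rfl
      map₂_whisker_right := fun x f => by
        induction x using Quot.inductionOn with | _ x
        rfl }

end Lift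

section Delta

/-- The objects `𝟣, 𝟤, 𝟥`. -/
inductive DObj : Type
  | one | two | three

/-- The arrows `d⁰, d¹ : 𝟣 ⟶ 𝟤`, `s⁰ : 𝟤 ⟶ 𝟣` and `∂⁰, ∂¹, ∂² : 𝟤 ⟶ 𝟥`. -/
inductive DArr : DObj → DObj → Type
  | d0 : DArr .one .two
  | d1 : DArr .one .two
  | s0 : DArr .two .one
  | p0 : DArr .two .three
  | p1 : DArr .two .three
  | p2 : DArr .two .three

instance : Quiver.{0} DObj := ⟨DArr⟩

/-- The path consisting of two consecutive arrows. -/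
abbrev path₂ {V : Type} [Quiver.{0} V] {a b c : V} (e : a ⟶ b) (e' : b ⟶ c) : Quiver.Path a c :=
  (Quiver.Path.nil.cons e).cons e'

/-- The generating `2`-cells `σ₀₀ : ∂⁰d⁰ ⇒ ∂¹d⁰`, `σ₂₀ : ∂²d⁰ ⇒ ∂⁰d¹`, `σ₂₁ : ∂²d¹ ⇒ ∂¹d¹`,
`n₀ : id ⇒ s⁰d⁰` and `n₁ : id ⇒ s⁰d¹` (paths are written in diagrammatic order). -/
inductive DCell : ∀ ⦃a b : DObj⦄, Quiver.Path a b → Quiver.Path a b → Type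
  | s00 : DCell (path₂ DArr.d0 DArr.p0) (path₂ DArr.d0 DArr.p1)
  | s20 : DCell (path₂ DArr.d0 DArr.p2) (path₂ DArr.d1 DArr.p0)
  | s21 : DCell (path₂ DArr.d1 DArr.p2) (path₂ DArr.d1 DArr.p1)
  | n0 : DCell (Quiver.Path.nil (a := DObj.one)) (path₂ DArr.d0 DArr.s0)
  | n1 : DCell (Quiver.Path.nil (a := DObj.one)) (path₂ DArr.d1 DArr.s0)

/-- The empty family of relations. -/
def noRel {V : Type} [Quiver.{0} V] (C : GenCells V) : CellRel C := fun _ _ _ _ _ _ => False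

/-- `Δ_ℓ`: the `2`-category freely generated by the computad on `𝟣, 𝟤, 𝟥`. -/
abbrev DeltaL : Type := Presented (noRel DCell)

/-- The objects `𝟢, 𝟣, 𝟤, 𝟥`. -/
inductive DotObj : Type
  | zero | of (x : DObj)

/-- The arrows of `Δ_ℓ` together with `d : 𝟢 ⟶ 𝟣`. -/
inductive DotArr : DotObj → DotObj → Type
  | d : DotArr .zero (.of .one)
  | of {x y : DObj} (e : DArr x y) : DotArr (.of x) (.of y)

instance : Quiver.{0} DotObj := ⟨DotArr⟩

/-- The inclusion of generators. -/
def dotIncl : DObj ⥤q DotObj where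
  obj := DotObj.of
  map e := DotArr.of e

/-- The generating `2`-cells of `Δ_ℓ`, together with `ϑ : d¹d ⇒ d⁰d` and, if `i` holds,
a `2`-cell `d⁰d ⇒ d¹d`. -/
inductive DotCell (i : Prop) : ∀ ⦃a b : DotObj⦄, Quiver.Path a b → Quiver.Path a b → Type
  | of {a b : DObj} {f g : Quiver.Path a b} (x : DCell f g) :
      DotCell i (dotIncl.mapPath f) (dotIncl.mapPath g)
  | theta : DotCell i (path₂ DotArr.d (DotArr.of DArr.d1)) (path₂ DotArr.d (DotArr.of DArr.d0))
  | thetaInv (h : i) :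
      DotCell i (path₂ DotArr.d (DotArr.of DArr.d0)) (path₂ DotArr.d (DotArr.of DArr.d1))

/-- The generating `2`-cells coming from `Δ_ℓ`, as formal pastings. -/
abbrev dotGen (i : Prop) {a b : DObj} {f g : Quiver.Path a b} (x : DCell f g) :
    PreCell (DotCell i) (dotIncl.mapPath f) (dotIncl.mapPath g) := .gen (.of x)

open PreCell in
/-- The associativity equation
`(∂¹ϑ) · (σ₂₁d) = (σ₀₀d) · (∂⁰ϑ) · (σ₂₀d) · (∂²ϑ)`, the identity equation
`(s⁰ϑ) · (n₁d) = n₀d` and, if `i` holds, the equations saying that `ϑ` is invertible. -/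
inductive DotRel (i : Prop) : CellRel (DotCell i)
  | assoc : DotRel i
      (vcomp (wl (Quiver.Hom.toPath DotArr.d) (dotGen i DCell.s21))
        (wr (gen DotCell.theta) (Quiver.Hom.toPath (DotArr.of DArr.p1))))
      (vcomp (wr (gen DotCell.theta) (Quiver.Hom.toPath (DotArr.of DArr.p2)))
        (vcomp (wl (Quiver.Hom.toPath DotArr.d) (dotGen i DCell.s20))
          (vcomp (wr (gen DotCell.theta) (Quiver.Hom.toPath (DotArr.of DArr.p0)))
            (wl (Quiver.Hom.toPath DotArr.d) (dotGen i DCell.s00)))))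
  | unit : DotRel i
      (vcomp (wl (Quiver.Hom.toPath DotArr.d) (dotGen i DCell.n1))
        (wr (gen DotCell.theta) (Quiver.Hom.toPath (DotArr.of DArr.s0))))
      (wl (Quiver.Hom.toPath DotArr.d) (dotGen i DCell.n0))
  | theta_inv (h : i) : DotRel i (vcomp (gen DotCell.theta) (gen (.thetaInv h))) (ofEq rfl)
  | inv_theta (h : i) : DotRel i (vcomp (gen (.thetaInv h)) (gen DotCell.theta)) (ofEq rfl)

/-- The `2`-category `Δ̇_ℓ` (for `i := False`) and the `2`-category `Δ̇` (for `i := True`). -/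
abbrev DeltaDot (i : Prop) : Type := Presented (DotRel i)

/-- The inclusion on objects and arrows, with values in the `2`-category `DeltaDot i`. -/
def deltaInclPre (i : Prop) : DObj ⥤q DeltaDot i where
  obj x := DotObj.of x
  map e := Quiver.Hom.toPath (V := DotObj) (DotArr.of e)

/-- The inclusions `t : Δ_ℓ ⟶ Δ̇_ℓ` and `j : Δ_ℓ ⟶ Δ̇`. -/
def deltaIncl (i : Prop) : StrictPseudofunctor DeltaL (DeltaDot i) :=
  Presented.lift (deltaInclPre i)
    (fun _ _ _ _ x => match x with
      | .s00 => Presented.mk₂ (E := DotRel i) (dotGen i DCell.s00)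
      | .s20 => Presented.mk₂ (E := DotRel i) (dotGen i DCell.s20)
      | .s21 => Presented.mk₂ (E := DotRel i) (dotGen i DCell.s21)
      | .n0 => Presented.mk₂ (E := DotRel i) (dotGen i DCell.n0)
      | .n1 => Presented.mk₂ (E := DotRel i) (dotGen i DCell.n1))
    (fun _ _ _ _ _ _ h => h.elim)

theorem postcomp_id {S : Type u} [Bicategory.{w, v} S] [Bicategory.Strict S] (x s : S) :
    postcomp x (𝟙 s) = 𝟭 (x ⟶ s) :=
  CategoryTheory.Functor.ext (fun f => Bicategory.Strict.comp_id f) (fun f g η => by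
    change η ▷ 𝟙 s = eqToHom _ ≫ η ≫ eqToHom _
    simp [Bicategory.Strict.rightUnitor_eqToIso])

theorem postcomp_comp {S : Type u} [Bicategory.{w, v} S] [Bicategory.Strict S] (x : S) {a b c : S}
    (f : a ⟶ b) (g : b ⟶ c) : postcomp x (f ≫ g) = postcomp x f ⋙ postcomp x g :=
  CategoryTheory.Functor.ext (fun h => (Bicategory.Strict.assoc h f g).symm) (fun h k η => by
    change η ▷ (f ≫ g) = eqToHom _ ≫ (η ▷ f) ▷ g ≫ eqToHom _
    simp [Bicategory.Strict.associator_eqToIso])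

theorem whiskerLeft_whiskerLeft_eq {S : Type u} [Bicategory.{w, v} S] [Bicategory.Strict S]
    {a b c d : S} (h : a ⟶ b) (f : b ⟶ c) {g k : c ⟶ d} (η : g ⟶ k)
    (e : h ≫ f ≫ g = (h ≫ f) ≫ g) (e' : (h ≫ f) ≫ k = h ≫ f ≫ k) :
    h ◁ f ◁ η = eqToHom e ≫ (h ≫ f) ◁ η ≫ eqToHom e' := by
  simp [Bicategory.Strict.associator_eqToIso]

theorem whiskerLeft_whiskerRight_eq {S : Type u} [Bicategory.{w, v} S] [Bicategory.Strict S]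
    {a b c d : S} (h : a ⟶ b) {f g : b ⟶ c} (η : f ⟶ g) (k : c ⟶ d)
    (e : h ≫ f ≫ k = (h ≫ f) ≫ k) (e' : (h ≫ g) ≫ k = h ≫ g ≫ k) :
    h ◁ η ▷ k = eqToHom e ≫ (h ◁ η) ▷ k ≫ eqToHom e' := by
  simp [Bicategory.Strict.associator_eqToIso]

/-- The representable `2`-functor `S(x, -) : S ⟶ Cat` of a `2`-category `S`. -/
def corepr {S : Type u} [Bicategory.{w, v} S] [Bicategory.Strict S] (x : S) :
    StrictPseudofunctor S Cat.{w, v} :=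
  StrictPseudofunctor.mk''
    { obj := fun s => Cat.of (x ⟶ s)
      map := fun f => (postcomp x f).toCatHom
      map₂ := fun η => NatTrans.toCatHom₂ ((postcomposing x _ _).map η)
      map₂_id := fun f => congrArg NatTrans.toCatHom₂ ((postcomposing x _ _).map_id f)
      map₂_comp := fun η θ => congrArg NatTrans.toCatHom₂ ((postcomposing x _ _).map_comp η θ)
      map_id := fun s => congrArg Functor.toCatHom (postcomp_id x s)
      map_comp := fun f g => congrArg Functor.toCatHom (postcomp_comp x f g)
      map₂_whisker_left := fun f _ _ η => by
        ext h
        simp only [Cat.Hom₂.comp_app, Cat.eqToHom_app]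
        exact whiskerLeft_whiskerLeft_eq h f η _ _
      map₂_whisker_right := fun η f => by
        ext h
        simp only [Cat.Hom₂.comp_app, Cat.eqToHom_app]
        exact whiskerLeft_whiskerRight_eq h η f _ _ }

/-- The weights `Δ̇_ℓ(𝟢, t-)` (for `i := False`) and `Δ̇(𝟢, j-)` (for `i := True`). -/
def descentWeight (i : Prop) : StrictPseudofunctor DeltaL Cat.{0, 0} :=
  (deltaIncl i).comp (corepr (S := DeltaDot i) DotObj.zero)

end Delta

section Op

variable {A : Type u} [Bicategory.{w, v} A]

theorem unop2_eqToHom {a b : Aᵒᵖ} {f g : a ⟶ b} (h : f = g) :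
    (eqToHom h).unop2 = eqToHom (congrArg Quiver.Hom.unop h) := by
  subst h; rfl

theorem hom2_ext {a b : Aᵒᵖ} {f g : a ⟶ b} {η θ : f ⟶ g} (h : η.unop2 = θ.unop2) : η = θ := by
  exact congrArg Bicategory.Opposite.Hom2.op2' h

/-- The `1`-cell dual of a `2`-category is a `2`-category. -/
instance opStrict [Bicategory.Strict A] : Bicategory.Strict Aᵒᵖ where
  id_comp f := congrArg Quiver.Hom.op (Bicategory.Strict.comp_id f.unop)
  comp_id f := congrArg Quiver.Hom.op (Bicategory.Strict.id_comp f.unop)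
  assoc f g h := congrArg Quiver.Hom.op (Bicategory.Strict.assoc h.unop g.unop f.unop).symm
  leftUnitor_eqToIso f := Iso.ext (hom2_ext (by
    rw [eqToIso.hom, unop2_eqToHom]
    exact congrArg Iso.hom (Bicategory.Strict.rightUnitor_eqToIso f.unop)))
  rightUnitor_eqToIso f := Iso.ext (hom2_ext (by
    rw [eqToIso.hom, unop2_eqToHom]
    exact congrArg Iso.hom (Bicategory.Strict.leftUnitor_eqToIso f.unop)))
  associator_eqToIso f g h := Iso.ext (hom2_ext (by
    rw [eqToIso.hom, unop2_eqToHom]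
    exact congrArg Iso.inv (Bicategory.Strict.associator_eqToIso h.unop g.unop f.unop)))

/-- A `2`-cell of the `1`-cell dual given by a `2`-cell, up to equalities of `1`-cells. -/
def opCell {a b : Aᵒᵖ} {p q : a ⟶ b} {k l : b.unop ⟶ a.unop} (η : k ⟶ l) (hk : p.unop = k)
    (hl : l = q.unop) : p ⟶ q :=
  Bicategory.Opposite.Hom2.op2' (eqToHom hk ≫ η ≫ eqToHom hl)

end Op

section Weighted

variable {S : Type u} [Bicategory.{w, v} S] [Bicategory.Strict S]
  {A : Type u₁} [Bicategory.{w₁, v₁} A] [Bicategory.Strict A]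

/-- For a weight `W : S ⟶ Cat` and a diagram `D : Sᵒᵖ ⟶ A` (regarded as a `2`-functor
`S ⟶ Aᵒᵖ`, where `ᵒᵖ` reverses only `1`-cells), the `2`-natural transformations
`W ⟶ A(D-, X)`. -/
structure WeightedCocone (W : StrictPseudofunctor S Cat.{w₂, v₂}) (D : StrictPseudofunctor S Aᵒᵖ)
    (X : A) where
  /-- the components -/
  app (s : S) : W.obj s ⥤ ((D.obj s).unop ⟶ X)
  naturality_obj {s t : S} (f : s ⟶ t) (x : W.obj s) :
    (app t).obj ((W.map f).toFunctor.obj x) = (D.map f).unop ≫ (app s).obj x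
  naturality_map {s t : S} (f : s ⟶ t) {x y : W.obj s} (k : x ⟶ y) :
    (app t).map ((W.map f).toFunctor.map k) =
      eqToHom (naturality_obj f x) ≫ (D.map f).unop ◁ (app s).map k ≫
        eqToHom (naturality_obj f y).symm
  naturality₂ {s t : S} {f g : s ⟶ t} (α : f ⟶ g) (x : W.obj s) :
    (app t).map ((W.map₂ α).toNatTrans.app x) =
      eqToHom (naturality_obj f x) ≫
        (D.map₂ α).unop2 ▷ (app s).obj x ≫
          eqToHom (naturality_obj g x).symm

theorem conj_whiskerRight_eq {a b c d : A} {p q : a ⟶ c} {f g : a ⟶ b} {k : b ⟶ c} (η : f ⟶ g)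
    (e : p = f ≫ k) (e' : g ≫ k = q) (h : c ⟶ d) (e₁ : p ≫ h = f ≫ k ≫ h)
    (e₂ : g ≫ k ≫ h = q ≫ h) :
    (eqToHom e ≫ η ▷ k ≫ eqToHom e') ▷ h = eqToHom e₁ ≫ η ▷ (k ≫ h) ≫ eqToHom e₂ := by
  subst e e'
  simp [Bicategory.Strict.associator_eqToIso]

namespace WeightedCocone

variable {W : StrictPseudofunctor S Cat.{w₂, v₂}} {D : StrictPseudofunctor S Aᵒᵖ}

/-- Modifications between `2`-natural transformations `W ⟶ A(D-, X)`. -/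
@[ext]
structure Hom {X : A} (φ ψ : WeightedCocone W D X) where
  /-- the components -/
  app (s : S) : φ.app s ⟶ ψ.app s
  comm {s t : S} (f : s ⟶ t) (x : W.obj s) :
    (app t).app ((W.map f).toFunctor.obj x) =
      eqToHom (φ.naturality_obj f x) ≫
        (D.map f).unop ◁ (app s).app x ≫
          eqToHom (ψ.naturality_obj f x).symm

/-- The category `[S, Cat](W, A(D-, X))`. -/
instance (X : A) : Category (WeightedCocone W D X) where
  Hom φ ψ := Hom φ ψ
  id φ := { app := fun s => 𝟙 (φ.app s), comm := fun f x => by simp }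
  comp Γ Θ := { app := fun s => Γ.app s ≫ Θ.app s, comm := fun f x => by simp [Γ.comm, Θ.comm] }
  id_comp Γ := Hom.ext (funext fun s => Category.id_comp _)
  comp_id Γ := Hom.ext (funext fun s => Category.comp_id _)
  assoc Γ Θ Λ := Hom.ext (funext fun s => Category.assoc _ _ _)

/-- Whiskering a cocone with vertex `c` by a `1`-cell `c ⟶ X`. -/
def post {c : A} (φ : WeightedCocone W D c) {X : A} (h : c ⟶ X) : WeightedCocone W D X where
  app s := φ.app s ⋙ postcomp _ h
  naturality_obj f x :=
    (congrArg (· ≫ h) (φ.naturality_obj f x)).trans (Bicategory.Strict.assoc _ _ _)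
  naturality_map {s t} f {x y} k := by
    change (φ.app t).map ((W.map f).toFunctor.map k) ▷ h =
      eqToHom _ ≫ (D.map f).unop ◁ ((φ.app s).map k ▷ h) ≫ eqToHom _
    rw [φ.naturality_map]
    simp [Bicategory.Strict.associator_eqToIso]
  naturality₂ {s t f g} α x := by
    change (φ.app t).map ((W.map₂ α).toNatTrans.app x) ▷ h =
      eqToHom _ ≫ (D.map₂ α).unop2 ▷ ((φ.app s).obj x ≫ h) ≫ eqToHom _
    rw [φ.naturality₂]
    exact conj_whiskerRight_eq _ _ _ _ _ _

/-- The functor `A(c, X) ⥤ [S, Cat](W, A(D-, X))` induced by a cocone with vertex `c`. -/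
def postFunctor {c : A} (φ : WeightedCocone W D c) (X : A) : (c ⟶ X) ⥤ WeightedCocone W D X where
  obj h := φ.post h
  map {h k} η :=
    { app := fun s => Functor.whiskerLeft (φ.app s) ((postcomposing _ _ _).map η)
      comm := fun {s t} f x => by
        change (φ.app t).obj ((W.map f).toFunctor.obj x) ◁ η =
          eqToHom _ ≫ (D.map f).unop ◁ ((φ.app s).obj x ◁ η) ≫ eqToHom _
        rw [Bicategory.congr_whiskerLeft (φ.naturality_obj f x)]
        simp [Bicategory.Strict.associator_eqToIso] }
  map_id h := Hom.ext (funext fun s => by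
    ext x; exact Bicategory.whiskerLeft_id _ _)
  map_comp η θ := Hom.ext (funext fun s => by
    ext x; exact Bicategory.whiskerLeft_comp _ _ _)

/-- A cocone is universal if, for every `X`, the induced functor
`A(c, X) ⥤ [S, Cat](W, A(D-, X))` is an isomorphism of categories. -/
def IsUniversal {c : A} (φ : WeightedCocone W D c) : Prop :=
  ∀ X : A, ∃ G : WeightedCocone W D X ⥤ (c ⟶ X),
    φ.postFunctor X ⋙ G = 𝟭 _ ∧ G ⋙ φ.postFunctor X = 𝟭 _

end WeightedCocone

/-- `c` is the (strict) weighted colimit of `D` with weight `W`. -/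
def IsWeightedColimit (W : StrictPseudofunctor S Cat.{w₂, v₂}) (D : StrictPseudofunctor S Aᵒᵖ)
    (c : A) : Prop :=
  ∃ φ : WeightedCocone W D c, φ.IsUniversal

/-- `c` is the strict lax codescent object of `D`. -/
def IsStrictLaxCodescentObject (D : StrictPseudofunctor DeltaL Aᵒᵖ) (c : A) : Prop :=
  IsWeightedColimit (descentWeight False) D c

/-- `c` is the strict codescent object of `D`. -/
def IsStrictCodescentObject (D : StrictPseudofunctor DeltaL Aᵒᵖ) (c : A) : Prop :=
  IsWeightedColimit (descentWeight True) D c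

end Weighted

section Strict

variable {B : Type u} [Bicategory.{w, v} B] {C : Type u₁} [Bicategory.{w₁, v₁} C]

theorem map_comp_whiskerLeft_eq (F : StrictPseudofunctor B C) [Bicategory.Strict C] {a b c : B}
    (f : a ⟶ b) (g : b ⟶ c) {d : C} {h k : F.obj c ⟶ d} (η : h ⟶ k) :
    F.map (f ≫ g) ◁ η = eqToHom (by rw [F.map_comp, Bicategory.Strict.assoc]) ≫
      F.map f ◁ F.map g ◁ η ≫ eqToHom (by rw [F.map_comp, Bicategory.Strict.assoc]) := by
  rw [Bicategory.congr_whiskerLeft (F.map_comp f g)]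
  simp [Bicategory.Strict.associator_eqToIso]

end Strict

/-- A `2`-monad on a `2`-category: a `2`-functor with `2`-natural multiplication and unit. -/
structure TwoMonad (B : Type u) [Bicategory.{w, v} B] [Bicategory.Strict B] where
  /-- the underlying `2`-functor -/
  T : StrictPseudofunctor B B
  /-- the multiplication -/
  mul (X : B) : T.obj (T.obj X) ⟶ T.obj X
  mul_naturality {X Y : B} (f : X ⟶ Y) : T.map (T.map f) ≫ mul Y = mul X ≫ T.map f
  mul_naturality₂ {X Y : B} {f g : X ⟶ Y} (η : f ⟶ g) :
    T.map₂ (T.map₂ η) ▷ mul Y =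
      eqToHom (mul_naturality f) ≫ mul X ◁ T.map₂ η ≫ eqToHom (mul_naturality g).symm
  /-- the unit -/
  unit (X : B) : X ⟶ T.obj X
  unit_naturality {X Y : B} (f : X ⟶ Y) : f ≫ unit Y = unit X ≫ T.map f
  unit_naturality₂ {X Y : B} {f g : X ⟶ Y} (η : f ⟶ g) :
    η ▷ unit Y =
      eqToHom (unit_naturality f) ≫ unit X ◁ T.map₂ η ≫ eqToHom (unit_naturality g).symm
  mul_assoc (X : B) : T.map (mul X) ≫ mul X = mul (T.obj X) ≫ mul X
  unit_mul (X : B) : unit (T.obj X) ≫ mul X = 𝟙 (T.obj X)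
  map_unit_mul (X : B) : T.map (unit X) ≫ mul X = 𝟙 (T.obj X)

/-- A `2`-adjunction `L ⊣ R`: `2`-natural unit and counit satisfying the triangle identities. -/
structure TwoAdjunction {A : Type u₁} [Bicategory.{w₁, v₁} A] [Bicategory.Strict A]
    {B : Type u} [Bicategory.{w, v} B] [Bicategory.Strict B]
    (L : StrictPseudofunctor B A) (R : StrictPseudofunctor A B) where
  /-- the unit -/
  unit (X : B) : X ⟶ R.obj (L.obj X)
  unit_naturality {X Y : B} (f : X ⟶ Y) : f ≫ unit Y = unit X ≫ R.map (L.map f)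
  unit_naturality₂ {X Y : B} {f g : X ⟶ Y} (η : f ⟶ g) :
    η ▷ unit Y =
      eqToHom (unit_naturality f) ≫ unit X ◁ R.map₂ (L.map₂ η) ≫ eqToHom (unit_naturality g).symm
  /-- the counit -/
  counit (X : A) : L.obj (R.obj X) ⟶ X
  counit_naturality {X Y : A} (f : X ⟶ Y) : L.map (R.map f) ≫ counit Y = counit X ≫ f
  counit_naturality₂ {X Y : A} {f g : X ⟶ Y} (η : f ⟶ g) :
    L.map₂ (R.map₂ η) ▷ counit Y =
      eqToHom (counit_naturality f) ≫ counit X ◁ η ≫ eqToHom (counit_naturality g).symm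
  left_triangle (X : B) : L.map (unit X) ≫ counit (L.obj X) = 𝟙 (L.obj X)
  right_triangle (X : A) : unit (R.obj X) ≫ R.map (counit X) = 𝟙 (R.obj X)

section LaxAlgebras

variable {B : Type u} [Bicategory.{w, v} B] [Bicategory.Strict B]

namespace TwoMonad

variable (M : TwoMonad B)

theorem map_map_comp {X Y Z : B} (f : X ⟶ Y) (g : Y ⟶ Z) {W : B} (k : M.T.obj Z ⟶ W) :
    M.T.map (f ≫ g) ≫ k = M.T.map f ≫ M.T.map g ≫ k := by
  rw [M.T.map_comp, Bicategory.Strict.assoc]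

theorem mul_naturality_assoc {X Y : B} (f : X ⟶ Y) {W : B} (k : M.T.obj Y ⟶ W) :
    M.T.map (M.T.map f) ≫ M.mul Y ≫ k = M.mul X ≫ M.T.map f ≫ k := by
  rw [← Bicategory.Strict.assoc, M.mul_naturality, Bicategory.Strict.assoc]

theorem unit_naturality_assoc {X Y : B} (f : X ⟶ Y) {W : B} (k : M.T.obj Y ⟶ W) :
    f ≫ M.unit Y ≫ k = M.unit X ≫ M.T.map f ≫ k := by
  rw [← Bicategory.Strict.assoc, M.unit_naturality, Bicategory.Strict.assoc]

theorem mul_assoc_assoc {X W : B} (k : M.T.obj X ⟶ W) :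
    M.T.map (M.mul X) ≫ M.mul X ≫ k = M.mul (M.T.obj X) ≫ M.mul X ≫ k := by
  rw [← Bicategory.Strict.assoc, M.mul_assoc, Bicategory.Strict.assoc]

theorem unit_mul_assoc {X W : B} (k : M.T.obj X ⟶ W) :
    M.unit (M.T.obj X) ≫ M.mul X ≫ k = k := by
  rw [← Bicategory.Strict.assoc, M.unit_mul, Bicategory.Strict.id_comp]

theorem map_unit_mul_assoc {X W : B} (k : M.T.obj X ⟶ W) :
    M.T.map (M.unit X) ≫ M.mul X ≫ k = k := by
  rw [← Bicategory.Strict.assoc, M.map_unit_mul, Bicategory.Strict.id_comp]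

theorem map_id_comp {X W : B} (k : M.T.obj X ⟶ W) : M.T.map (𝟙 X) ≫ k = k := by
  rw [M.T.map_id, Bicategory.Strict.id_comp]

theorem mul_swap {X Y : B} (f : X ⟶ Y) {W : B} {k l : M.T.obj Y ⟶ W} (η : k ⟶ l) :
    M.mul X ◁ M.T.map f ◁ η = eqToHom (M.mul_naturality_assoc f k).symm ≫
      M.T.map (M.T.map f) ◁ M.mul Y ◁ η ≫ eqToHom (M.mul_naturality_assoc f l) := by
  have h := Bicategory.congr_whiskerLeft (M.mul_naturality f) η
  simp only [comp_whiskerLeft, Bicategory.Strict.associator_eqToIso, eqToIso.hom, eqToIso.inv,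
    Category.assoc, eqToHom_trans, eqToHom_trans_assoc] at h
  rw [eqToHom_comp_iff, comp_eqToHom_iff] at h
  rw [h]
  simp

theorem unit_swap {X Y : B} (f : X ⟶ Y) {W : B} {k l : M.T.obj Y ⟶ W} (η : k ⟶ l) :
    M.unit X ◁ M.T.map f ◁ η = eqToHom (M.unit_naturality_assoc f k).symm ≫
      f ◁ M.unit Y ◁ η ≫ eqToHom (M.unit_naturality_assoc f l) := by
  have h := Bicategory.congr_whiskerLeft (M.unit_naturality f) η
  simp only [comp_whiskerLeft, Bicategory.Strict.associator_eqToIso, eqToIso.hom, eqToIso.inv,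
    Category.assoc, eqToHom_trans, eqToHom_trans_assoc] at h
  rw [eqToHom_comp_iff, comp_eqToHom_iff] at h
  rw [h]
  simp

end TwoMonad

/-- Lax algebras of a `2`-monad. Composites of `1`-cells are written in diagrammatic order. -/
structure LaxAlg (M : TwoMonad B) where
  /-- the underlying object `Z` -/
  carrier : B
  /-- the structure `1`-cell `a : T Z ⟶ Z` -/
  act : M.T.obj carrier ⟶ carrier
  /-- the `2`-cell `a T(a) ⇒ a m` -/
  mulCell : M.T.map act ≫ act ⟶ M.mul carrier ≫ act
  /-- the `2`-cell `id ⇒ a η` -/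
  unitCell : 𝟙 carrier ⟶ M.unit carrier ≫ act
  assoc :
    eqToHom (M.map_map_comp _ _ _).symm ≫ M.T.map₂ mulCell ▷ act ≫
        eqToHom (M.map_map_comp _ _ _) ≫ M.T.map (M.mul carrier) ◁ mulCell ≫
          eqToHom (M.mul_assoc_assoc act) =
      M.T.map (M.T.map act) ◁ mulCell ≫ eqToHom (M.mul_naturality_assoc act act) ≫
        M.mul (M.T.obj carrier) ◁ mulCell
  left_unit :
    eqToHom (Bicategory.Strict.comp_id act).symm ≫ act ◁ unitCell ≫
        eqToHom (M.unit_naturality_assoc act act) ≫ M.unit (M.T.obj carrier) ◁ mulCell ≫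
          eqToHom (M.unit_mul_assoc act) = 𝟙 act
  right_unit :
    eqToHom (M.map_id_comp act).symm ≫ M.T.map₂ unitCell ▷ act ≫
        eqToHom (M.map_map_comp _ _ _) ≫ M.T.map (M.unit carrier) ◁ mulCell ≫
          eqToHom (M.map_unit_mul_assoc act) = 𝟙 act

namespace LaxAlg

variable {M : TwoMonad B}

/-- Lax morphisms `(f, ⟨f⟩)` of lax algebras, with `⟨f⟩ : a_z T(f) ⇒ f a_y`. -/
structure Mor (y z : LaxAlg M) where
  /-- the underlying `1`-cell -/
  hom : y.carrier ⟶ z.carrier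
  /-- the structure `2`-cell -/
  cell : M.T.map hom ≫ z.act ⟶ y.act ≫ hom
  mul_cell :
    M.T.map (M.T.map hom) ◁ z.mulCell ≫ eqToHom (M.mul_naturality_assoc hom z.act) ≫
        M.mul y.carrier ◁ cell =
      eqToHom (M.map_map_comp _ _ _).symm ≫ M.T.map₂ cell ▷ z.act ≫
        eqToHom (M.map_map_comp _ _ _) ≫ M.T.map y.act ◁ cell ≫
          eqToHom (Bicategory.Strict.assoc _ _ _).symm ≫ y.mulCell ▷ hom ≫
            eqToHom (Bicategory.Strict.assoc _ _ _)
  unit_cell :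
    eqToHom (Bicategory.Strict.comp_id hom).symm ≫ hom ◁ z.unitCell ≫
        eqToHom (M.unit_naturality_assoc hom z.act) ≫ M.unit y.carrier ◁ cell =
      eqToHom (Bicategory.Strict.id_comp hom).symm ≫ y.unitCell ▷ hom ≫
        eqToHom (Bicategory.Strict.assoc _ _ _)

/-- `T`-transformations between lax morphisms. -/
@[ext]
structure Mor₂ {y z : LaxAlg M} (f h : Mor y z) where
  /-- the underlying `2`-cell -/
  hom : f.hom ⟶ h.hom
  comm : M.T.map₂ hom ▷ z.act ≫ h.cell = f.cell ≫ y.act ◁ hom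

/-- The identity morphism. -/
def Mor.id (y : LaxAlg M) : Mor y y where
  hom := 𝟙 y.carrier
  cell := eqToHom ((M.map_id_comp y.act).trans (Bicategory.Strict.comp_id y.act).symm)
  mul_cell := by
    rw [Bicategory.congr_whiskerLeft (show M.T.map (M.T.map (𝟙 y.carrier)) = 𝟙 _ by
      rw [M.T.map_id, M.T.map_id])]
    simp [PrelaxFunctor.map₂_eqToHom, Bicategory.Strict.leftUnitor_eqToIso,
      Bicategory.Strict.rightUnitor_eqToIso]
  unit_cell := by
    simp [Bicategory.Strict.leftUnitor_eqToIso, Bicategory.Strict.rightUnitor_eqToIso]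

/-- Composition of lax morphisms. -/
def Mor.comp {x y z : LaxAlg M} (f : Mor x y) (g : Mor y z) : Mor x z where
  hom := f.hom ≫ g.hom
  cell := eqToHom (M.map_map_comp _ _ _) ≫ M.T.map f.hom ◁ g.cell ≫
    eqToHom (Bicategory.Strict.assoc _ _ _).symm ≫ f.cell ▷ g.hom ≫
      eqToHom (Bicategory.Strict.assoc _ _ _)
  mul_cell := by
    have e₁ : M.T.map (M.T.map f.hom) ≫ M.mul y.carrier ≫ y.act ≫ g.hom =
        (M.mul x.carrier ≫ M.T.map f.hom ≫ y.act) ≫ g.hom := by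
      simp only [M.mul_naturality_assoc, Bicategory.Strict.assoc]
    have e₂ : (M.mul x.carrier ≫ x.act ≫ f.hom) ≫ g.hom =
        M.mul x.carrier ≫ x.act ≫ f.hom ≫ g.hom := by
      simp only [Bicategory.Strict.assoc]
    have e₃ : M.T.map (M.T.map (f.hom ≫ g.hom)) ≫ M.T.map z.act ≫ z.act =
        M.T.map (M.T.map f.hom) ≫ M.T.map (M.T.map g.hom ≫ z.act) ≫ z.act := by
      simp only [M.T.map_comp, Bicategory.Strict.assoc]
    have e₄ : M.T.map (M.T.map f.hom) ≫ M.T.map (y.act ≫ g.hom) ≫ z.act =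
        M.T.map (M.T.map f.hom ≫ y.act) ≫ M.T.map g.hom ≫ z.act := by
      simp only [M.T.map_comp, Bicategory.Strict.assoc]
    have e₅ : M.T.map (M.T.map f.hom ≫ y.act) ≫ y.act ≫ g.hom =
        (M.T.map (M.T.map f.hom) ≫ M.T.map y.act ≫ y.act) ≫ g.hom := by
      simp only [M.T.map_comp, Bicategory.Strict.assoc]
    have e₆ : M.T.map (x.act ≫ f.hom) ≫ y.act ≫ g.hom =
        (M.T.map x.act ≫ M.T.map f.hom ≫ y.act) ≫ g.hom := by
      simp only [M.T.map_comp, Bicategory.Strict.assoc]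
    have e₇ : (M.T.map x.act ≫ x.act ≫ f.hom) ≫ g.hom =
        ((M.T.map x.act ≫ x.act) ≫ f.hom) ≫ g.hom := by
      simp only [Bicategory.Strict.assoc]
    have e₈ : ((M.mul x.carrier ≫ x.act) ≫ f.hom) ≫ g.hom =
        M.mul x.carrier ≫ x.act ≫ f.hom ≫ g.hom := by
      simp only [Bicategory.Strict.assoc]
    have e₀ : M.T.map (M.T.map (f.hom ≫ g.hom)) =
        M.T.map (M.T.map f.hom) ≫ M.T.map (M.T.map g.hom) := by
      rw [M.T.map_comp, M.T.map_comp]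
    calc
      _ = eqToHom (by rw [e₀, Bicategory.Strict.assoc]) ≫
          (M.T.map (M.T.map f.hom) ◁ (M.T.map (M.T.map g.hom) ◁ z.mulCell ≫
            eqToHom (M.mul_naturality_assoc g.hom z.act) ≫ M.mul y.carrier ◁ g.cell)) ≫
          eqToHom e₁ ≫ (M.mul x.carrier ◁ f.cell) ▷ g.hom ≫ eqToHom e₂ := by
        rw [Bicategory.congr_whiskerLeft e₀]
        simp [Bicategory.Strict.associator_eqToIso, M.mul_swap]
      _ = eqToHom e₃ ≫ M.T.map (M.T.map f.hom) ◁ (M.T.map₂ g.cell ▷ z.act) ≫ eqToHom e₄ ≫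
          M.T.map (M.T.map f.hom ≫ y.act) ◁ g.cell ≫ eqToHom e₅ ≫
          (M.T.map (M.T.map f.hom) ◁ y.mulCell ≫
            eqToHom (M.mul_naturality_assoc f.hom y.act) ≫ M.mul x.carrier ◁ f.cell) ▷ g.hom ≫
          eqToHom e₂ := by
        rw [g.mul_cell]
        simp [Bicategory.Strict.associator_eqToIso, map_comp_whiskerLeft_eq]
      _ = eqToHom e₃ ≫ M.T.map (M.T.map f.hom) ◁ (M.T.map₂ g.cell ▷ z.act) ≫ eqToHom e₄ ≫
          (M.T.map (M.T.map f.hom ≫ y.act) ◁ g.cell ≫ M.T.map₂ f.cell ▷ (y.act ≫ g.hom)) ≫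
          eqToHom e₆ ≫ (M.T.map x.act ◁ f.cell) ▷ g.hom ≫ eqToHom e₇ ≫
          (x.mulCell ▷ f.hom) ▷ g.hom ≫ eqToHom e₈ := by
        rw [f.mul_cell]
        simp [Bicategory.Strict.associator_eqToIso]
      _ = _ := by
        rw [whisker_exchange]
        simp [Bicategory.Strict.associator_eqToIso, map_comp_whiskerLeft_eq,
          M.T.mapComp_eq_eqToIso, PrelaxFunctor.map₂_eqToHom]
  unit_cell := by
    calc
      _ = (f.hom ◁ (eqToHom (Bicategory.Strict.comp_id g.hom).symm ≫ g.hom ◁ z.unitCell ≫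
            eqToHom (M.unit_naturality_assoc g.hom z.act) ≫ M.unit y.carrier ◁ g.cell)) ≫
          eqToHom (by rw [M.unit_naturality_assoc, ← Bicategory.Strict.assoc (M.T.map _),
            ← Bicategory.Strict.assoc (M.unit _)]) ≫ (M.unit x.carrier ◁ f.cell) ▷ g.hom ≫
          eqToHom (by simp only [Bicategory.Strict.assoc]) := by
        simp [Bicategory.Strict.associator_eqToIso, M.unit_swap]
      _ = eqToHom rfl ≫ (eqToHom (Bicategory.Strict.comp_id f.hom).symm ≫ f.hom ◁ y.unitCell ≫
            eqToHom (M.unit_naturality_assoc f.hom y.act) ≫ M.unit x.carrier ◁ f.cell) ▷ g.hom ≫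
          eqToHom (by simp only [Bicategory.Strict.assoc]) := by
        rw [g.unit_cell]
        simp [Bicategory.Strict.associator_eqToIso]
      _ = _ := by
        rw [f.unit_cell]
        simp [Bicategory.Strict.associator_eqToIso]

instance : CategoryStruct (LaxAlg M) where
  Hom := Mor
  id := Mor.id
  comp := Mor.comp

instance homCategory (y z : LaxAlg M) : Category (y ⟶ z) where
  Hom f h := Mor₂ f h
  id f := { hom := 𝟙 f.hom, comm := by simp }
  comp η θ :=
    { hom := η.hom ≫ θ.hom
      comm := by
        rw [M.T.map₂_comp, comp_whiskerRight, Category.assoc, θ.comm, ← Category.assoc, η.comm,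
          Category.assoc, ← whiskerLeft_comp] }
  id_comp η := Mor₂.ext (Category.id_comp _)
  comp_id η := Mor₂.ext (Category.comp_id _)
  assoc η θ κ := Mor₂.ext (Category.assoc _ _ _)

/-- An equality of underlying `1`-cells compatible with the structure `2`-cells gives an equality
of morphisms. -/
theorem Mor.ext_of_eqToHom {y z : LaxAlg M} {f g : y ⟶ z} (h : f.hom = g.hom)
    (e : M.T.map₂ (eqToHom h) ▷ z.act ≫ g.cell = f.cell ≫ y.act ◁ eqToHom h) : f = g := by
  obtain ⟨f, c, _, _⟩ := f
  obtain ⟨g, c', _, _⟩ := g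
  obtain rfl : f = g := h
  obtain rfl : c' = c := by simpa using e
  rfl

/-- An invertible `T`-transformation from an invertible `2`-cell. -/
def isoMk {y z : LaxAlg M} {f g : y ⟶ z} (i : f.hom ≅ g.hom)
    (e : M.T.map₂ i.hom ▷ z.act ≫ g.cell = f.cell ≫ y.act ◁ i.hom) : f ≅ g where
  hom := ⟨i.hom, e⟩
  inv := ⟨i.inv, by
    have h : M.T.map₂ i.inv ▷ z.act ≫ M.T.map₂ i.hom ▷ z.act = 𝟙 _ := by
      rw [← comp_whiskerRight, ← M.T.map₂_comp, i.inv_hom_id]; simp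
    have h' : y.act ◁ i.hom ≫ y.act ◁ i.inv = 𝟙 _ := by
      rw [← whiskerLeft_comp, i.hom_inv_id]; simp
    calc
      _ = M.T.map₂ i.inv ▷ z.act ≫ (f.cell ≫ y.act ◁ i.hom) ≫ y.act ◁ i.inv := by
        rw [Category.assoc, h', Category.comp_id]
      _ = _ := by rw [← e, Category.assoc, ← Category.assoc, h, Category.id_comp]⟩
  hom_inv_id := Mor₂.ext i.hom_inv_id
  inv_hom_id := Mor₂.ext i.inv_hom_id

theorem assoc_comm {x y z t : LaxAlg M} (f : x ⟶ y) (g : y ⟶ z) (h : z ⟶ t) :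
    M.T.map₂ (α_ f.hom g.hom h.hom).hom ▷ t.act ≫ (Mor.comp f (Mor.comp g h)).cell =
      (Mor.comp (Mor.comp f g) h).cell ≫ x.act ◁ (α_ f.hom g.hom h.hom).hom := by
  simp [Mor.comp, Bicategory.Strict.associator_eqToIso, PrelaxFunctor.map₂_eqToHom,
    map_comp_whiskerLeft_eq]

theorem left_unit_comm {y z : LaxAlg M} (f : y ⟶ z) :
    M.T.map₂ (λ_ f.hom).hom ▷ z.act ≫ f.cell =
      (Mor.comp (Mor.id y) f).cell ≫ y.act ◁ (λ_ f.hom).hom := by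
  simp [Mor.comp, Mor.id, Bicategory.Strict.leftUnitor_eqToIso, PrelaxFunctor.map₂_eqToHom,
    Bicategory.congr_whiskerLeft (M.T.map_id y.carrier)]

theorem right_unit_comm {y z : LaxAlg M} (f : y ⟶ z) :
    M.T.map₂ (ρ_ f.hom).hom ▷ z.act ≫ f.cell =
      (Mor.comp f (Mor.id z)).cell ≫ y.act ◁ (ρ_ f.hom).hom := by
  simp [Mor.comp, Mor.id, Bicategory.Strict.rightUnitor_eqToIso, PrelaxFunctor.map₂_eqToHom]

theorem whiskerLeft_comm {x y z : LaxAlg M} (f : x ⟶ y) {g h : y ⟶ z} (η : g ⟶ h) :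
    M.T.map₂ (f.hom ◁ η.hom) ▷ z.act ≫ (Mor.comp f h).cell =
      (Mor.comp f g).cell ≫ x.act ◁ f.hom ◁ η.hom := by
  have e₁ : M.T.map (f.hom ≫ g.hom) ≫ z.act = M.T.map f.hom ≫ M.T.map g.hom ≫ z.act :=
    M.map_map_comp _ _ _
  have e₂ : M.T.map f.hom ≫ y.act ≫ h.hom = (M.T.map f.hom ≫ y.act) ≫ h.hom :=
    (Bicategory.Strict.assoc _ _ _).symm
  have e₃ : (x.act ≫ f.hom) ≫ h.hom = x.act ≫ f.hom ≫ h.hom := Bicategory.Strict.assoc _ _ _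
  have e₄ : M.T.map f.hom ≫ y.act ≫ g.hom = (M.T.map f.hom ≫ y.act) ≫ g.hom :=
    (Bicategory.Strict.assoc _ _ _).symm
  calc
    _ = eqToHom e₁ ≫ M.T.map f.hom ◁ (M.T.map₂ η.hom ▷ z.act ≫ h.cell) ≫ eqToHom e₂ ≫
        f.cell ▷ h.hom ≫ eqToHom e₃ := by
      simp [Mor.comp, Bicategory.Strict.associator_eqToIso, M.T.mapComp_eq_eqToIso]
    _ = eqToHom e₁ ≫ M.T.map f.hom ◁ g.cell ≫ eqToHom e₄ ≫
        ((M.T.map f.hom ≫ y.act) ◁ η.hom ≫ f.cell ▷ h.hom) ≫ eqToHom e₃ := by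
      rw [η.comm]
      simp [Bicategory.Strict.associator_eqToIso]
    _ = _ := by
      rw [whisker_exchange]
      simp [Mor.comp, Bicategory.Strict.associator_eqToIso]

theorem whiskerRight_comm {x y z : LaxAlg M} {f g : x ⟶ y} (η : f ⟶ g) (h : y ⟶ z) :
    M.T.map₂ (η.hom ▷ h.hom) ▷ z.act ≫ (Mor.comp g h).cell =
      (Mor.comp f h).cell ≫ x.act ◁ η.hom ▷ h.hom := by
  have e₁ : M.T.map (f.hom ≫ h.hom) ≫ z.act = M.T.map f.hom ≫ M.T.map h.hom ≫ z.act :=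
    M.map_map_comp _ _ _
  have e₂ : M.T.map g.hom ≫ y.act ≫ h.hom = (M.T.map g.hom ≫ y.act) ≫ h.hom :=
    (Bicategory.Strict.assoc _ _ _).symm
  have e₃ : (x.act ≫ g.hom) ≫ h.hom = x.act ≫ g.hom ≫ h.hom := Bicategory.Strict.assoc _ _ _
  have e₄ : M.T.map f.hom ≫ y.act ≫ h.hom = (M.T.map f.hom ≫ y.act) ≫ h.hom :=
    (Bicategory.Strict.assoc _ _ _).symm
  calc
    _ = eqToHom e₁ ≫ (M.T.map₂ η.hom ▷ (M.T.map h.hom ≫ z.act) ≫ M.T.map g.hom ◁ h.cell) ≫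
        eqToHom e₂ ≫ g.cell ▷ h.hom ≫ eqToHom e₃ := by
      simp [Mor.comp, Bicategory.Strict.associator_eqToIso, M.T.mapComp_eq_eqToIso]
    _ = eqToHom e₁ ≫ M.T.map f.hom ◁ h.cell ≫ eqToHom e₄ ≫
        (M.T.map₂ η.hom ▷ y.act ≫ g.cell) ▷ h.hom ≫ eqToHom e₃ := by
      rw [← whisker_exchange]
      simp [Bicategory.Strict.associator_eqToIso]
    _ = _ := by
      rw [η.comm]
      simp [Mor.comp, Bicategory.Strict.associator_eqToIso]

/-- The `2`-category `Lax-T-Alg_ℓ` of lax algebras, lax morphisms and `T`-transformations. -/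
instance bicategory : Bicategory (LaxAlg M) where
  homCategory := homCategory
  whiskerLeft f _ _ η :=
    { hom := f.hom ◁ η.hom
      comm := whiskerLeft_comm f η }
  whiskerRight η h :=
    { hom := η.hom ▷ h.hom
      comm := whiskerRight_comm η h }
  associator f g h := isoMk (α_ f.hom g.hom h.hom) (assoc_comm f g h)
  leftUnitor f := isoMk (λ_ f.hom) (left_unit_comm f)
  rightUnitor f := isoMk (ρ_ f.hom) (right_unit_comm f)
  whiskerLeft_id _ _ := Mor₂.ext (Bicategory.whiskerLeft_id _ _)
  whiskerLeft_comp _ _ _ _ _ _ := Mor₂.ext (Bicategory.whiskerLeft_comp _ _ _)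
  id_whiskerLeft _ := Mor₂.ext (Bicategory.id_whiskerLeft _)
  comp_whiskerLeft _ _ _ _ _ := Mor₂.ext (Bicategory.comp_whiskerLeft _ _ _)
  id_whiskerRight _ _ := Mor₂.ext (Bicategory.id_whiskerRight _ _)
  comp_whiskerRight _ _ _ := Mor₂.ext (Bicategory.comp_whiskerRight _ _ _)
  whiskerRight_id _ := Mor₂.ext (Bicategory.whiskerRight_id _)
  whiskerRight_comp _ _ _ := Mor₂.ext (Bicategory.whiskerRight_comp _ _ _)
  whisker_assoc _ _ _ _ _ := Mor₂.ext (Bicategory.whisker_assoc _ _ _)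
  whisker_exchange _ _ := Mor₂.ext (Bicategory.whisker_exchange _ _)
  pentagon _ _ _ _ := Mor₂.ext (Bicategory.pentagon _ _ _ _)
  triangle _ _ := Mor₂.ext (Bicategory.triangle _ _)

theorem eqToHom_hom {y z : LaxAlg M} {f g : y ⟶ z} (h : f = g) :
    (eqToHom h).hom = eqToHom (congrArg Mor.hom h) := by
  subst h; rfl

theorem strict_aux {y z : LaxAlg M} {f g : y ⟶ z} (i : f ≅ g) (h : f.hom = g.hom)
    (hi : i.hom.hom = eqToHom h) : ∃ e : f = g, i = eqToIso e := by
  have e : f = g := Mor.ext_of_eqToHom h (by rw [← hi]; exact i.hom.comm)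
  refine ⟨e, Iso.ext (Mor₂.ext ?_)⟩
  rw [hi, eqToIso.hom, eqToHom_hom]

theorem strict_assoc {x y z t : LaxAlg M} (f : x ⟶ y) (g : y ⟶ z) (h : z ⟶ t) :
    ∃ e : (f ≫ g) ≫ h = f ≫ g ≫ h, α_ f g h = eqToIso e :=
  strict_aux _ (Bicategory.Strict.assoc f.hom g.hom h.hom)
    (congrArg Iso.hom (Bicategory.Strict.associator_eqToIso f.hom g.hom h.hom))

theorem strict_id_comp {y z : LaxAlg M} (f : y ⟶ z) : ∃ e : 𝟙 y ≫ f = f, λ_ f = eqToIso e :=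
  strict_aux _ (Bicategory.Strict.id_comp f.hom)
    (congrArg Iso.hom (Bicategory.Strict.leftUnitor_eqToIso f.hom))

theorem strict_comp_id {y z : LaxAlg M} (f : y ⟶ z) : ∃ e : f ≫ 𝟙 z = f, ρ_ f = eqToIso e :=
  strict_aux _ (Bicategory.Strict.comp_id f.hom)
    (congrArg Iso.hom (Bicategory.Strict.rightUnitor_eqToIso f.hom))

instance : Bicategory.Strict (LaxAlg M) where
  id_comp f := (strict_id_comp f).1
  comp_id f := (strict_comp_id f).1
  assoc f g h := (strict_assoc f g h).1
  leftUnitor_eqToIso f := (strict_id_comp f).2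
  rightUnitor_eqToIso f := (strict_comp_id f).2
  associator_eqToIso f g h := (strict_assoc f g h).2

end LaxAlg

end LaxAlgebras

section LocallyFull

variable {B : Type u} [Bicategory.{w, v} B]

/-- A class of `1`-cells closed under identities and composition. -/
structure OneCells (B : Type u) [Bicategory.{w, v} B] where
  /-- membership -/
  mem : ∀ {a b : B}, (a ⟶ b) → Prop
  id_mem : ∀ a : B, mem (𝟙 a)
  comp_mem : ∀ {a b c : B} (f : a ⟶ b) (g : b ⟶ c), mem f → mem g → mem (f ≫ g)

/-- The locally full sub-`2`-category with all objects and the `1`-cells in the class `P`. -/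
@[ext]
structure LocallyFull (P : OneCells B) where
  /-- the underlying object -/
  obj : B

namespace LocallyFull

variable {P : OneCells B}

/-- The `1`-cells in `P`. -/
@[ext]
structure Mor (a b : LocallyFull P) where
  /-- the underlying `1`-cell -/
  hom : a.obj ⟶ b.obj
  mem : P.mem hom

instance : CategoryStruct (LocallyFull P) where
  Hom := Mor
  id a := ⟨𝟙 a.obj, P.id_mem _⟩
  comp f g := ⟨f.hom ≫ g.hom, P.comp_mem _ _ f.mem g.mem⟩

/-- All `2`-cells between `1`-cells in `P`. -/
@[ext]
structure Mor₂ {a b : LocallyFull P} (f g : a ⟶ b) where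
  /-- the underlying `2`-cell -/
  hom : f.hom ⟶ g.hom

instance homCategory (a b : LocallyFull P) : Category (a ⟶ b) where
  Hom f g := Mor₂ f g
  id f := ⟨𝟙 f.hom⟩
  comp η θ := ⟨η.hom ≫ θ.hom⟩
  id_comp _ := Mor₂.ext (Category.id_comp _)
  comp_id _ := Mor₂.ext (Category.comp_id _)
  assoc _ _ _ := Mor₂.ext (Category.assoc _ _ _)

/-- Invertible `2`-cells. -/
def isoMk {a b : LocallyFull P} {f g : a ⟶ b} (i : f.hom ≅ g.hom) : f ≅ g where
  hom := ⟨i.hom⟩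
  inv := ⟨i.inv⟩
  hom_inv_id := Mor₂.ext i.hom_inv_id
  inv_hom_id := Mor₂.ext i.inv_hom_id

instance bicategory : Bicategory (LocallyFull P) where
  homCategory := homCategory
  whiskerLeft f _ _ η := ⟨f.hom ◁ η.hom⟩
  whiskerRight η h := ⟨η.hom ▷ h.hom⟩
  associator f g h := isoMk (α_ f.hom g.hom h.hom)
  leftUnitor f := isoMk (λ_ f.hom)
  rightUnitor f := isoMk (ρ_ f.hom)
  whiskerLeft_id _ _ := Mor₂.ext (Bicategory.whiskerLeft_id _ _)
  whiskerLeft_comp _ _ _ _ _ _ := Mor₂.ext (Bicategory.whiskerLeft_comp _ _ _)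
  id_whiskerLeft _ := Mor₂.ext (Bicategory.id_whiskerLeft _)
  comp_whiskerLeft _ _ _ _ _ := Mor₂.ext (Bicategory.comp_whiskerLeft _ _ _)
  id_whiskerRight _ _ := Mor₂.ext (Bicategory.id_whiskerRight _ _)
  comp_whiskerRight _ _ _ := Mor₂.ext (Bicategory.comp_whiskerRight _ _ _)
  whiskerRight_id _ := Mor₂.ext (Bicategory.whiskerRight_id _)
  whiskerRight_comp _ _ _ := Mor₂.ext (Bicategory.whiskerRight_comp _ _ _)
  whisker_assoc _ _ _ _ _ := Mor₂.ext (Bicategory.whisker_assoc _ _ _)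
  whisker_exchange _ _ := Mor₂.ext (Bicategory.whisker_exchange _ _)
  pentagon _ _ _ _ := Mor₂.ext (Bicategory.pentagon _ _ _ _)
  triangle _ _ := Mor₂.ext (Bicategory.triangle _ _)

theorem comp_hom {a b : LocallyFull P} {f g h : a ⟶ b} (η : f ⟶ g) (θ : g ⟶ h) :
    (η ≫ θ).hom = η.hom ≫ θ.hom := rfl

theorem eqToHom_hom {a b : LocallyFull P} {f g : a ⟶ b} (h : f = g) :
    (eqToHom h).hom = eqToHom (congrArg Mor.hom h) := by
  subst h; rfl

instance [Bicategory.Strict B] : Bicategory.Strict (LocallyFull P) where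
  id_comp f := Mor.ext (Bicategory.Strict.id_comp f.hom)
  comp_id f := Mor.ext (Bicategory.Strict.comp_id f.hom)
  assoc f g h := Mor.ext (Bicategory.Strict.assoc f.hom g.hom h.hom)
  leftUnitor_eqToIso f := Iso.ext (Mor₂.ext (by
    rw [eqToIso.hom, eqToHom_hom]
    exact congrArg Iso.hom (Bicategory.Strict.leftUnitor_eqToIso f.hom)))
  rightUnitor_eqToIso f := Iso.ext (Mor₂.ext (by
    rw [eqToIso.hom, eqToHom_hom]
    exact congrArg Iso.hom (Bicategory.Strict.rightUnitor_eqToIso f.hom)))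
  associator_eqToIso f g h := Iso.ext (Mor₂.ext (by
    rw [eqToIso.hom, eqToHom_hom]
    exact congrArg Iso.hom (Bicategory.Strict.associator_eqToIso f.hom g.hom h.hom)))

/-- The inclusion of a locally full sub-`2`-category. -/
def incl (P : OneCells B) [Bicategory.Strict B] : StrictPseudofunctor (LocallyFull P) B :=
  StrictPseudofunctor.mk''
    { obj := fun a => a.obj
      map := fun f => f.hom
      map₂ := fun η => η.hom
      map₂_id := fun _ => rfl
      map₂_comp := fun _ _ => rfl
      map_id := fun _ => rfl
      map_comp := fun _ _ => rfl
      map₂_whisker_left := fun f _ _ η => by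
        exact ((Category.id_comp _).trans (Category.comp_id _)).symm
      map₂_whisker_right := fun η f => by
        exact ((Category.id_comp _).trans (Category.comp_id _)).symm }

/-- The inclusion between two locally full sub-`2`-categories. -/
def inclOfLE {P Q : OneCells B} [Bicategory.Strict B]
    (h : ∀ {a b : B} (f : a ⟶ b), P.mem f → Q.mem f) :
    StrictPseudofunctor (LocallyFull P) (LocallyFull Q) :=
  StrictPseudofunctor.mk''
    { obj := fun a => ⟨a.obj⟩
      map := fun f => ⟨f.hom, h _ f.mem⟩
      map₂ := fun η => ⟨η.hom⟩
      map₂_id := fun _ => rfl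
      map₂_comp := fun _ _ => rfl
      map_id := fun _ => rfl
      map_comp := fun _ _ => rfl
      map₂_whisker_left := fun f _ _ η => by
        exact Mor₂.ext (by
          rw [comp_hom, comp_hom, eqToHom_hom, eqToHom_hom]
          exact ((Category.id_comp _).trans (Category.comp_id _)).symm)
      map₂_whisker_right := fun η f => by
        exact Mor₂.ext (by
          rw [comp_hom, comp_hom, eqToHom_hom, eqToHom_hom]
          exact ((Category.id_comp _).trans (Category.comp_id _)).symm) }

end LocallyFull

end LocallyFull

section

variable {B : Type u} [Bicategory.{w, v} B] [Bicategory.Strict B] (M : TwoMonad B)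

/-- `T`-pseudomorphisms: lax morphisms with invertible structure `2`-cell. -/
def pseudoMor : OneCells (LaxAlg M) where
  mem f := IsIso f.cell
  id_mem y := by
    change IsIso (LaxAlg.Mor.id y).cell
    unfold LaxAlg.Mor.id
    infer_instance
  comp_mem f g hf hg := by
    have := hf
    have := hg
    change IsIso (LaxAlg.Mor.comp f g).cell
    unfold LaxAlg.Mor.comp
    infer_instance

/-- Strict `T`-morphisms: lax morphisms whose structure `2`-cell is an identity. -/
def strictMor : OneCells (LaxAlg M) where
  mem {y z} f := ∃ h : M.T.map f.hom ≫ z.act = y.act ≫ f.hom, f.cell = eqToHom h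
  id_mem y := ⟨(M.map_id_comp y.act).trans (Bicategory.Strict.comp_id y.act).symm, rfl⟩
  comp_mem {x y z} f g := by
    rintro ⟨h, hf⟩ ⟨k, hg⟩
    refine ⟨?_, ?_⟩
    · change M.T.map (f.hom ≫ g.hom) ≫ z.act = x.act ≫ f.hom ≫ g.hom
      rw [M.map_map_comp, k, ← Bicategory.Strict.assoc, h, Bicategory.Strict.assoc]
    · change (LaxAlg.Mor.comp f g).cell = _
      simp only [LaxAlg.Mor.comp, hf, hg, whiskerLeft_eqToHom, eqToHom_whiskerRight,
        eqToHom_trans]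
      rfl

theorem pseudoMor_of_strictMor {y z : LaxAlg M} (f : y ⟶ z) (hf : (strictMor M).mem f) :
    (pseudoMor M).mem f := by
  have h : ∃ h : M.T.map f.hom ≫ z.act = y.act ≫ f.hom, f.cell = eqToHom h := hf
  obtain ⟨h, hf⟩ := h
  change IsIso f.cell
  rw [hf]
  infer_instance

/-- `Lax-T-Alg`: lax algebras and `T`-pseudomorphisms. -/
abbrev LaxAlgPs : Type _ := LocallyFull (pseudoMor M)

/-- `Lax-T-Alg_s`: lax algebras and strict `T`-morphisms. -/
abbrev LaxAlgS : Type _ := LocallyFull (strictMor M)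

/-- The inclusion `ℓ : Lax-T-Alg ⟶ Lax-T-Alg_ℓ`. -/
abbrev ell : StrictPseudofunctor (LaxAlgPs M) (LaxAlg M) := LocallyFull.incl (pseudoMor M)

/-- The inclusion `Lax-T-Alg_s ⟶ Lax-T-Alg`. -/
abbrev strictIncl : StrictPseudofunctor (LaxAlgS M) (LaxAlgPs M) :=
  LocallyFull.inclOfLE (pseudoMor_of_strictMor M)

/-- The forgetful `2`-functor `U : Lax-T-Alg ⟶ B`. -/
def forgetPs : StrictPseudofunctor (LaxAlgPs M) B :=
  StrictPseudofunctor.mk''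
    { obj := fun z => z.obj.carrier
      map := fun f => f.hom.hom
      map₂ := fun η => η.hom.hom
      map₂_id := fun _ => rfl
      map₂_comp := fun _ _ => rfl
      map_id := fun _ => rfl
      map_comp := fun _ _ => rfl
      map₂_whisker_left := fun f _ _ η => by
        exact ((Category.id_comp _).trans (Category.comp_id _)).symm
      map₂_whisker_right := fun η f => by
        exact ((Category.id_comp _).trans (Category.comp_id _)).symm }

end

section Diagram

variable {A : Type u₁} [Bicategory.{w₁, v₁} A] [Bicategory.Strict A]
  {B : Type u} [Bicategory.{w, v} B] [Bicategory.Strict B] {M : TwoMonad B}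
  {Jt : StrictPseudofunctor A (LaxAlgS M)} {E : StrictPseudofunctor B A}
  (adj : TwoAdjunction E ((Jt.comp (strictIncl M)).comp (forgetPs M)))

/-- The lax algebra `J X`. -/
abbrev jAlg (Jt : StrictPseudofunctor A (LaxAlgS M)) (X : A) : LaxAlg M := (Jt.obj X).obj

/-- The underlying `1`-cell of `J f`. -/
abbrev jMap (Jt : StrictPseudofunctor A (LaxAlgS M)) {X Y : A} (f : X ⟶ Y) :
    (jAlg Jt X).carrier ⟶ (jAlg Jt Y).carrier := (Jt.map f).hom.hom

theorem jMap_act (Jt : StrictPseudofunctor A (LaxAlgS M)) {X Y : A} (f : X ⟶ Y) :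
    M.T.map (jMap Jt f) ≫ (jAlg Jt Y).act = (jAlg Jt X).act ≫ jMap Jt f := by
  obtain ⟨h, -⟩ := (Jt.map f).mem
  exact h

namespace TwoAdjunction

/-- The unit `ρ`. -/
def rho (X : B) : X ⟶ (jAlg Jt (E.obj X)).carrier := adj.unit X

/-- The counit `ε`. -/
def eps (X : A) : E.obj (jAlg Jt X).carrier ⟶ X := adj.counit X

theorem rho_naturality {X Y : B} (f : X ⟶ Y) : f ≫ adj.rho Y = adj.rho X ≫ jMap Jt (E.map f) :=
  adj.unit_naturality f

theorem eps_naturality {X Y : A} (f : X ⟶ Y) :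
    E.map (jMap Jt f) ≫ adj.eps Y = adj.eps X ≫ f :=
  adj.counit_naturality f

theorem rho_eps (X : B) : E.map (adj.rho X) ≫ adj.eps (E.obj X) = 𝟙 (E.obj X) :=
  adj.left_triangle X

theorem eps_rho (X : A) : adj.rho (jAlg Jt X).carrier ≫ jMap Jt (adj.eps X) = 𝟙 _ :=
  adj.right_triangle X

/-- The `1`-cell `ε_{EX} E(a_{JEX} T(ρ_X)) : E T X ⟶ E X`. -/
def actRho (X : B) : E.obj (M.T.obj X) ⟶ E.obj X :=
  E.map (M.T.map (adj.rho X) ≫ (jAlg Jt (E.obj X)).act) ≫ adj.eps (E.obj X)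

theorem actRho_naturality {X Y : B} (f : X ⟶ Y) :
    adj.actRho X ≫ E.map f = E.map (M.T.map f) ≫ adj.actRho Y := by
  unfold actRho
  rw [Bicategory.Strict.assoc, ← adj.eps_naturality, ← Bicategory.Strict.assoc, ← E.map_comp,
    Bicategory.Strict.assoc, ← jMap_act, ← Bicategory.Strict.assoc (M.T.map (adj.rho X)),
    ← M.T.map_comp, ← adj.rho_naturality, M.T.map_comp, Bicategory.Strict.assoc, E.map_comp,
    Bicategory.Strict.assoc]

theorem actRho_eps (X : A) :
    adj.actRho (jAlg Jt X).carrier ≫ adj.eps X = E.map (jAlg Jt X).act ≫ adj.eps X := by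
  unfold actRho
  rw [Bicategory.Strict.assoc, ← adj.eps_naturality, ← Bicategory.Strict.assoc, ← E.map_comp,
    Bicategory.Strict.assoc, ← jMap_act, ← Bicategory.Strict.assoc (M.T.map (adj.rho _)),
    ← M.T.map_comp, adj.eps_rho, M.T.map_id, Bicategory.Strict.id_comp]

theorem actRho_actRho (X : B) : adj.actRho (M.T.obj X) ≫ adj.actRho X =
    E.map (M.T.map (M.T.map (adj.rho X)) ≫ M.T.map (jAlg Jt (E.obj X)).act ≫
      (jAlg Jt (E.obj X)).act) ≫ adj.eps (E.obj X) := by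
  conv_lhs => rw [show adj.actRho X = E.map (M.T.map (adj.rho X) ≫
    (jAlg Jt (E.obj X)).act) ≫ adj.eps (E.obj X) from rfl]
  rw [← Bicategory.Strict.assoc, actRho_naturality, Bicategory.Strict.assoc, actRho_eps,
    ← Bicategory.Strict.assoc, ← E.map_comp, M.T.map_comp, Bicategory.Strict.assoc]

theorem mul_actRho (X : B) : E.map (M.T.map (M.T.map (adj.rho X)) ≫ M.mul _ ≫
      (jAlg Jt (E.obj X)).act) ≫ adj.eps (E.obj X) = E.map (M.mul X) ≫ adj.actRho X := by
  unfold actRho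
  rw [M.mul_naturality_assoc, E.map_comp, Bicategory.Strict.assoc]

theorem unit_actRho (X : B) : E.map (adj.rho X ≫ M.unit _ ≫
      (jAlg Jt (E.obj X)).act) ≫ adj.eps (E.obj X) = E.map (M.unit X) ≫ adj.actRho X := by
  unfold actRho
  rw [M.unit_naturality_assoc, E.map_comp, Bicategory.Strict.assoc]

/-- The objects and arrows of the diagram `𝒜_y`, in `Aᵒᵖ`:
`d⁰ ↦ E(a_y)`, `d¹ ↦ ε E(a_{JEY} T(ρ_Y))`, `s⁰ ↦ E(η_Y)`,
`∂⁰ ↦ E(T(a_y))`, `∂¹ ↦ E(m_Y)`, `∂² ↦ ε E(a_{JETY} T(ρ_{TY}))`. -/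
def diagramPre (y : LaxAlg M) : DObj ⥤q Aᵒᵖ where
  obj
    | .one => op (E.obj y.carrier)
    | .two => op (E.obj (M.T.obj y.carrier))
    | .three => op (E.obj (M.T.obj (M.T.obj y.carrier)))
  map
    | .d0 => (E.map y.act).op
    | .d1 => (adj.actRho y.carrier).op
    | .s0 => (E.map (M.unit y.carrier)).op
    | .p0 => (E.map (M.T.map y.act)).op
    | .p1 => (E.map (M.mul y.carrier)).op
    | .p2 => (adj.actRho (M.T.obj y.carrier)).op

theorem diagramPre_path₂ (y : LaxAlg M) {a b c : DObj} (e : a ⟶ b) (e' : b ⟶ c) :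
    (pathMap (adj.diagramPre y) (path₂ e e')).unop =
      ((adj.diagramPre y).map e').unop ≫ ((adj.diagramPre y).map e).unop := by
  change _ ≫ (_ ≫ 𝟙 _) = _
  rw [Bicategory.Strict.comp_id]

/-- The `2`-cells of the diagram `𝒜_y`. -/
def diagramCell (y : LaxAlg M) ⦃a b : DObj⦄ ⦃f g : Quiver.Path a b⦄ :
    DCell f g → (pathMap (adj.diagramPre y) f ⟶ pathMap (adj.diagramPre y) g)
  | .s00 => opCell (E.map₂ y.mulCell)
      ((adj.diagramPre_path₂ y DArr.d0 DArr.p0).trans (E.map_comp _ _).symm)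
      ((E.map_comp _ _).trans (adj.diagramPre_path₂ y DArr.d0 DArr.p1).symm)
  | .s20 => opCell (𝟙 (adj.actRho (M.T.obj y.carrier) ≫ E.map y.act))
      (adj.diagramPre_path₂ y DArr.d0 DArr.p2)
      ((adj.actRho_naturality y.act).trans (adj.diagramPre_path₂ y DArr.d1 DArr.p0).symm)
  | .s21 => opCell
      (E.map₂ (M.T.map (M.T.map (adj.rho y.carrier)) ◁ (jAlg Jt (E.obj y.carrier)).mulCell) ▷
        adj.eps (E.obj y.carrier))
      ((adj.diagramPre_path₂ y DArr.d1 DArr.p2).trans (adj.actRho_actRho y.carrier))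
      ((adj.mul_actRho y.carrier).trans (adj.diagramPre_path₂ y DArr.d1 DArr.p1).symm)
  | .n0 => opCell (E.map₂ y.unitCell) (E.map_id _).symm
      ((E.map_comp _ _).trans (adj.diagramPre_path₂ y DArr.d0 DArr.s0).symm)
  | .n1 => opCell
      (E.map₂ (adj.rho y.carrier ◁ (jAlg Jt (E.obj y.carrier)).unitCell) ▷
        adj.eps (E.obj y.carrier))
      ((adj.rho_eps y.carrier).symm.trans
        (congrArg (E.map · ≫ adj.eps _) (Bicategory.Strict.comp_id (adj.rho y.carrier)).symm))
      ((adj.unit_actRho y.carrier).trans (adj.diagramPre_path₂ y DArr.d1 DArr.s0).symm)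

/-- The diagram `𝒜_y`, for `J` the composite of `Jt` with the inclusion and `R` the composite of
`J` with the forgetful `2`-functor. -/
def diagram (y : LaxAlg M) : StrictPseudofunctor DeltaL Aᵒᵖ :=
  Presented.lift (adj.diagramPre y) (adj.diagramCell y) (fun _ _ _ _ _ _ h => h.elim)

/-- Transport of a `2`-adjunction along an equality of right adjoints. -/
def ofEq {R R' : StrictPseudofunctor A B} (adj : TwoAdjunction E R) (h : R = R') :
    TwoAdjunction E R' := h ▸ adj

end TwoAdjunction

/-- The diagram `𝒜_y : Δ_ℓᵒᵖ ⟶ A` (regarded as a `2`-functor `Δ_ℓ ⟶ Aᵒᵖ`) attached to a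
`2`-adjunction `E ⊣ R`, commutative triangles `J = incl ∘ Jt` and `R = U ∘ J`, and a lax
algebra `y`. -/
def codescentDiagram {R : StrictPseudofunctor A B} {J : StrictPseudofunctor A (LaxAlgPs M)}
    (hJ : Jt.comp (strictIncl M) = J) (hR : J.comp (forgetPs M) = R)
    (adj : TwoAdjunction E R) (y : LaxAlg M) : StrictPseudofunctor DeltaL Aᵒᵖ :=
  TwoAdjunction.diagram (Jt := Jt) (adj.ofEq ((congrArg (·.comp (forgetPs M)) hJ).trans hR).symm) y

end Diagram

end LaxAlgebras

universe u₂

/-!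
By the universal-arrow description of adjunctions, `ℓ J` has a left `2`-adjoint exactly when every
lax algebra `y` admits a strict `2`-universal arrow `y ⟶ ℓ J c`. Since `Δ̇_ℓ` is presented over
`Δ_ℓ` by the arrow `d` and the `2`-cell `ϑ`, a cocone under `𝒜_y` with vertex `X` is freely
determined by its leg `f : E Y ⟶ X` at `d` and its `2`-cell `θ : d¹ f ⇒ d⁰ f` at `ϑ`, subject to
the two defining equations of `Δ̇_ℓ`. Transposing across `E ⊣ R` turns `f` into a `1`-cell
`Y ⟶ R X`, `θ` into a structure cell for it, and the two equations into the axioms of a lax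
morphism `y ⟶ J X`. The resulting isomorphism of categories between cocones and lax morphisms is
compatible with composition by `X ⟶ X'`, because `J` takes values in strict morphisms; hence
universal cocones and universal arrows correspond. Inverting `ϑ` amounts to inverting the structure
cell, which gives pseudomorphisms and the statement for `J`.
-/

namespace LaxAlgebras

section HeterogeneousEquality

variable {B : Type u} [Bicategory.{w, v} B]

theorem whiskerLeft_hcongr {a b c : B} {f f' : a ⟶ b} {g g' h h' : b ⟶ c} {η : g ⟶ h}
    {η' : g' ⟶ h'} (hf : f = f') (hg : g = g') (hh : h = h') (e : η ≍ η') :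
    f ◁ η ≍ f' ◁ η' := by
  subst hf hg hh; cases e; rfl

theorem whiskerRight_hcongr {a b c : B} {f f' : b ⟶ c} {g g' h h' : a ⟶ b} {η : g ⟶ h}
    {η' : g' ⟶ h'} (hf : f = f') (hg : g = g') (hh : h = h') (e : η ≍ η') :
    η ▷ f ≍ η' ▷ f' := by
  subst hf hg hh; cases e; rfl

section

variable [Bicategory.Strict B]

theorem comp_whiskerLeft_heq {a b c d : B} (f : a ⟶ b) (g : b ⟶ c) {h h' : c ⟶ d} (η : h ⟶ h') :
    (f ≫ g) ◁ η ≍ f ◁ g ◁ η := by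
  simp [Bicategory.Strict.associator_eqToIso]

theorem id_whiskerLeft_heq {a b : B} {f g : a ⟶ b} (η : f ⟶ g) : 𝟙 a ◁ η ≍ η := by
  simp [Bicategory.Strict.leftUnitor_eqToIso]

theorem whiskerRight_comp_heq {a b c d : B} {f f' : a ⟶ b} (η : f ⟶ f') (g : b ⟶ c) (h : c ⟶ d) :
    η ▷ (g ≫ h) ≍ (η ▷ g) ▷ h := by
  simp [Bicategory.Strict.associator_eqToIso]

theorem whiskerRight_id_heq {a b : B} {f g : a ⟶ b} (η : f ⟶ g) : η ▷ 𝟙 b ≍ η := by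
  simp [Bicategory.Strict.rightUnitor_eqToIso]

theorem whisker_assoc_heq {a b c d : B} (f : a ⟶ b) {g g' : b ⟶ c} (η : g ⟶ g') (h : c ⟶ d) :
    (f ◁ η) ▷ h ≍ f ◁ η ▷ h := by
  simp [Bicategory.Strict.associator_eqToIso]

end

variable {C : Type u₁} [Bicategory.{w₁, v₁} C] (F : StrictPseudofunctor B C)

theorem map₂_hcongr {a b : B} {f g f' g' : a ⟶ b} {η : f ⟶ g} {η' : f' ⟶ g'} (hf : f = f')
    (hg : g = g') (e : η ≍ η') : F.map₂ η ≍ F.map₂ η' := by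
  subst hf hg; cases e; rfl

theorem map₂_whiskerLeft_heq {a b c : B} (f : a ⟶ b) {g h : b ⟶ c} (η : g ⟶ h) :
    F.map₂ (f ◁ η) ≍ F.map f ◁ F.map₂ η := by
  simp [F.mapComp_eq_eqToIso]

theorem map₂_whiskerRight_heq {a b c : B} {f g : a ⟶ b} (η : f ⟶ g) (h : b ⟶ c) :
    F.map₂ (η ▷ h) ≍ F.map₂ η ▷ F.map h := by
  simp [F.mapComp_eq_eqToIso]

end HeterogeneousEquality

section IsoOfCategories

variable {C : Type u} [Category.{v} C] {D : Type u₁} [Category.{v₁} D]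

theorem functor_map_hcongr (F : C ⥤ D) {a b a' b' : C} {f : a ⟶ b} {f' : a' ⟶ b'}
    (ha : a = a') (hb : b = b') (e : f ≍ f') : F.map f ≍ F.map f' := by
  subst ha hb; cases e; rfl

theorem functor_map_heq_iff (F : C ⥤ D) [F.Faithful] {a b a' b' : C} {f : a ⟶ b} {f' : a' ⟶ b'}
    (ha : a = a') (hb : b = b') : F.map f ≍ F.map f' ↔ f ≍ f' := by
  subst ha hb
  rw [heq_iff_eq, heq_iff_eq, F.map_injective.eq_iff]

theorem functor_isIso_iff (F : C ⥤ D) :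
    F.IsIso ↔ ∃ G : D ⥤ C, F ⋙ G = 𝟭 C ∧ G ⋙ F = 𝟭 D where
  mp _ := ⟨F.strictInv, F.asIsomorphism.unit_eq.symm, F.asIsomorphism.counit_eq⟩
  mpr := fun ⟨G, hFG, hGF⟩ =>
    (IsoCat.mk (functor := F) (inverse := G) hFG.symm hGF).isIso_functor

theorem functor_isIso_comp_iff {E : Type u₂} [Category.{v₂} E] (F : C ⥤ D) (G : D ⥤ E)
    [G.IsIso] : (F ⋙ G).IsIso ↔ F.IsIso where
  mp _ :=
    { faithful := .of_comp F G
      full := .of_comp_faithful F G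
      bijective_obj := (Function.Bijective.of_comp_iff' G.bijective_obj F.obj).1
        (F ⋙ G).bijective_obj }
  mpr _ := inferInstance

end IsoOfCategories

section UniversalArrow

variable {A : Type u₁} [Bicategory.{w₁, v₁} A] {B : Type u} [Bicategory.{w, v} B]

/-- The functor `A(c, X) ⥤ B(y, P X)` induced by a `1`-cell `u : y ⟶ P c`. -/
@[simps]
def arrowFunctor (P : StrictPseudofunctor A B) {y : B} {c : A} (u : y ⟶ P.obj c) (X : A) :
    (c ⟶ X) ⥤ (y ⟶ P.obj X) where
  obj k := u ≫ P.map k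
  map η := u ◁ P.map₂ η

/-- A `1`-cell `u : y ⟶ P c` is a strict `2`-universal arrow from `y` to `P` if it induces
isomorphisms of categories, not merely equivalences, `A(c, X) ≅ B(y, P X)`. -/
def IsUniversalArrow (P : StrictPseudofunctor A B) {y : B} {c : A} (u : y ⟶ P.obj c) : Prop :=
  ∀ X : A, (arrowFunctor P u X).IsIso

variable [Bicategory.Strict B] {P : StrictPseudofunctor A B}

section

variable {y : B} {c : A} (u : y ⟶ P.obj c)

theorem arrowFunctor_obj_comp {X Y : A} (k : c ⟶ X) (l : X ⟶ Y) :
    (arrowFunctor P u Y).obj (k ≫ l) = (arrowFunctor P u X).obj k ≫ P.map l := by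
  simp only [arrowFunctor_obj, P.map_comp, Bicategory.Strict.assoc]

theorem arrowFunctor_map_whiskerRight {X Y : A} {k k' : c ⟶ X} (η : k ⟶ k') (l : X ⟶ Y) :
    (arrowFunctor P u Y).map (η ▷ l) ≍ (arrowFunctor P u X).map η ▷ P.map l :=
  (whiskerLeft_hcongr rfl (P.map_comp _ _) (P.map_comp _ _) (map₂_whiskerRight_heq P η l)).trans
    (whisker_assoc_heq _ _ _).symm

theorem arrowFunctor_map_whiskerLeft {X Y : A} (k : c ⟶ X) {l l' : X ⟶ Y} (η : l ⟶ l') :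
    (arrowFunctor P u Y).map (k ◁ η) ≍ (arrowFunctor P u X).obj k ◁ P.map₂ η :=
  (whiskerLeft_hcongr rfl (P.map_comp _ _) (P.map_comp _ _) (map₂_whiskerLeft_heq P k η)).trans
    (comp_whiskerLeft_heq _ _ _).symm

end

namespace IsUniversalArrow

variable {y : B} {c : A} {u : y ⟶ P.obj c} (hu : IsUniversalArrow P u) {X Y : A}

/-- The factorization of `1`-cells `y ⟶ P X`, and of `2`-cells between them, through a universal
arrow: the inverse of `arrowFunctor`. -/
noncomputable def desc (X : A) : (y ⟶ P.obj X) ⥤ (c ⟶ X) :=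
  haveI := hu X
  (arrowFunctor P u X).strictInv

theorem arrowFunctor_comp_desc (X : A) : arrowFunctor P u X ⋙ hu.desc X = 𝟭 (c ⟶ X) :=
  haveI := hu X
  (arrowFunctor P u X).asIsomorphism.unit_eq.symm

theorem desc_comp_arrowFunctor (X : A) : hu.desc X ⋙ arrowFunctor P u X = 𝟭 (y ⟶ P.obj X) :=
  haveI := hu X
  (arrowFunctor P u X).asIsomorphism.counit_eq

theorem fac (f : y ⟶ P.obj X) : u ≫ P.map ((hu.desc X).obj f) = f :=
  Functor.congr_obj (hu.desc_comp_arrowFunctor X) f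

theorem fac₂ {f g : y ⟶ P.obj X} (η : f ⟶ g) : u ◁ P.map₂ ((hu.desc X).map η) ≍ η :=
  Functor.hcongr_hom (hu.desc_comp_arrowFunctor X) η

theorem desc_obj_arrow (k : c ⟶ X) : (hu.desc X).obj (u ≫ P.map k) = k :=
  Functor.congr_obj (hu.arrowFunctor_comp_desc X) k

theorem desc_map_arrow {k l : c ⟶ X} (η : k ⟶ l) : (hu.desc X).map (u ◁ P.map₂ η) ≍ η :=
  Functor.hcongr_hom (hu.arrowFunctor_comp_desc X) η

theorem desc_obj_comp_map (f : y ⟶ P.obj X) (l : X ⟶ Y) :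
    (hu.desc Y).obj (f ≫ P.map l) = (hu.desc X).obj f ≫ l := by
  conv_lhs => rw [← hu.fac f]
  exact (congrArg (hu.desc Y).obj (arrowFunctor_obj_comp u _ l).symm).trans (hu.desc_obj_arrow _)

theorem desc_map_whiskerRight {f g : y ⟶ P.obj X} (η : f ⟶ g) (l : X ⟶ Y) :
    (hu.desc Y).map (η ▷ P.map l) ≍ (hu.desc X).map η ▷ l := by
  refine HEq.trans (functor_map_hcongr _ ?_ ?_ ?_) (hu.desc_map_arrow ((hu.desc X).map η ▷ l))
  · rw [P.map_comp, ← Bicategory.Strict.assoc, hu.fac]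
  · rw [P.map_comp, ← Bicategory.Strict.assoc, hu.fac]
  · exact (whiskerRight_hcongr rfl (hu.fac f).symm (hu.fac g).symm (hu.fac₂ η).symm).trans
      (arrowFunctor_map_whiskerRight u _ l).symm

theorem desc_map_whiskerLeft (f : y ⟶ P.obj X) {l l' : X ⟶ Y} (η : l ⟶ l') :
    (hu.desc Y).map (f ◁ P.map₂ η) ≍ (hu.desc X).obj f ◁ η := by
  refine HEq.trans (functor_map_hcongr _ ?_ ?_ ?_) (hu.desc_map_arrow ((hu.desc X).obj f ◁ η))
  · rw [P.map_comp, ← Bicategory.Strict.assoc, hu.fac]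
  · rw [P.map_comp, ← Bicategory.Strict.assoc, hu.fac]
  · exact (whiskerLeft_hcongr (hu.fac f).symm rfl rfl .rfl).trans
      (arrowFunctor_map_whiskerLeft u _ η).symm

section LeftAdjoint

variable {C : B → A} {u : ∀ y, y ⟶ P.obj (C y)} (hu : ∀ y, IsUniversalArrow P (u y))

theorem desc_comp_unit {x y z : B} (f : x ⟶ y) (g : y ⟶ z) :
    ((hu x).desc (C z)).obj ((f ≫ g) ≫ u z) =
      ((hu x).desc (C y)).obj (f ≫ u y) ≫ ((hu y).desc (C z)).obj (g ≫ u z) := by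
  rw [← desc_obj_comp_map, Bicategory.Strict.assoc f (u y), (hu y).fac, Bicategory.Strict.assoc]

theorem desc_whiskerLeft_unit {x y z : B} (f : x ⟶ y) {g g' : y ⟶ z} (η : g ⟶ g') :
    ((hu x).desc (C z)).map ((f ◁ η) ▷ u z) ≍
      ((hu x).desc (C y)).obj (f ≫ u y) ◁ ((hu y).desc (C z)).map (η ▷ u z) := by
  refine HEq.trans (functor_map_hcongr _ ?_ ?_ ?_) ((hu x).desc_map_whiskerLeft (f ≫ u y) _)
  · rw [Bicategory.Strict.assoc f (u y), (hu y).fac, Bicategory.Strict.assoc]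
  · rw [Bicategory.Strict.assoc f (u y), (hu y).fac, Bicategory.Strict.assoc]
  · have factor : f ◁ η ▷ u z ≍ f ◁ u y ◁ P.map₂ (((hu y).desc (C z)).map (η ▷ u z)) :=
      whiskerLeft_hcongr rfl ((hu y).fac _).symm ((hu y).fac _).symm ((hu y).fac₂ _).symm
    exact (whisker_assoc_heq _ _ _).trans (factor.trans (comp_whiskerLeft_heq _ _ _).symm)

theorem desc_whiskerRight_unit {x y z : B} {f f' : x ⟶ y} (η : f ⟶ f') (g : y ⟶ z) :
    ((hu x).desc (C z)).map ((η ▷ g) ▷ u z) ≍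
      ((hu x).desc (C y)).map (η ▷ u y) ▷ ((hu y).desc (C z)).obj (g ≫ u z) := by
  refine HEq.trans (functor_map_hcongr _ ?_ ?_ ?_) ((hu x).desc_map_whiskerRight (η ▷ u y) _)
  · rw [Bicategory.Strict.assoc f (u y), (hu y).fac, Bicategory.Strict.assoc]
  · rw [Bicategory.Strict.assoc f' (u y), (hu y).fac, Bicategory.Strict.assoc]
  · have factor : η ▷ (g ≫ u z) ≍ η ▷ (u y ≫ P.map (((hu y).desc (C z)).obj (g ≫ u z))) :=
      whiskerRight_hcongr ((hu y).fac _).symm rfl rfl .rfl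
    exact (whiskerRight_comp_heq _ _ _).symm.trans (factor.trans (whiskerRight_comp_heq _ _ _))

variable [Bicategory.Strict A]

/-- The left `2`-adjoint determined by a choice of universal arrows `u y : y ⟶ P (C y)`. -/
noncomputable def leftAdjoint : StrictPseudofunctor B A :=
  StrictPseudofunctor.mk''
    { obj := C
      map := fun {y z} f => ((hu y).desc (C z)).obj (f ≫ u z)
      map₂ := fun {y z _ _} η => ((hu y).desc (C z)).map (η ▷ u z)
      map₂_id := fun _ =>
        (congrArg _ (id_whiskerRight _ _)).trans (CategoryTheory.Functor.map_id _ _)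
      map₂_comp := fun _ _ => by simp only [comp_whiskerRight, Functor.map_comp]
      map_id := fun y => by
        rw [Bicategory.Strict.id_comp, ← (hu y).desc_obj_arrow (𝟙 (C y)), P.map_id,
          Bicategory.Strict.comp_id]
      map_comp := fun f g => desc_comp_unit hu f g
      map₂_whisker_left := fun f _ _ η =>
        (conj_eqToHom_iff_heq _ _ (desc_comp_unit hu _ _) (desc_comp_unit hu _ _)).2
          (desc_whiskerLeft_unit hu f η)
      map₂_whisker_right := fun η g =>
        (conj_eqToHom_iff_heq _ _ (desc_comp_unit hu _ _) (desc_comp_unit hu _ _)).2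
          (desc_whiskerRight_unit hu η g) }

theorem desc_map_comp_unit_comp_desc_id {X Y : A} (f : X ⟶ Y) :
    ((hu _).desc _).obj (P.map f ≫ u (P.obj Y)) ≫ ((hu _).desc Y).obj (𝟙 _) =
      ((hu _).desc X).obj (𝟙 _) ≫ f := by
  rw [← desc_obj_comp_map, ← desc_obj_comp_map, Bicategory.Strict.assoc, (hu _).fac,
    Bicategory.Strict.comp_id, Bicategory.Strict.id_comp]

theorem desc_map₂_whiskerRight_unit {X Y : A} {f g : X ⟶ Y} (η : f ⟶ g) :
    ((hu _).desc _).map (P.map₂ η ▷ u (P.obj Y)) ▷ ((hu _).desc Y).obj (𝟙 _) ≍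
      ((hu _).desc X).obj (𝟙 _) ◁ η := by
  refine HEq.trans ((hu _).desc_map_whiskerRight _ _).symm
    (HEq.trans (functor_map_hcongr _ ?_ ?_ ?_) ((hu _).desc_map_whiskerLeft (𝟙 _) η))
  · rw [Bicategory.Strict.assoc, (hu _).fac, Bicategory.Strict.comp_id, Bicategory.Strict.id_comp]
  · rw [Bicategory.Strict.assoc, (hu _).fac, Bicategory.Strict.comp_id, Bicategory.Strict.id_comp]
  · have factor : P.map₂ η ▷ (u (P.obj Y) ≫ P.map (((hu _).desc Y).obj (𝟙 _))) ≍
        P.map₂ η ▷ 𝟙 (P.obj Y) := whiskerRight_hcongr ((hu _).fac _) rfl rfl .rfl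
    exact (whiskerRight_comp_heq _ _ _).symm.trans
      (factor.trans ((whiskerRight_id_heq _).trans (id_whiskerLeft_heq _).symm))

/-- The `2`-adjunction determined by a choice of universal arrows, with these as its unit. -/
noncomputable def twoAdjunction : TwoAdjunction (leftAdjoint hu) P where
  unit := u
  unit_naturality f := ((hu _).fac _).symm
  unit_naturality₂ η :=
    (conj_eqToHom_iff_heq _ _ ((hu _).fac _).symm ((hu _).fac _).symm).2 ((hu _).fac₂ _).symm
  counit X := ((hu (P.obj X)).desc X).obj (𝟙 _)
  counit_naturality f := desc_map_comp_unit_comp_desc_id hu f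
  counit_naturality₂ η :=
    (conj_eqToHom_iff_heq _ _ (desc_map_comp_unit_comp_desc_id hu _)
      (desc_map_comp_unit_comp_desc_id hu _)).2 (desc_map₂_whiskerRight_unit hu η)
  left_triangle y := by
    change ((hu y).desc _).obj (u y ≫ u _) ≫ ((hu _).desc (C y)).obj (𝟙 _) = 𝟙 (C y)
    rw [← desc_obj_comp_map, Bicategory.Strict.assoc, (hu _).fac, Bicategory.Strict.comp_id,
      ← (hu y).desc_obj_arrow (𝟙 (C y)), P.map_id, Bicategory.Strict.comp_id]
  right_triangle X := (hu _).fac _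

end LeftAdjoint

end IsUniversalArrow

namespace TwoAdjunction

variable [Bicategory.Strict A] {G : StrictPseudofunctor B A} (adj : TwoAdjunction G P)

/-- Transposition `B(y, P X) ⥤ A(G y, X)` across a `2`-adjunction `G ⊣ P`. -/
def counitFunctor (y : B) (X : A) : (y ⟶ P.obj X) ⥤ (G.obj y ⟶ X) where
  obj f := G.map f ≫ adj.counit X
  map η := G.map₂ η ▷ adj.counit X

theorem arrowFunctor_unit_comp_counitFunctor (y : B) (X : A) :
    arrowFunctor P (adj.unit y) X ⋙ adj.counitFunctor y X = 𝟭 (G.obj y ⟶ X) := by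
  refine Functor.hext (fun k => ?_) (fun k l η => ?_)
  · change G.map (adj.unit y ≫ P.map k) ≫ adj.counit X = k
    rw [G.map_comp, Bicategory.Strict.assoc, adj.counit_naturality, ← Bicategory.Strict.assoc,
      adj.left_triangle, Bicategory.Strict.id_comp]
  · have counit_nat : G.map₂ (P.map₂ η) ▷ adj.counit X ≍ adj.counit (G.obj y) ◁ η :=
      (conj_eqToHom_iff_heq _ _ (adj.counit_naturality k) (adj.counit_naturality l)).1
        (adj.counit_naturality₂ η)
    have naturality : G.map (adj.unit y) ◁ G.map₂ (P.map₂ η) ▷ adj.counit X ≍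
        G.map (adj.unit y) ◁ adj.counit (G.obj y) ◁ η :=
      whiskerLeft_hcongr rfl (adj.counit_naturality k) (adj.counit_naturality l) counit_nat
    have triangle : (G.map (adj.unit y) ≫ adj.counit (G.obj y)) ◁ η ≍ 𝟙 (G.obj y) ◁ η :=
      whiskerLeft_hcongr (adj.left_triangle y) rfl rfl .rfl
    refine (whiskerRight_hcongr rfl (G.map_comp _ _) (G.map_comp _ _)
      (map₂_whiskerLeft_heq G _ _)).trans ((whisker_assoc_heq _ _ _).trans ?_)
    exact naturality.trans ((comp_whiskerLeft_heq _ _ _).symm.trans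
      (triangle.trans (id_whiskerLeft_heq η)))

theorem counitFunctor_comp_arrowFunctor_unit (y : B) (X : A) :
    adj.counitFunctor y X ⋙ arrowFunctor P (adj.unit y) X = 𝟭 (y ⟶ P.obj X) := by
  refine Functor.hext (fun f => ?_) (fun f g η => ?_)
  · change adj.unit y ≫ P.map (G.map f ≫ adj.counit X) = f
    rw [P.map_comp, ← Bicategory.Strict.assoc, ← adj.unit_naturality, Bicategory.Strict.assoc,
      adj.right_triangle, Bicategory.Strict.comp_id]
  · have unit_nat : η ▷ adj.unit (P.obj X) ≍ adj.unit y ◁ P.map₂ (G.map₂ η) :=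
      (conj_eqToHom_iff_heq _ _ (adj.unit_naturality f) (adj.unit_naturality g)).1
        (adj.unit_naturality₂ η)
    have naturality : (adj.unit y ◁ P.map₂ (G.map₂ η)) ▷ P.map (adj.counit X) ≍
        (η ▷ adj.unit (P.obj X)) ▷ P.map (adj.counit X) :=
      whiskerRight_hcongr rfl (adj.unit_naturality f).symm (adj.unit_naturality g).symm
        unit_nat.symm
    have triangle : η ▷ (adj.unit (P.obj X) ≫ P.map (adj.counit X)) ≍ η ▷ 𝟙 (P.obj X) :=
      whiskerRight_hcongr (adj.right_triangle X) rfl rfl .rfl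
    exact (arrowFunctor_map_whiskerRight _ _ _).trans
      (naturality.trans ((whiskerRight_comp_heq _ _ _).symm.trans
        (triangle.trans (whiskerRight_id_heq η))))

theorem isUniversalArrow_unit (y : B) : IsUniversalArrow P (adj.unit y) := fun X =>
  (functor_isIso_iff _).2 ⟨adj.counitFunctor y X, adj.arrowFunctor_unit_comp_counitFunctor y X,
    adj.counitFunctor_comp_arrowFunctor_unit y X⟩

theorem exists_iff_exists_isUniversalArrow :
    (∃ G : StrictPseudofunctor B A, Nonempty (TwoAdjunction G P)) ↔
      ∀ y : B, ∃ (c : A) (u : y ⟶ P.obj c), IsUniversalArrow P u where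
  mp := fun ⟨G, ⟨adj⟩⟩ y => ⟨G.obj y, adj.unit y, adj.isUniversalArrow_unit y⟩
  mpr h := by
    choose C u hu using h
    exact ⟨IsUniversalArrow.leftAdjoint hu, ⟨IsUniversalArrow.twoAdjunction hu⟩⟩

end TwoAdjunction

end UniversalArrow

/-- Vertical composition of `2`-cells of a presented `2`-category, between paths rather than
`1`-cells. -/
abbrev Presented.comp₂ {V : Type} [Quiver.{0} V] {C : GenCells V} {E : CellRel C} {a b : V}
    {f g h : Quiver.Path a b} (x : Cell E f g) (y : Cell E g h) : Cell E f h :=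
  (Presented.homCategory (E := E) a b).comp x y

section DotPaths

theorem isEmpty_path_to_zero (a : DObj) : IsEmpty (Quiver.Path (DotObj.of a) DotObj.zero) :=
  ⟨fun p => by cases p with | cons _ e => exact nomatch (e : DotArr _ _)⟩

theorem path_zero_zero (p : Quiver.Path DotObj.zero DotObj.zero) : p = Quiver.Path.nil := by
  cases p with
  | nil => rfl
  | cons _ e => exact nomatch (e : DotArr _ _)

/-- A path between objects of `Δ_ℓ`, regarded as a `1`-cell of `Δ_ℓ`. -/
def unPath {a : DObj} : ∀ {b : DObj}, Quiver.Path (DotObj.of a) (DotObj.of b) → Quiver.Path a b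
  | _, .nil => .nil
  | _, .cons (b := .of _) p (.of e) => (unPath p).cons e

/-- The part of a path starting at `𝟢` that follows its first arrow `d`. -/
def tail : ∀ {b : DObj}, Quiver.Path DotObj.zero (DotObj.of b) → Quiver.Path DObj.one b
  | _, .cons (b := .of _) p (.of e) => (tail p).cons e
  | _, .cons (b := .zero) _ .d => .nil

/-- The arrow `d : 𝟢 ⟶ 𝟣`, as a path. -/
abbrev pathD : Quiver.Path DotObj.zero (DotObj.of .one) := Quiver.Hom.toPath DotArr.d

variable {i : Prop}

theorem deltaIncl_map {a b : DObj} (p : Quiver.Path a b) :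
    ((deltaIncl i).map (X := a) (Y := b) p : Quiver.Path (DotObj.of a) (DotObj.of b)) =
      dotIncl.mapPath p := by
  induction p with
  | nil => rfl
  | cons p e ih => exact congrArg (·.cons (DotArr.of e)) ih

theorem unPath_deltaIncl_map {a b : DObj} (p : Quiver.Path a b) :
    unPath ((deltaIncl i).map (X := a) (Y := b) p) = p := by
  rw [deltaIncl_map]
  induction p with
  | nil => exact unPath.eq_1
  | cons p e ih => exact (unPath.eq_2 _ _ _ _).trans (congrArg (·.cons e) ih)

theorem deltaIncl_map_unPath {a : DObj} : ∀ {b : DObj}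
    (p : Quiver.Path (DotObj.of a) (DotObj.of b)), (deltaIncl i).map (unPath p) = p
  | _, .nil => by rw [unPath]; rfl
  | _, .cons (b := .of _) p (.of e) => by
    rw [unPath]
    exact congrArg (·.cons (DotArr.of e)) (deltaIncl_map_unPath p)

theorem deltaIncl_map_injective {a b : DeltaL} {f g : a ⟶ b}
    (h : (deltaIncl i).map f = (deltaIncl i).map g) : f = g :=
  Function.LeftInverse.injective (g := unPath) unPath_deltaIncl_map h

theorem tail_pathD_comp {b : DObj} (p : Quiver.Path DObj.one b) :
    tail (pathD.comp ((deltaIncl i).map (X := DObj.one) (Y := b) p)) = p := by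
  rw [deltaIncl_map]
  induction p with
  | nil => exact tail.eq_2 _
  | cons p e ih => exact (tail.eq_1 _ _ _ _).trans (congrArg (·.cons e) ih)

variable (i) in
theorem pathD_comp_tail : ∀ {b : DObj} (p : Quiver.Path DotObj.zero (DotObj.of b)),
    pathD.comp ((deltaIncl i).map (tail p)) = p
  | _, .cons (b := .of _) p (.of e) => by
    rw [tail]
    exact congrArg (·.cons (DotArr.of e)) (pathD_comp_tail p)
  | _, .cons (b := .zero) p .d => by
    rw [tail]
    exact congrArg (·.cons DotArr.d) (path_zero_zero p).symm

end DotPaths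

section DotCells

variable {i : Prop}

/-- The formal pasting `x` represents a `2`-cell in the image of `Δ_ℓ`. -/
def FromDelta (a b : DeltaL) (f g : Quiver.Path (DotObj.of a) (DotObj.of b))
    (x : PreCell (DotCell i) f g) : Prop :=
  ∃ (f' g' : a ⟶ b) (α : f' ⟶ g'), (deltaIncl i).map f' = f ∧ (deltaIncl i).map g' = g ∧
    (deltaIncl i).map₂ α ≍ Presented.mk₂ (E := DotRel i) x

namespace FromDelta

theorem gen {a b : DObj} {f g : Quiver.Path a b} (x : DCell f g) :
    FromDelta a b _ _ (dotGen i x) :=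
  ⟨f, g, Presented.mk₂ (.gen x), deltaIncl_map f, deltaIncl_map g, by cases x <;> rfl⟩

theorem refl {a b : DeltaL} (f : Quiver.Path (DotObj.of a) (DotObj.of b)) :
    FromDelta a b f f (.ofEq rfl : PreCell (DotCell i) f f) := by
  rw [← deltaIncl_map_unPath (i := i) f]
  exact ⟨unPath f, unPath f, 𝟙 _, rfl, rfl, .rfl⟩

theorem vcomp {a b : DeltaL} {f g h : Quiver.Path (DotObj.of a) (DotObj.of b)}
    {x : PreCell (DotCell i) f g} {y : PreCell (DotCell i) g h} (hx : FromDelta a b _ _ x)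
    (hy : FromDelta a b _ _ y) : FromDelta a b _ _ (x.vcomp y) := by
  obtain ⟨f, g, α, rfl, rfl, hα⟩ := hx
  obtain ⟨g', h, β, hg, rfl, hβ⟩ := hy
  obtain rfl := deltaIncl_map_injective hg
  refine ⟨f, h, α ≫ β, rfl, rfl, ?_⟩
  rw [PrelaxFunctor.map₂_comp, eq_of_heq hα, eq_of_heq hβ]
  rfl

theorem wl {a b c : DeltaL} (f : Quiver.Path (DotObj.of a) (DotObj.of b))
    {g h : Quiver.Path (DotObj.of b) (DotObj.of c)} {x : PreCell (DotCell i) g h}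
    (hx : FromDelta b c _ _ x) : FromDelta a c _ _ (x.wl f) := by
  obtain ⟨g, h, α, rfl, rfl, hα⟩ := hx
  obtain ⟨f, rfl⟩ : ∃ f' : a ⟶ b, (deltaIncl i).map f' = f := ⟨_, deltaIncl_map_unPath f⟩
  refine ⟨f ≫ g, f ≫ h, f ◁ α, (deltaIncl i).map_comp _ _, (deltaIncl i).map_comp _ _,
    (map₂_whiskerLeft_heq _ _ _).trans ?_⟩
  rw [eq_of_heq hα]
  rfl

theorem wr {a b c : DeltaL} {f g : Quiver.Path (DotObj.of a) (DotObj.of b)}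
    {x : PreCell (DotCell i) f g} (hx : FromDelta a b _ _ x)
    (h : Quiver.Path (DotObj.of b) (DotObj.of c)) : FromDelta a c _ _ (x.wr h) := by
  obtain ⟨f, g, α, rfl, rfl, hα⟩ := hx
  obtain ⟨h, rfl⟩ : ∃ h' : b ⟶ c, (deltaIncl i).map h' = h := ⟨_, deltaIncl_map_unPath h⟩
  refine ⟨f ≫ h, g ≫ h, α ▷ h, (deltaIncl i).map_comp _ _, (deltaIncl i).map_comp _ _,
    (map₂_whiskerRight_heq _ _ _).trans ?_⟩
  rw [eq_of_heq hα]
  rfl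

end FromDelta

/-- If both ends of the formal pasting `x` lie in `Δ_ℓ`, then `x` represents a `2`-cell in the
image of `Δ_ℓ`; the induction on `x` needs this for all ends at once. -/
def ComesFromDelta : ∀ {a b : DotObj} {f g : Quiver.Path a b}, PreCell (DotCell i) f g → Prop
  | .of a, .of b, f, g, x => FromDelta a b f g x
  | .zero, _, _, _, _ => True
  | .of _, .zero, _, _, _ => True

theorem comesFromDelta {a b : DotObj} {f g : Quiver.Path a b} (x : PreCell (DotCell i) f g) :
    ComesFromDelta x := by
  induction x with
  | gen x =>
    cases x with
    | of x => exact FromDelta.gen x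
    | theta | thetaInv _ => exact trivial
  | @ofEq a b f g h =>
    subst h
    match a, b with
    | .of a, .of b => exact FromDelta.refl f
    | .zero, _ | .of _, .zero => exact trivial
  | @vcomp a b f g h x y ihx ihy =>
    match a, b with
    | .of a, .of b => exact FromDelta.vcomp ihx ihy
    | .zero, _ | .of _, .zero => exact trivial
  | @wl a b c f g h x ih =>
    match a, b, c with
    | .of a, .of b, .of c => exact FromDelta.wl f ih
    | .of a, .zero, _ => exact ((isEmpty_path_to_zero a).false f).elim
    | .zero, _, _ | .of _, .of _, .zero => exact trivial
  | @wr a b c f g x h ih =>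
    match a, b, c with
    | .of a, .of b, .of c => exact FromDelta.wr ih h
    | .of a, .zero, _ => exact ((isEmpty_path_to_zero a).false f).elim
    | .zero, _, _ | .of _, .of _, .zero => exact trivial

/-- If the formal pasting `x` goes from `𝟢` to `𝟢`, then it represents an identity; the induction
on `x` needs this for all ends at once. -/
def TrivialAtZero : ∀ {a b : DotObj} {f g : Quiver.Path a b}, PreCell (DotCell i) f g → Prop
  | .zero, .zero, f, g, x => ∃ h : f = g, Presented.mk₂ (E := DotRel i) x = Presented.mk₂ (.ofEq h)
  | .zero, .of _, _, _, _ => True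
  | .of _, _, _, _, _ => True

theorem trivialAtZero {a b : DotObj} {f g : Quiver.Path a b} (x : PreCell (DotCell i) f g) :
    TrivialAtZero x := by
  induction x with
  | gen x => cases x <;> exact trivial
  | @ofEq a b f g h =>
    match a, b with
    | .zero, .zero => exact ⟨h, rfl⟩
    | .zero, .of _ | .of _, _ => exact trivial
  | @vcomp a b f g h x y ihx ihy =>
    match a, b with
    | .zero, .zero =>
      obtain ⟨rfl, hx⟩ := ihx
      obtain ⟨rfl, hy⟩ := ihy
      exact ⟨rfl, (congrArg₂ Presented.comp₂ hx hy).trans (Quot.sound (.id_comp _))⟩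
    | .zero, .of _ | .of _, _ => exact trivial
  | @wl a b c f g h x ih =>
    match a, b, c with
    | .zero, .zero, .zero =>
      obtain ⟨rfl, hx⟩ := ih
      exact ⟨rfl, (congrArg (Presented.wl₂ f) hx).trans (Quot.sound (.wl_id _ _))⟩
    | .zero, .of b, .zero => exact ((isEmpty_path_to_zero b).false g).elim
    | .zero, _, .of _ | .of _, _, _ => exact trivial
  | @wr a b c f g x h ih =>
    match a, b, c with
    | .zero, .zero, .zero =>
      obtain ⟨rfl, hx⟩ := ih
      exact ⟨rfl, (congrArg (Presented.wr₂ · h) hx).trans (Quot.sound (.id_wr _ _))⟩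
    | .zero, .of b, .zero => exact ((isEmpty_path_to_zero b).false h).elim
    | .zero, _, .of _ | .of _, _, _ => exact trivial

end DotCells

/-- A generating arrow of `Δ_ℓ`, as a `1`-cell. -/
abbrev arr {a b : DObj} (e : DArr a b) : Quiver.Hom (V := DeltaL) a b :=
  Quiver.Hom.toPath (V := DObj) e

/-- The `2`-cell `ϑ`. -/
abbrev theta (i : Prop) : Presented.Cell (DotRel i) (path₂ DotArr.d (DotArr.of DArr.d1))
    (path₂ DotArr.d (DotArr.of DArr.d0)) :=
  Presented.mk₂ (.gen .theta)

theorem id_heq_id {C : Type u} [Category.{v} C] {a b : C} (h : a = b) : 𝟙 a ≍ 𝟙 b := by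
  subst h; rfl

theorem isIso_iff_of_heq {C : Type u} [Category.{v} C] {a b a' b' : C} {f : a ⟶ b}
    {f' : a' ⟶ b'} (ha : a = a') (hb : b = b') (h : f ≍ f') : IsIso f ↔ IsIso f' := by
  subst ha hb; cases h; rfl

namespace WeightedCocone

variable {A : Type u₁} [Bicategory.{w₁, v₁} A] [Bicategory.Strict A] {i : Prop}
  {D : StrictPseudofunctor DeltaL Aᵒᵖ} {X : A}

/-- The value of a cocone on a path. -/
def onPath (φ : WeightedCocone (descentWeight i) D X) {b : DeltaL}
    (p : Quiver.Path DotObj.zero (DotObj.of b)) : (D.obj b).unop ⟶ X :=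
  (φ.app b).obj p

/-- The value of a cocone on a `2`-cell. -/
def onCell (φ : WeightedCocone (descentWeight i) D X) {b : DeltaL}
    {p q : Quiver.Path DotObj.zero (DotObj.of b)} (x : Presented.Cell (DotRel i) p q) :
    φ.onPath p ⟶ φ.onPath q :=
  (φ.app b).map x

section Values

variable (φ : WeightedCocone (descentWeight i) D X)

theorem onPath_comp {b c : DeltaL} (p : Quiver.Path DotObj.zero (DotObj.of b)) (f : b ⟶ c) :
    φ.onPath (p.comp ((deltaIncl i).map f)) = (D.map f).unop ≫ φ.onPath p :=
  φ.naturality_obj f p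

theorem onCell_id {b : DeltaL} (p : Quiver.Path DotObj.zero (DotObj.of b)) :
    φ.onCell (Presented.mk₂ (.ofEq (rfl : p = p))) = 𝟙 (φ.onPath p) :=
  (φ.app b).map_id p

theorem onCell_comp {b : DeltaL} {p q r : Quiver.Path DotObj.zero (DotObj.of b)}
    (x : Presented.Cell (DotRel i) p q) (y : Presented.Cell (DotRel i) q r) :
    φ.onCell (Presented.comp₂ x y) = φ.onCell x ≫ φ.onCell y :=
  (φ.app b).map_comp x y

theorem onCell_wr {b c : DeltaL} {p q : Quiver.Path DotObj.zero (DotObj.of b)}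
    (x : Presented.Cell (DotRel i) p q) (f : b ⟶ c) :
    φ.onCell (Presented.wr₂ x ((deltaIncl i).map f)) ≍ (D.map f).unop ◁ φ.onCell x :=
  (conj_eqToHom_iff_heq _ _ _ (φ.onPath_comp q f)).1 (φ.naturality_map f (x := p) (y := q) x)

theorem onCell_wl {b c : DeltaL} (p : Quiver.Path DotObj.zero (DotObj.of b)) {f g : b ⟶ c}
    (α : f ⟶ g) :
    φ.onCell (Presented.wl₂ p ((deltaIncl i).map₂ α)) ≍ (D.map₂ α).unop2 ▷ φ.onPath p :=
  (conj_eqToHom_iff_heq _ _ _ (φ.onPath_comp p g)).1 (φ.naturality₂ α p)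

/-- The value at `d` of a cocone. -/
abbrev leg : (D.obj DObj.one).unop ⟶ X := φ.onPath (b := DObj.one) pathD

theorem onPath_pathD_comp {b : DeltaL} (f : Quiver.Hom (V := DeltaL) DObj.one b) :
    φ.onPath (pathD.comp ((deltaIncl i).map f)) = (D.map f).unop ≫ φ.leg :=
  φ.onPath_comp (b := DObj.one) pathD f

/-- The value at `ϑ` of a cocone, as a `2`-cell between composites of its leg. -/
abbrev legCell : (D.map (arr .d1)).unop ≫ φ.leg ⟶ (D.map (arr .d0)).unop ≫ φ.leg :=
  eqToHom (φ.onPath_pathD_comp (arr .d1)).symm ≫ φ.onCell (b := DObj.two) (theta i) ≫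
    eqToHom (φ.onPath_pathD_comp (arr .d0))

theorem onCell_theta_heq : φ.onCell (b := DObj.two) (theta i) ≍ φ.legCell :=
  ((eqToHom_comp_heq _ _).trans (comp_eqToHom_heq _ _)).symm

theorem isIso_legCell (hi : i) : IsIso φ.legCell := by
  have : IsIso (φ.onCell (b := DObj.two) (theta i)) := by
    refine ⟨φ.onCell (b := DObj.two) (Presented.mk₂ (.gen (.thetaInv hi))), ?_, ?_⟩
    · refine (φ.onCell_comp (b := DObj.two) _ _).symm.trans (.trans ?_ (φ.onCell_id _))
      exact congrArg φ.onCell (Quot.sound (.rel (.theta_inv hi)))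
    · refine (φ.onCell_comp (b := DObj.two) _ _).symm.trans (.trans ?_ (φ.onCell_id _))
      exact congrArg φ.onCell (Quot.sound (.rel (.inv_theta hi)))
  exact (isIso_iff_of_heq (φ.onPath_pathD_comp (arr .d1)) (φ.onPath_pathD_comp (arr .d0))
    φ.onCell_theta_heq).1 this

theorem post_legCell_heq {Y : A} (k : X ⟶ Y) : (φ.post k).legCell ≍ φ.legCell ▷ k :=
  (φ.post k).onCell_theta_heq.symm.trans (whiskerRight_hcongr rfl
    (φ.onPath_pathD_comp (arr .d1)) (φ.onPath_pathD_comp (arr .d0)) φ.onCell_theta_heq)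

end Values

variable {φ ψ : WeightedCocone (descentWeight i) D X}

variable (φ ψ) in
/-- A family of `2`-cells between the values of two cocones on paths. -/
abbrev PathCells : Type w₁ :=
  ∀ (b : DeltaL) (p : Quiver.Path DotObj.zero (DotObj.of b)), φ.onPath p ⟶ ψ.onPath p

/-- The family `τ` is compatible with the `1`-cells of `Δ_ℓ`. -/
def PathCells.IsStable (τ : PathCells φ ψ) : Prop :=
  ∀ ⦃b c : DeltaL⦄ (p : Quiver.Path DotObj.zero (DotObj.of b)) (f : b ⟶ c),
    τ c (p.comp ((deltaIncl i).map f)) ≍ (D.map f).unop ◁ τ b p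

/-- The family `τ` is natural at the `2`-cell `x`. -/
def NatSquare (τ : PathCells φ ψ) {b : DeltaL} {p q : Quiver.Path DotObj.zero (DotObj.of b)}
    (x : Presented.Cell (DotRel i) p q) : Prop :=
  φ.onCell x ≫ τ b q = τ b p ≫ ψ.onCell x

namespace NatSquare

variable {τ : PathCells φ ψ}

theorem id {b : DeltaL} (p : Quiver.Path DotObj.zero (DotObj.of b)) :
    NatSquare τ (Presented.mk₂ (.ofEq (rfl : p = p))) := by
  rw [NatSquare, onCell_id, onCell_id, Category.id_comp, Category.comp_id]

theorem comp {b : DeltaL} {p q r : Quiver.Path DotObj.zero (DotObj.of b)}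
    {x : Presented.Cell (DotRel i) p q} {y : Presented.Cell (DotRel i) q r}
    (hx : NatSquare τ x) (hy : NatSquare τ y) : NatSquare τ (Presented.comp₂ x y) := by
  unfold NatSquare at *
  rw [onCell_comp, onCell_comp, Category.assoc, hy, ← Category.assoc, hx, Category.assoc]

theorem inv {b : DeltaL} {p q : Quiver.Path DotObj.zero (DotObj.of b)}
    {x : Presented.Cell (DotRel i) p q} {y : Presented.Cell (DotRel i) q p}
    (hx : NatSquare τ x) (hxy : Presented.comp₂ x y = Presented.mk₂ (.ofEq rfl))
    (hyx : Presented.comp₂ y x = Presented.mk₂ (.ofEq rfl)) : NatSquare τ y := by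
  have hφ : φ.onCell y ≫ φ.onCell x = 𝟙 _ := by rw [← onCell_comp, hyx, onCell_id]
  have hψ : ψ.onCell x ≫ ψ.onCell y = 𝟙 _ := by rw [← onCell_comp, hxy, onCell_id]
  unfold NatSquare at *
  calc φ.onCell y ≫ τ b p
    _ = φ.onCell y ≫ (τ b p ≫ ψ.onCell x) ≫ ψ.onCell y := by
      rw [Category.assoc, hψ, Category.comp_id]
    _ = (φ.onCell y ≫ φ.onCell x) ≫ τ b q ≫ ψ.onCell y := by rw [← hx]; simp only [Category.assoc]
    _ = τ b q ≫ ψ.onCell y := by rw [hφ, Category.id_comp]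

theorem of_heq {b : DeltaL} {p q p' q' : Quiver.Path DotObj.zero (DotObj.of b)}
    {x : Presented.Cell (DotRel i) p q} {x' : Presented.Cell (DotRel i) p' q'} (hx : NatSquare τ x)
    (hp : p = p') (hq : q = q') (h : x ≍ x') : NatSquare τ x' := by
  subst hp hq; cases h; exact hx

theorem wl (hτ : τ.IsStable) {b c : DeltaL} (f : Quiver.Path DotObj.zero (DotObj.of b))
    {g h : Quiver.Path (DotObj.of b) (DotObj.of c)} (x : PreCell (DotCell i) g h) :
    NatSquare τ (Presented.mk₂ (x.wl f)) := by
  obtain ⟨g, h, α, rfl, rfl, hα⟩ := comesFromDelta x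
  have hx : Presented.mk₂ (E := DotRel i) (x.wl f) = Presented.wl₂ f ((deltaIncl i).map₂ α) := by
    rw [eq_of_heq hα]
    rfl
  rw [hx]
  have h₁ := heq_comp (φ.onPath_comp f g) (φ.onPath_comp f h) (ψ.onPath_comp f h)
    (φ.onCell_wl f α) (hτ f h)
  have h₂ := heq_comp (φ.onPath_comp f g) (ψ.onPath_comp f g) (ψ.onPath_comp f h)
    (hτ f g) (ψ.onCell_wl f α)
  exact eq_of_heq (h₁.trans ((heq_of_eq (whisker_exchange _ _).symm).trans h₂.symm))

theorem nil_wl {b : DeltaL} {p q : Quiver.Path DotObj.zero (DotObj.of b)}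
    {x : PreCell (DotCell i) p q} (hx : NatSquare τ (Presented.mk₂ x)) :
    NatSquare τ (Presented.mk₂ (x.wl Quiver.Path.nil)) :=
  hx.of_heq (Quiver.Path.nil_comp p).symm (Quiver.Path.nil_comp q).symm
    (id_whiskerLeft_heq (B := DeltaDot i) (a := DotObj.zero) (b := DotObj.of b) (f := p) (g := q)
      (Presented.mk₂ x)).symm

theorem wr (hτ : τ.IsStable) {b c : DeltaL} {f g : Quiver.Path DotObj.zero (DotObj.of b)}
    {x : PreCell (DotCell i) f g} (hx : NatSquare τ (Presented.mk₂ x))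
    (h : Quiver.Path (DotObj.of b) (DotObj.of c)) : NatSquare τ (Presented.mk₂ (x.wr h)) := by
  obtain ⟨h, rfl⟩ : ∃ h' : b ⟶ c, (deltaIncl i).map h' = h := ⟨_, deltaIncl_map_unPath h⟩
  have h₁ := heq_comp (φ.onPath_comp f h) (φ.onPath_comp g h) (ψ.onPath_comp g h)
    (φ.onCell_wr (Presented.mk₂ x) h) (hτ g h)
  have h₂ := heq_comp (φ.onPath_comp f h) (ψ.onPath_comp f h) (ψ.onPath_comp g h)
    (hτ f h) (ψ.onCell_wr (Presented.mk₂ x) h)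
  refine eq_of_heq (h₁.trans (HEq.trans (heq_of_eq ?_) h₂.symm))
  rw [← Bicategory.whiskerLeft_comp, ← Bicategory.whiskerLeft_comp]
  exact congrArg _ hx

theorem zero_wr {b : DeltaL} {f g : Quiver.Path DotObj.zero DotObj.zero}
    (x : PreCell (DotCell i) f g) (h : Quiver.Path DotObj.zero (DotObj.of b)) :
    NatSquare τ (Presented.mk₂ (x.wr h)) := by
  obtain ⟨rfl, hx⟩ := trivialAtZero x
  have hid : Presented.mk₂ (E := DotRel i) (x.wr h) = Presented.mk₂ (.ofEq rfl) :=
    (congrArg (Presented.wr₂ · h) hx).trans (Quot.sound (.id_wr _ _))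
  rw [hid]
  exact NatSquare.id _

end NatSquare

/-- If the `2`-cell represented by `x` goes from `𝟢` to an object of `Δ_ℓ`, then the family `τ` is
natural at it; the induction on `x` needs this for all ends at once. -/
def NaturalAt (τ : PathCells φ ψ) :
    ∀ {a b : DotObj} {f g : Quiver.Path a b}, PreCell (DotCell i) f g → Prop
  | .zero, .of b, _, _, x => NatSquare τ (b := b) (Presented.mk₂ x)
  | .zero, .zero, _, _, _ => True
  | .of _, _, _, _, _ => True

theorem naturalAt {τ : PathCells φ ψ} (hτ : τ.IsStable)
    (hθ : NatSquare τ (b := DObj.two) (theta i)) {a b : DotObj} {f g : Quiver.Path a b}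
    (x : PreCell (DotCell i) f g) : NaturalAt τ x := by
  induction x with
  | gen x =>
    cases x with
    | of x => exact trivial
    | theta => exact hθ
    | thetaInv h =>
      exact NatSquare.inv hθ (Quot.sound (.rel (.theta_inv h))) (Quot.sound (.rel (.inv_theta h)))
  | @ofEq a b f g h =>
    subst h
    match a, b with
    | .zero, .of b => exact NatSquare.id f
    | .zero, .zero | .of _, _ => exact trivial
  | @vcomp a b f g h x y ihx ihy =>
    match a, b with
    | .zero, .of b => exact NatSquare.comp ihx ihy
    | .zero, .zero | .of _, _ => exact trivial
  | @wl a b c f g h x ih =>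
    match a, b, c with
    | .zero, .of b, .of c => exact NatSquare.wl hτ f x
    | .zero, .zero, .of c =>
      obtain rfl := path_zero_zero f
      exact NatSquare.nil_wl ih
    | .zero, _, .zero | .of _, _, _ => exact trivial
  | @wr a b c f g x h ih =>
    match a, b, c with
    | .zero, .of b, .of c => exact NatSquare.wr hτ ih h
    | .zero, .zero, .of c => exact NatSquare.zero_wr x h
    | .zero, _, .zero | .of _, _, _ => exact trivial

theorem PathCells.IsStable.natSquare {τ : PathCells φ ψ} (hτ : τ.IsStable)
    (hθ : NatSquare τ (b := DObj.two) (theta i)) {b : DeltaL}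
    {p q : Quiver.Path DotObj.zero (DotObj.of b)} (x : Presented.Cell (DotRel i) p q) :
    NatSquare τ x := by
  induction x using Quot.inductionOn with | _ x
  exact naturalAt hτ hθ x

theorem onPath_eq_tail (φ : WeightedCocone (descentWeight i) D X) {b : DeltaL}
    (p : Quiver.Path DotObj.zero (DotObj.of b)) :
    φ.onPath p = (D.map (X := DObj.one) (Y := b) (tail p)).unop ≫ φ.leg :=
  (congrArg φ.onPath (pathD_comp_tail i p)).symm.trans (φ.onPath_pathD_comp (b := b) (tail p))

theorem onPath_eq_of_leg_eq (h : φ.leg = ψ.leg) {b : DeltaL}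
    (p : Quiver.Path DotObj.zero (DotObj.of b)) : φ.onPath p = ψ.onPath p :=
  (φ.onPath_eq_tail p).trans ((congrArg (_ ≫ ·) h).trans (ψ.onPath_eq_tail p).symm)

theorem isStable_eqToHom
    (h : ∀ (b : DeltaL) (p : Quiver.Path DotObj.zero (DotObj.of b)), φ.onPath p = ψ.onPath p) :
    PathCells.IsStable (φ := φ) (ψ := ψ) fun b p => eqToHom (h b p) := fun b c p f => by
  rw [whiskerLeft_eqToHom]
  exact (eqToHom_heq_id_dom _ _ _).trans
    ((id_heq_id (φ.onPath_comp p f)).trans (eqToHom_heq_id_dom _ _ _).symm)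

theorem ext_of_leg (h : φ.leg = ψ.leg) (hθ : φ.legCell ≍ ψ.legCell) : φ = ψ := by
  have hpath (b : DeltaL) (p : Quiver.Path DotObj.zero (DotObj.of b)) : φ.onPath p = ψ.onPath p :=
    onPath_eq_of_leg_eq h p
  have hθ' : φ.onCell (b := DObj.two) (theta i) ≍ ψ.onCell (b := DObj.two) (theta i) :=
    φ.onCell_theta_heq.trans (hθ.trans ψ.onCell_theta_heq.symm)
  have hnat {b : DeltaL} {p q : Quiver.Path DotObj.zero (DotObj.of b)}
      (x : Presented.Cell (DotRel i) p q) : NatSquare (fun b p => eqToHom (hpath b p)) x :=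
    (isStable_eqToHom hpath).natSquare
      (eq_of_heq ((comp_eqToHom_heq _ _).trans (hθ'.trans (eqToHom_comp_heq _ _).symm))) x
  have happ : φ.app = ψ.app := funext fun b =>
    CategoryTheory.Functor.hext (hpath b) fun p q x =>
      (comp_eqToHom_heq _ (hpath b q)).symm.trans
        ((heq_of_eq (hnat (p := p) (q := q) x)).trans (eqToHom_comp_heq _ _))
  cases φ; cases ψ; cases happ; rfl

/-- The component at `d` of a modification. -/
abbrev legHom (Γ : φ ⟶ ψ) : φ.leg ⟶ ψ.leg := (Γ.app DObj.one).app pathD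

theorem app_pathD_comp_heq (Γ : φ ⟶ ψ) {b : DeltaL} (f : Quiver.Hom (V := DeltaL) DObj.one b) :
    (Γ.app b).app (pathD.comp ((deltaIncl i).map f)) ≍ (D.map f).unop ◁ legHom Γ :=
  (conj_eqToHom_iff_heq _ _ _ (ψ.onPath_pathD_comp f)).1
    (Γ.comm (s := DObj.one) (t := b) f pathD)

theorem hom_ext_of_legHom {Γ Θ : φ ⟶ ψ} (h : legHom Γ = legHom Θ) : Γ = Θ := by
  refine Hom.ext (funext fun b => ?_)
  ext p
  obtain ⟨f, rfl⟩ : ∃ f : Quiver.Hom (V := DeltaL) DObj.one b,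
    pathD.comp ((deltaIncl i).map f) = p := ⟨_, pathD_comp_tail i p⟩
  refine eq_of_heq ((app_pathD_comp_heq Γ f).trans ?_)
  rw [h]
  exact (app_pathD_comp_heq Θ f).symm

theorem legHom_comm (Γ : φ ⟶ ψ) :
    φ.legCell ≫ (D.map (arr .d0)).unop ◁ legHom Γ =
      (D.map (arr .d1)).unop ◁ legHom Γ ≫ ψ.legCell := by
  have hφ := heq_comp (φ.onPath_pathD_comp (arr .d1)) (φ.onPath_pathD_comp (arr .d0))
    (ψ.onPath_pathD_comp (arr .d0)) φ.onCell_theta_heq (app_pathD_comp_heq Γ (arr .d0))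
  have hψ := heq_comp (φ.onPath_pathD_comp (arr .d1)) (ψ.onPath_pathD_comp (arr .d1))
    (ψ.onPath_pathD_comp (arr .d0)) (app_pathD_comp_heq Γ (arr .d1)) ψ.onCell_theta_heq
  exact eq_of_heq
    (hφ.symm.trans ((heq_of_eq ((Γ.app DObj.two).naturality (theta i))).trans hψ))

section Extend

variable (η : φ.leg ⟶ ψ.leg)

/-- The only family compatible with the `1`-cells of `Δ_ℓ` whose value at `d` is `η`. -/
def extend : PathCells φ ψ := fun b p =>
  eqToHom (φ.onPath_eq_tail p) ≫ (D.map (X := DObj.one) (Y := b) (tail p)).unop ◁ η ≫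
    eqToHom (ψ.onPath_eq_tail p).symm

theorem extend_pathD_comp_heq {b : DeltaL} (f : Quiver.Hom (V := DeltaL) DObj.one b) :
    extend η b (pathD.comp ((deltaIncl i).map f)) ≍ (D.map f).unop ◁ η := by
  exact (eqToHom_comp_heq _ _).trans ((comp_eqToHom_heq _ _).trans
    (whiskerLeft_hcongr (congrArg (fun p => (D.map p).unop) (tail_pathD_comp f)) rfl rfl .rfl))

theorem extend_pathD : extend η DObj.one pathD = η :=
  eq_of_heq ((extend_pathD_comp_heq η (𝟙 _)).trans
    ((whiskerLeft_hcongr (congrArg Quiver.Hom.unop (D.map_id _)) rfl rfl .rfl).trans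
      (id_whiskerLeft_heq _)))

theorem extend_isStable : (extend η).IsStable := fun b c p f => by
  obtain ⟨g, rfl⟩ : ∃ g : Quiver.Hom (V := DeltaL) DObj.one b,
    pathD.comp ((deltaIncl i).map g) = p := ⟨_, pathD_comp_tail i p⟩
  have hcomp : (pathD.comp ((deltaIncl i).map g)).comp ((deltaIncl i).map f) =
      pathD.comp ((deltaIncl i).map (g ≫ f)) :=
    (Quiver.Path.comp_assoc _ _ _).trans (congrArg pathD.comp ((deltaIncl i).map_comp g f).symm)
  have hD : (D.map (g ≫ f)).unop ◁ η ≍ (D.map f).unop ◁ (D.map g).unop ◁ η :=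
    (whiskerLeft_hcongr (congrArg Quiver.Hom.unop (D.map_comp g f)) rfl rfl .rfl).trans
      (comp_whiskerLeft_heq _ _ _)
  exact (congr_arg_heq (extend η c) hcomp).trans ((extend_pathD_comp_heq η (g ≫ f)).trans
    (hD.trans (whiskerLeft_hcongr rfl (φ.onPath_pathD_comp g).symm (ψ.onPath_pathD_comp g).symm
      (extend_pathD_comp_heq η g).symm)))

variable {η}
  (hη : φ.legCell ≫ (D.map (arr .d0)).unop ◁ η = (D.map (arr .d1)).unop ◁ η ≫ ψ.legCell)

include hη

theorem extend_natSquare_theta : NatSquare (extend η) (b := DObj.two) (theta i) := by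
  have hφ := heq_comp (φ.onPath_pathD_comp (arr .d1)) (φ.onPath_pathD_comp (arr .d0))
    (ψ.onPath_pathD_comp (arr .d0)) φ.onCell_theta_heq (extend_pathD_comp_heq η (arr .d0))
  have hψ := heq_comp (φ.onPath_pathD_comp (arr .d1)) (ψ.onPath_pathD_comp (arr .d1))
    (ψ.onPath_pathD_comp (arr .d0)) (extend_pathD_comp_heq η (arr .d1)) ψ.onCell_theta_heq
  exact eq_of_heq (hφ.trans ((heq_of_eq hη).trans hψ.symm))

theorem exists_legHom_eq : ∃ Γ : φ ⟶ ψ, legHom Γ = η :=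
  ⟨{ app b :=
      { app p := extend η b p
        naturality _ _ x := (extend_isStable η).natSquare (extend_natSquare_theta hη) x }
     comm f p := (conj_eqToHom_iff_heq _ _ _ (ψ.onPath_comp p f)).2 (extend_isStable η p f) },
    extend_pathD η⟩

end Extend

end WeightedCocone

section

variable {C : Type u} [Category.{v} C]

theorem comp_heq_comp_eqToHom_comp {a b c a' b' b'' c' : C} {f : a ⟶ b} {g : b ⟶ c}
    {f' : a' ⟶ b'} {g' : b'' ⟶ c'} (ha : a = a') (hb : b = b') (hc : c = c') (e : b' = b'')
    (hf : f ≍ f') (hg : g ≍ g') : f ≫ g ≍ f' ≫ eqToHom e ≫ g' := by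
  subst ha hb hc e; cases hf; cases hg; simp

theorem eq_iff_of_heq {a b a' b' : C} {f g : a ⟶ b} {f' g' : a' ⟶ b'} (ha : a = a') (hb : b = b')
    (hf : f ≍ f') (hg : g ≍ g') : f = g ↔ f' = g' := by
  subst ha hb; cases hf; cases hg; rfl

theorem conj_comp_conj {a b c d : C} {x : b ⟶ c} {y : c ⟶ b} (h : x ≫ y = 𝟙 b) (e : a = b)
    (e' : c = d) :
    (eqToHom e ≫ x ≫ eqToHom e') ≫ (eqToHom e'.symm ≫ y ≫ eqToHom e.symm) = 𝟙 a := by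
  subst e e'; simpa using h

end

section OppositeCells

variable {A : Type u₁} [Bicategory.{w₁, v₁} A] {a b : Aᵒᵖ} {f g f' g' : a ⟶ b} {η : f ⟶ g}
  {η' : f' ⟶ g'}

theorem unop2_hcongr (hf : f = f') (hg : g = g') (h : η ≍ η') : η.unop2 ≍ η'.unop2 := by
  subst hf hg; cases h; rfl

theorem heq_of_unop2_heq (hf : f = f') (hg : g = g') (h : η.unop2 ≍ η'.unop2) : η ≍ η' := by
  subst hf hg; exact heq_of_eq (hom2_ext (eq_of_heq h))

end OppositeCells

variable {A : Type u₁} [Bicategory.{w₁, v₁} A] [Bicategory.Strict A]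
  {D : StrictPseudofunctor DeltaL Aᵒᵖ} {X : A}

theorem map_path₂_comp (D : StrictPseudofunctor DeltaL Aᵒᵖ) {a b c : DObj} (e : DArr a b)
    (e' : DArr b c) (f : (D.obj a).unop ⟶ X) :
    (D.map (X := a) (Y := c) (path₂ (V := DObj) e e')).unop ≫ f =
      (D.map (arr e')).unop ≫ (D.map (arr e)).unop ≫ f :=
  (congrArg (·.unop ≫ f) (D.map_comp (arr e) (arr e'))).trans (Bicategory.Strict.assoc _ _ _)

/-- A generating `2`-cell of `Δ_ℓ` as a `2`-cell of `Δ_ℓ`. -/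
abbrev cell {a b : DObj} {f g : Quiver.Path a b} (x : DCell f g) :
    Presented.Cell (noRel DCell) f g :=
  Presented.mk₂ (.gen x)

/-- The `2`-cell of `A` assigned to a generating `2`-cell of `Δ_ℓ`. -/
abbrev genCell (D : StrictPseudofunctor DeltaL Aᵒᵖ) {a b : DObj} {f g : Quiver.Path a b}
    (x : DCell f g) : (D.map (X := a) (Y := b) f).unop ⟶ (D.map (X := a) (Y := b) g).unop :=
  (D.map₂ (a := a) (b := b) (f := f) (g := g) (cell x)).unop2

/-- The `1`-cell `f` and the `2`-cell `θ`, as candidate values at `d` and `ϑ`, satisfy the two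
equations imposed on `ϑ` in the presentation of `Δ̇_ℓ`. -/
structure IsCodescentDatum (D : StrictPseudofunctor DeltaL Aᵒᵖ) {X : A}
    (f : (D.obj DObj.one).unop ⟶ X)
    (θ : (D.map (arr .d1)).unop ≫ f ⟶ (D.map (arr .d0)).unop ≫ f) : Prop where
  assoc : genCell D .s21 ▷ f ≫ eqToHom (map_path₂_comp D .d1 .p1 f) ≫
        (D.map (arr .p1)).unop ◁ θ =
      eqToHom (map_path₂_comp D .d1 .p2 f) ≫ (D.map (arr .p2)).unop ◁ θ ≫
        eqToHom (map_path₂_comp D .d0 .p2 f).symm ≫ genCell D .s20 ▷ f ≫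
          eqToHom (map_path₂_comp D .d1 .p0 f) ≫ (D.map (arr .p0)).unop ◁ θ ≫
            eqToHom (map_path₂_comp D .d0 .p0 f).symm ≫ genCell D .s00 ▷ f ≫
              eqToHom (map_path₂_comp D .d0 .p1 f)
  unit : genCell D .n1 ▷ f ≫ eqToHom (map_path₂_comp D .d1 .s0 f) ≫ (D.map (arr .s0)).unop ◁ θ =
      genCell D .n0 ▷ f ≫ eqToHom (map_path₂_comp D .d0 .s0 f)

theorem isCodescentDatum_iff_of_heq {f : (D.obj DObj.one).unop ⟶ X}
    {θ : (D.map (arr .d1)).unop ≫ f ⟶ (D.map (arr .d0)).unop ≫ f}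
    {k : ∀ {b c : DObj}, DArr .one b → DArr b c → ((D.obj c).unop ⟶ X)}
    (hk : ∀ {b c : DObj} (e : DArr .one b) (e' : DArr b c),
      k e e' = (D.map (arr e')).unop ≫ (D.map (arr e)).unop ≫ f)
    {τ : ∀ {b : DObj} (e : DArr .two b), k .d1 e ⟶ k .d0 e}
    (hτ : ∀ {b : DObj} (e : DArr .two b), τ e ≍ (D.map (arr e)).unop ◁ θ)
    {s₂₁ : k .d1 .p2 ⟶ k .d1 .p1} (h₂₁ : s₂₁ ≍ genCell D .s21 ▷ f)
    {s₂₀ : k .d0 .p2 ⟶ k .d1 .p0} (h₂₀ : s₂₀ ≍ genCell D .s20 ▷ f)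
    {s₀₀ : k .d0 .p0 ⟶ k .d0 .p1} (h₀₀ : s₀₀ ≍ genCell D .s00 ▷ f)
    {k₁ : (D.obj DObj.one).unop ⟶ X} (hk₁ : k₁ = (D.map (𝟙 _)).unop ≫ f)
    {n₁ : k₁ ⟶ k .d1 .s0} (hn₁ : n₁ ≍ genCell D .n1 ▷ f)
    {n₀ : k₁ ⟶ k .d0 .s0} (hn₀ : n₀ ≍ genCell D .n0 ▷ f) :
    IsCodescentDatum D f θ ↔
      s₂₁ ≫ τ .p1 = τ .p2 ≫ s₂₀ ≫ τ .p0 ≫ s₀₀ ∧ n₁ ≫ τ .s0 = n₀ := by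
  have hk' {b c : DObj} (e : DArr .one b) (e' : DArr b c) :
      k e e' = (D.map (X := DObj.one) (Y := c) (path₂ (V := DObj) e e')).unop ≫ f :=
    (hk e e').trans (map_path₂_comp D e e' f).symm
  have assoc_lhs := comp_heq_comp_eqToHom_comp (hk' .d1 .p2) (hk' .d1 .p1) (hk .d0 .p1)
    (map_path₂_comp D .d1 .p1 f) h₂₁ (hτ .p1)
  have assoc_rhs := (comp_heq_comp_eqToHom_comp (hk .d1 .p2) (hk .d0 .p2) (hk .d0 .p1)
    (map_path₂_comp D .d0 .p2 f).symm (hτ .p2)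
      (comp_heq_comp_eqToHom_comp (hk' .d0 .p2) (hk' .d1 .p0) (hk .d0 .p1)
        (map_path₂_comp D .d1 .p0 f) h₂₀
        (comp_heq_comp_eqToHom_comp (hk .d1 .p0) (hk .d0 .p0) (hk .d0 .p1)
          (map_path₂_comp D .d0 .p0 f).symm (hτ .p0)
          (h₀₀.trans (comp_eqToHom_heq _ (map_path₂_comp D .d0 .p1 f)).symm)))).trans
    (eqToHom_comp_heq _ (map_path₂_comp D .d1 .p2 f)).symm
  have unit_lhs := comp_heq_comp_eqToHom_comp hk₁ (hk' .d1 .s0) (hk .d0 .s0)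
    (map_path₂_comp D .d1 .s0 f) hn₁ (hτ .s0)
  have unit_rhs := hn₀.trans (comp_eqToHom_heq _ (map_path₂_comp D .d0 .s0 f)).symm
  have assoc_iff := eq_iff_of_heq (hk' .d1 .p2) (hk .d0 .p1) assoc_lhs assoc_rhs
  have unit_iff := eq_iff_of_heq hk₁ (hk .d0 .s0) unit_lhs unit_rhs
  exact ⟨fun h => ⟨assoc_iff.2 h.assoc, unit_iff.2 h.unit⟩,
    fun h => ⟨assoc_iff.1 h.1, unit_iff.1 h.2⟩⟩

namespace WeightedCocone

variable {i : Prop} (φ : WeightedCocone (descentWeight i) D X)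

theorem onCell_gen {a b : DObj} {f g : Quiver.Path a b} (x : DCell f g)
    (p : Quiver.Path DotObj.zero (DotObj.of a)) :
    φ.onCell (b := b) (Presented.mk₂ (.wl p (dotGen i x))) ≍ genCell D x ▷ φ.onPath (b := a) p := by
  have h := φ.onCell_wl p (Presented.mk₂ (.gen x) : Presented.Cell (noRel DCell) f g)
  cases x <;> exact h

theorem onCell_theta_wr {b : DObj} (e : DArr .two b) :
    φ.onCell (b := b) (Presented.mk₂ (.wr (.gen .theta)
      (Quiver.Hom.toPath (DotArr.of e)))) ≍ (D.map (arr e)).unop ◁ φ.legCell :=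
  (φ.onCell_wr (b := DObj.two) (theta i) (arr e)).trans
    (whiskerLeft_hcongr rfl (φ.onPath_pathD_comp (arr .d1)) (φ.onPath_pathD_comp (arr .d0))
      φ.onCell_theta_heq)

theorem onCell_vcomp {b : DeltaL} {p q r : Quiver.Path DotObj.zero (DotObj.of b)}
    (x : PreCell (DotCell i) p q) (y : PreCell (DotCell i) q r) :
    φ.onCell (Presented.mk₂ (x.vcomp y)) =
      φ.onCell (Presented.mk₂ x) ≫ φ.onCell (Presented.mk₂ y) :=
  φ.onCell_comp (Presented.mk₂ x) (Presented.mk₂ y)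

theorem onPath_pathD_comp_path₂ {b c : DObj} (e : DArr .one b) (e' : DArr b c) :
    φ.onPath (b := c) (pathD.comp (path₂ (DotArr.of e) (DotArr.of e'))) =
      (D.map (arr e')).unop ≫ (D.map (arr e)).unop ≫ φ.leg :=
  (φ.onPath_comp (b := DObj.one) pathD (path₂ (V := DObj) e e')).trans (map_path₂_comp D e e' _)

theorem isCodescentDatum : IsCodescentDatum D φ.leg φ.legCell := by
  refine (isCodescentDatum_iff_of_heq φ.onPath_pathD_comp_path₂ φ.onCell_theta_wr
    (φ.onCell_gen .s21 pathD) (φ.onCell_gen .s20 pathD) (φ.onCell_gen .s00 pathD)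
    (φ.onPath_pathD_comp (𝟙 _)) (φ.onCell_gen .n1 pathD) (φ.onCell_gen .n0 pathD)).2 ⟨?_, ?_⟩
  · have h := congrArg (φ.onCell (b := DObj.three)) (Quot.sound (.rel .assoc))
    exact (φ.onCell_vcomp _ _).symm.trans (h.trans ((φ.onCell_vcomp _ _).trans (congrArg (_ ≫ ·)
      ((φ.onCell_vcomp _ _).trans (congrArg (_ ≫ ·) (φ.onCell_vcomp _ _))))))
  · have h := congrArg (φ.onCell (b := DObj.one)) (Quot.sound (.rel .unit))
    exact (φ.onCell_vcomp _ _).symm.trans h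

end WeightedCocone

section Extension

variable {A : Type u₁} [Bicategory.{w₁, v₁} A] [Bicategory.Strict A]
  (D : StrictPseudofunctor DeltaL Aᵒᵖ) {X : A} (f : (D.obj DObj.one).unop ⟶ X)
  (θ : (D.map (arr .d1)).unop ≫ f ⟶ (D.map (arr .d0)).unop ≫ f)

/-- The extension of the action of `D` on objects and arrows to the generators of `Δ̇`, with
values `X` at `0` and `f` at `d`. -/
def extPre : DotObj ⥤q Aᵒᵖ where
  obj
    | .zero => op X
    | .of b => D.obj b
  map
    | .d => f.op
    | .of e => D.map (arr e)

theorem pathMap_extPre {a b : DObj} (p : Quiver.Path a b) :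
    pathMap (extPre D f) (dotIncl.mapPath p) = D.map (X := a) (Y := b) p := by
  induction p with
  | nil => exact (D.map_id a).symm
  | cons p e ih =>
    exact (congrArg (· ≫ D.map (arr e)) ih).trans (D.map_comp (b := _) p (arr e)).symm

theorem pathMap_extPre_pathD : pathMap (extPre D f) pathD = f.op :=
  Bicategory.Strict.id_comp (B := Aᵒᵖ) f.op

theorem pathMap_extPre_pathD_comp {b : DObj} (p : Quiver.Path DObj.one b) :
    pathMap (extPre D f) (pathD.comp (dotIncl.mapPath p)) =
      f.op ≫ D.map (X := DObj.one) (Y := b) p :=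
  (pathMap_comp _ _ _).trans
    (congrArg₂ (· ≫ ·) (pathMap_extPre_pathD D f) (pathMap_extPre D f p))

theorem pathMap_extPre_d {b : DObj} (e : DArr .one b) :
    (pathMap (extPre D f) (path₂ DotArr.d (DotArr.of e))).unop = (D.map (arr e)).unop ≫ f :=
  congrArg ((D.map (arr e)).unop ≫ ·) (Bicategory.Strict.comp_id f)

theorem pathMap_extPre_path₂ {a b : DObj} (e : DArr .one a) (e' : DArr a b) :
    (pathMap (extPre D f) (path₂ DotArr.d (DotArr.of e) |>.cons (DotArr.of e'))).unop =
      (D.map (arr e')).unop ≫ (D.map (arr e)).unop ≫ f :=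
  congrArg ((D.map (arr e')).unop ≫ ·) (pathMap_extPre_d D f e)

variable {i : Prop} {D f θ}

/-- The extension of the action of `D` on generating `2`-cells to those of `Δ̇`, with value `θ`
at `ϑ`. -/
noncomputable def extCell (hθ : i → IsIso θ) ⦃a b : DotObj⦄ ⦃p q : Quiver.Path a b⦄ :
    DotCell i p q → (pathMap (extPre D f) p ⟶ pathMap (extPre D f) q)
  | .of (a := a) (b := b) (f := p) (g := q) x => eqToHom (pathMap_extPre D f p) ≫
      D.map₂ (a := a) (b := b) (f := p) (g := q) (cell x) ≫ eqToHom (pathMap_extPre D f q).symm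
  | .theta => opCell θ (pathMap_extPre_d D f .d1) (pathMap_extPre_d D f .d0).symm
  | .thetaInv h =>
      opCell (@inv _ _ _ _ θ (hθ h)) (pathMap_extPre_d D f .d0) (pathMap_extPre_d D f .d1).symm

variable (hθ : i → IsIso θ)

theorem cellMap_extCell_gen {b : DObj} {p q : Quiver.Path DObj.one b} (x : DCell p q) :
    (cellMap (extPre D f) (extCell hθ) (.wl pathD (dotGen i x))).unop2 ≍ genCell D x ▷ f := by
  refine unop2_hcongr (η' := f.op ◁ D.map₂ (f := p) (g := q) (cell x))
    (pathMap_extPre_pathD_comp D f p) (pathMap_extPre_pathD_comp D f q) ?_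
  refine (eqToHom_comp_heq _ _).trans ((comp_eqToHom_heq _ _).trans ?_)
  exact whiskerLeft_hcongr (pathMap_extPre_pathD D f) (pathMap_extPre D f p)
    (pathMap_extPre D f q) ((eqToHom_comp_heq _ _).trans (comp_eqToHom_heq _ _))

theorem extCell_theta_heq : extCell hθ .theta ≍ Bicategory.Opposite.op2 θ :=
  heq_of_unop2_heq (congrArg Quiver.Hom.op (pathMap_extPre_d D f .d1))
    (congrArg Quiver.Hom.op (pathMap_extPre_d D f .d0))
    ((eqToHom_comp_heq _ _).trans (comp_eqToHom_heq _ _))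

theorem cellMap_extCell_theta {b : DObj} (e : DArr .two b) :
    (cellMap (extPre D f) (extCell hθ)
      (.wr (.gen .theta) (Quiver.Hom.toPath (DotArr.of e)))).unop2 ≍
      (D.map (arr e)).unop ◁ θ := by
  have harr : pathMap (extPre D f) (Quiver.Hom.toPath (DotArr.of e)) = D.map (arr e) :=
    Bicategory.Strict.id_comp (B := Aᵒᵖ) _
  refine unop2_hcongr (η' := Bicategory.Opposite.op2 θ ▷ D.map (arr e))
    (congrArg Quiver.Hom.op (pathMap_extPre_path₂ D f .d1 e))
    (congrArg Quiver.Hom.op (pathMap_extPre_path₂ D f .d0 e)) ?_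
  refine (eqToHom_comp_heq _ _).trans ((comp_eqToHom_heq _ _).trans ?_)
  exact whiskerRight_hcongr harr (congrArg Quiver.Hom.op (pathMap_extPre_d D f .d1))
    (congrArg Quiver.Hom.op (pathMap_extPre_d D f .d0)) (extCell_theta_heq hθ)

variable (h : IsCodescentDatum D f θ)

include h in
theorem cellMap_extCell_rel ⦃a b : DotObj⦄ ⦃p q : Quiver.Path a b⦄ (x y : PreCell (DotCell i) p q)
    (hxy : DotRel i x y) :
    cellMap (extPre D f) (extCell hθ) x = cellMap (extPre D f) (extCell hθ) y := by
  obtain ⟨hassoc, hunit⟩ := (isCodescentDatum_iff_of_heq (pathMap_extPre_path₂ D f)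
    (cellMap_extCell_theta hθ) (cellMap_extCell_gen hθ .s21) (cellMap_extCell_gen hθ .s20)
    (cellMap_extCell_gen hθ .s00) (congrArg Quiver.Hom.unop (pathMap_extPre_pathD_comp D f .nil))
    (cellMap_extCell_gen hθ .n1) (cellMap_extCell_gen hθ .n0)).1 h
  cases hxy with
  | assoc => exact hom2_ext hassoc
  | unit => exact hom2_ext hunit
  | theta_inv hi =>
    have := hθ hi
    exact hom2_ext (conj_comp_conj (IsIso.hom_inv_id θ) _ _)
  | inv_theta hi =>
    have := hθ hi
    exact hom2_ext (conj_comp_conj (IsIso.inv_hom_id θ) _ _)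

/-- The extension of `D` to `Δ̇` given by a codescent datum. -/
noncomputable def extension : StrictPseudofunctor (DeltaDot i) Aᵒᵖ :=
  Presented.lift (extPre D f) (extCell hθ) (cellMap_extCell_rel hθ h)

theorem extension_map {a b : DeltaL} (p : a ⟶ b) :
    (extension hθ h).map ((deltaIncl i).map p) = D.map p :=
  (congrArg (pathMap (extPre D f)) (deltaIncl_map p)).trans (pathMap_extPre D f p)

theorem extension_map₂_gen {a b : DObj} {p q : Quiver.Path a b} (x : DCell p q) :
    (extension hθ h).map₂ ((deltaIncl i).map₂ (a := a) (b := b) (f := p) (g := q) (cell x)) ≍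
      D.map₂ (a := a) (b := b) (f := p) (g := q) (cell x) := by
  have hx : (eqToHom (pathMap_extPre D f p) ≫ D.map₂ (a := a) (b := b) (f := p) (g := q) (cell x) ≫
      eqToHom (pathMap_extPre D f q).symm) ≍
      D.map₂ (a := a) (b := b) (f := p) (g := q) (cell x) :=
    (eqToHom_comp_heq _ _).trans (comp_eqToHom_heq _ _)
  cases x <;> exact hx

variable {a b c : DeltaL}

theorem extension_map₂_id (p : a ⟶ b) :
    (extension hθ h).map₂ ((deltaIncl i).map₂ (𝟙 p)) ≍ D.map₂ (𝟙 p) := by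
  simp only [PrelaxFunctor.map₂_id]
  exact id_heq_id (extension_map hθ h p)

theorem extension_map₂_comp {p q r : a ⟶ b} {x : p ⟶ q} {y : q ⟶ r}
    (hx : (extension hθ h).map₂ ((deltaIncl i).map₂ x) ≍ D.map₂ x)
    (hy : (extension hθ h).map₂ ((deltaIncl i).map₂ y) ≍ D.map₂ y) :
    (extension hθ h).map₂ ((deltaIncl i).map₂ (x ≫ y)) ≍ D.map₂ (x ≫ y) := by
  simp only [PrelaxFunctor.map₂_comp]
  exact heq_comp (extension_map hθ h p) (extension_map hθ h q) (extension_map hθ h r) hx hy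

theorem extension_map₂_whiskerLeft (p : a ⟶ b) {q r : b ⟶ c} {x : q ⟶ r}
    (hx : (extension hθ h).map₂ ((deltaIncl i).map₂ x) ≍ D.map₂ x) :
    (extension hθ h).map₂ ((deltaIncl i).map₂ (p ◁ x)) ≍ D.map₂ (p ◁ x) :=
  (map₂_hcongr _ ((deltaIncl i).map_comp _ _) ((deltaIncl i).map_comp _ _)
    (map₂_whiskerLeft_heq (deltaIncl i) p x)).trans <|
  (map₂_whiskerLeft_heq _ _ _).trans <|
  (whiskerLeft_hcongr (extension_map hθ h p) (extension_map hθ h q) (extension_map hθ h r) hx).trans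
    (map₂_whiskerLeft_heq D p x).symm

theorem extension_map₂_whiskerRight {p q : a ⟶ b} {x : p ⟶ q} (r : b ⟶ c)
    (hx : (extension hθ h).map₂ ((deltaIncl i).map₂ x) ≍ D.map₂ x) :
    (extension hθ h).map₂ ((deltaIncl i).map₂ (x ▷ r)) ≍ D.map₂ (x ▷ r) :=
  (map₂_hcongr _ ((deltaIncl i).map_comp _ _) ((deltaIncl i).map_comp _ _)
    (map₂_whiskerRight_heq (deltaIncl i) x r)).trans <|
  (map₂_whiskerRight_heq _ _ _).trans <|
  (whiskerRight_hcongr (extension_map hθ h r) (extension_map hθ h p)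
    (extension_map hθ h q) hx).trans
    (map₂_whiskerRight_heq D x r).symm

theorem extension_map₂ {p q : a ⟶ b} (x : p ⟶ q) :
    (extension hθ h).map₂ ((deltaIncl i).map₂ x) ≍ D.map₂ x := by
  induction x using Quot.inductionOn with | _ x
  induction x with
  | gen x => exact extension_map₂_gen hθ h x
  | ofEq e => subst e; exact extension_map₂_id hθ h _
  | vcomp x y ihx ihy => exact extension_map₂_comp hθ h ihx ihy
  | wl p x ih => exact extension_map₂_whiskerLeft hθ h p ih
  | wr x r ih => exact extension_map₂_whiskerRight hθ h r ih

/-- The object `0` of `Δ̇`. -/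
abbrev dotZero (i : Prop) : DeltaDot i := DotObj.zero

theorem extension_map_comp (x : dotZero i ⟶ (deltaIncl i).obj b) (p : b ⟶ c) :
    (extension hθ h).map (x ≫ (deltaIncl i).map p) =
      CategoryStruct.comp (Y := D.obj b) ((extension hθ h).map x) (D.map p) :=
  ((extension hθ h).map_comp x ((deltaIncl i).map p)).trans
    (congrArg ((extension hθ h).map x ≫ ·) (extension_map hθ h p))

theorem extension_map₂_wr {x y : dotZero i ⟶ (deltaIncl i).obj b} (k : x ⟶ y) (p : b ⟶ c) :
    ((extension hθ h).map₂ (k ▷ (deltaIncl i).map p)).unop2 ≍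
      (D.map p).unop ◁ ((extension hθ h).map₂ k).unop2 :=
  unop2_hcongr (η' := Bicategory.whiskerRight (b := D.obj b) ((extension hθ h).map₂ k) (D.map p))
    (extension_map_comp hθ h x p) (extension_map_comp hθ h y p)
    ((map₂_whiskerRight_heq _ k _).trans
      (whiskerRight_hcongr (extension_map hθ h p) rfl rfl .rfl))

theorem extension_map₂_wl (x : dotZero i ⟶ (deltaIncl i).obj b) {p q : b ⟶ c} (α : p ⟶ q) :
    ((extension hθ h).map₂ (x ◁ (deltaIncl i).map₂ α)).unop2 ≍
      (D.map₂ α).unop2 ▷ ((extension hθ h).map x).unop :=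
  unop2_hcongr (η' := Bicategory.whiskerLeft (b := D.obj b) ((extension hθ h).map x) (D.map₂ α))
    (extension_map_comp hθ h x p) (extension_map_comp hθ h x q)
    ((map₂_whiskerLeft_heq _ x _).trans
      (whiskerLeft_hcongr rfl (extension_map hθ h p) (extension_map hθ h q)
        (extension_map₂ hθ h α)))

/-- The cocone given by a codescent datum: the restriction to `0` of the action of its extension
on hom-categories. -/
noncomputable def coconeOfDatum : WeightedCocone (descentWeight i) D X where
  app b :=
    { obj p := ((extension hθ h).map (X := DotObj.zero) (Y := DotObj.of b) p).unop
      map {p q} x := ((extension hθ h).map₂ (a := DotObj.zero) (b := DotObj.of b)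
        (f := p) (g := q) x).unop2
      map_id p := congrArg (·.unop2) ((extension hθ h).map₂_id
        (a := DotObj.zero) (b := DotObj.of b) p)
      map_comp {p q r} x y := congrArg (·.unop2) ((extension hθ h).map₂_comp
        (a := DotObj.zero) (b := DotObj.of b) (f := p) (g := q) (h := r) x y) }
  naturality_obj p x := congrArg Quiver.Hom.unop (extension_map_comp hθ h x p)
  naturality_map {_ _} p {x y} k :=
    (conj_eqToHom_iff_heq _ _ _ (congrArg Quiver.Hom.unop (extension_map_comp hθ h y p))).2
      (extension_map₂_wr hθ h (x := x) (y := y) k p)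
  naturality₂ {_ _ _ q} α x :=
    (conj_eqToHom_iff_heq _ _ _ (congrArg Quiver.Hom.unop (extension_map_comp hθ h x q))).2
      (extension_map₂_wl hθ h x α)

theorem coconeOfDatum_leg : (coconeOfDatum hθ h).leg = f :=
  Bicategory.Strict.comp_id f

theorem coconeOfDatum_legCell : (coconeOfDatum hθ h).legCell ≍ θ :=
  (coconeOfDatum hθ h).onCell_theta_heq.symm.trans
    ((eqToHom_comp_heq _ _).trans (comp_eqToHom_heq _ _))

end Extension

section

variable {C : Type u} [Category.{v} C] {D : Type u₁} [Category.{v₁} D] (F : C ⥤ D)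

theorem map_comp_eqToHom_comp_heq {a b b' c : C} {f : a ⟶ b} {g : b' ⟶ c} {a' d d' c' : D}
    {f' : a' ⟶ d} {g' : d' ⟶ c'} (e : b = b') (e' : d = d') (ha : F.obj a = a') (hb : F.obj b = d)
    (hc : F.obj c = c') (hf : F.map f ≍ f') (hg : F.map g ≍ g') :
    F.map (f ≫ eqToHom e ≫ g) ≍ f' ≫ eqToHom e' ≫ g' := by
  subst ha hb hc e e'; cases hf; cases hg; simp

theorem map_comp_eqToHom_heq {a b b' : C} {f : a ⟶ b} {a' d d' : D} {f' : a' ⟶ d} (e : b = b')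
    (e' : d = d') (hf : F.map f ≍ f') : F.map (f ≫ eqToHom e) ≍ f' ≫ eqToHom e' := by
  subst e e'; simpa using hf

theorem map_eqToHom_comp_heq {a b b' : C} {f : b' ⟶ a} {a' d d' : D} {f' : d' ⟶ a'} (e : b = b')
    (e' : d = d') (hf : F.map f ≍ f') : F.map (eqToHom e ≫ f) ≍ eqToHom e' ≫ f' := by
  subst e e'; simpa using hf

end

theorem map_conj_whiskerRight_heq {A : Type u₁} [Bicategory.{w₁, v₁} A] {X Y Z : A} {C : Type u}
    [Category.{v} C] (F : (X ⟶ Z) ⥤ C) {g₁ g h h₁ : X ⟶ Y} (e : g₁ = g) (β : g ⟶ h) (e' : h = h₁)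
    (f : Y ⟶ Z) : F.map ((eqToHom e ≫ β ≫ eqToHom e') ▷ f) ≍ F.map (β ▷ f) := by
  subst e e'; simp

section StrictMorphisms

variable {A : Type u₁} [Bicategory.{w₁, v₁} A] [Bicategory.Strict A]
  {B : Type u} [Bicategory.{w, v} B] [Bicategory.Strict B] {M : TwoMonad B}
  (Jt : StrictPseudofunctor A (LaxAlgS M))

/-- The underlying `2`-cell of `J η`. -/
abbrev jMap₂ {X Y : A} {f g : X ⟶ Y} (η : f ⟶ g) : jMap Jt f ⟶ jMap Jt g := (Jt.map₂ η).hom.hom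

theorem jMap₂_act {X Y : A} {f g : X ⟶ Y} (η : f ⟶ g) :
    M.T.map₂ (jMap₂ Jt η) ▷ (jAlg Jt Y).act ≍ (jAlg Jt X).act ◁ jMap₂ Jt η := by
  obtain ⟨hf, hf'⟩ := (Jt.map f).mem
  obtain ⟨hg, hg'⟩ := (Jt.map g).mem
  have h := (Jt.map₂ η).hom.comm
  rw [hf', hg'] at h
  exact (comp_eqToHom_heq _ _).symm.trans ((heq_of_eq h).trans (eqToHom_comp_heq _ _))

theorem jMap_mulCell {X Y : A} (f : X ⟶ Y) :
    M.T.map (M.T.map (jMap Jt f)) ◁ (jAlg Jt Y).mulCell ≍ (jAlg Jt X).mulCell ▷ jMap Jt f := by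
  obtain ⟨hf, hf'⟩ := (Jt.map f).mem
  have h := (Jt.map f).hom.mul_cell
  rw [hf'] at h
  simp only [whiskerLeft_eqToHom, eqToHom_trans, PrelaxFunctor.map₂_eqToHom,
    eqToHom_whiskerRight, eqToHom_trans_assoc] at h
  exact (comp_eqToHom_heq _ _).symm.trans ((heq_of_eq h).trans
    ((eqToHom_comp_heq _ _).trans (comp_eqToHom_heq _ _)))

theorem jMap_unitCell {X Y : A} (f : X ⟶ Y) :
    jMap Jt f ◁ (jAlg Jt Y).unitCell ≍ (jAlg Jt X).unitCell ▷ jMap Jt f := by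
  obtain ⟨hf, hf'⟩ := (Jt.map f).mem
  have h := (Jt.map f).hom.unit_cell
  rw [hf'] at h
  simp only [whiskerLeft_eqToHom, eqToHom_trans] at h
  exact ((eqToHom_comp_heq _ _).trans (comp_eqToHom_heq _ _)).symm.trans ((heq_of_eq h).trans
    ((eqToHom_comp_heq _ _).trans (comp_eqToHom_heq _ _)))

end StrictMorphisms

namespace TwoAdjunction

variable {A : Type u₁} [Bicategory.{w₁, v₁} A] [Bicategory.Strict A]
  {B : Type u} [Bicategory.{w, v} B] [Bicategory.Strict B] {M : TwoMonad B}
  {Jt : StrictPseudofunctor A (LaxAlgS M)} {E : StrictPseudofunctor B A}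
  (adj : TwoAdjunction E ((Jt.comp (strictIncl M)).comp (forgetPs M)))

/-- Transposition along the adjunction. -/
abbrev transpose (Z : B) (X : A) : (E.obj Z ⟶ X) ⥤ (Z ⟶ (jAlg Jt X).carrier) :=
  arrowFunctor ((Jt.comp (strictIncl M)).comp (forgetPs M)) (adj.unit Z) X

instance (Z : B) (X : A) : (adj.transpose Z X).IsIso :=
  adj.isUniversalArrow_unit Z X

theorem transpose_obj {Z : B} {X : A} (f : E.obj Z ⟶ X) :
    (adj.transpose Z X).obj f = adj.rho Z ≫ jMap Jt f := rfl

theorem transpose_comp {Z : B} {X Y : A} (f : E.obj Z ⟶ X) (g : X ⟶ Y) :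
    (adj.transpose Z Y).obj (f ≫ g) = (adj.transpose Z X).obj f ≫ jMap Jt g :=
  arrowFunctor_obj_comp _ f g

theorem transpose_map_comp {Z Z' : B} {X : A} (g : Z ⟶ Z') (f : E.obj Z' ⟶ X) :
    (adj.transpose Z X).obj (E.map g ≫ f) = g ≫ (adj.transpose Z' X).obj f := by
  rw [transpose_comp, transpose_obj, transpose_obj, ← rho_naturality, Bicategory.Strict.assoc]

theorem transpose_actRho (Z : B) : (adj.transpose (M.T.obj Z) (E.obj Z)).obj (adj.actRho Z) =
    M.T.map (adj.rho Z) ≫ (jAlg Jt (E.obj Z)).act := by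
  unfold actRho
  rw [transpose_map_comp, transpose_obj, eps_rho, Bicategory.Strict.comp_id]

theorem transpose_actRho_comp {Z : B} {X : A} (f : E.obj Z ⟶ X) :
    (adj.transpose (M.T.obj Z) X).obj (adj.actRho Z ≫ f) =
      M.T.map ((adj.transpose Z X).obj f) ≫ (jAlg Jt X).act := by
  rw [transpose_comp, transpose_actRho, Bicategory.Strict.assoc, ← jMap_act, transpose_obj,
    M.map_map_comp]

theorem transpose_whiskerLeft_map {Z Z' : B} {X : A} (g : Z ⟶ Z') {f f' : E.obj Z' ⟶ X}
    (η : f ⟶ f') :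
    (adj.transpose Z X).map (E.map g ◁ η) ≍ g ◁ (adj.transpose Z' X).map η :=
  (arrowFunctor_map_whiskerLeft _ _ η).trans
    ((whiskerLeft_hcongr (adj.rho_naturality g).symm rfl rfl .rfl).trans
      (comp_whiskerLeft_heq _ _ _))

theorem transpose_whiskerLeft_actRho {Z : B} {X : A} {f f' : E.obj Z ⟶ X} (η : f ⟶ f') :
    (adj.transpose (M.T.obj Z) X).map (adj.actRho Z ◁ η) ≍
      M.T.map₂ ((adj.transpose Z X).map η) ▷ (jAlg Jt X).act := by
  refine (arrowFunctor_map_whiskerLeft _ _ η).trans ?_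
  refine (whiskerLeft_hcongr (adj.transpose_actRho Z) rfl rfl .rfl).trans ?_
  refine (comp_whiskerLeft_heq _ _ _).trans ?_
  refine (whiskerLeft_hcongr rfl (jMap_act Jt f).symm (jMap_act Jt f').symm
    (jMap₂_act Jt η).symm).trans ?_
  refine (whisker_assoc_heq _ _ _).symm.trans ?_
  exact whiskerRight_hcongr rfl (M.T.map_comp _ _).symm (M.T.map_comp _ _).symm
    (map₂_whiskerLeft_heq M.T _ _).symm

theorem transpose_map₂_whiskerRight {Z Z' : B} {X : A} {g g' : Z ⟶ Z'} (β : g ⟶ g')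
    (f : E.obj Z' ⟶ X) :
    (adj.transpose Z X).map (E.map₂ β ▷ f) ≍ β ▷ (adj.transpose Z' X).obj f := by
  refine (arrowFunctor_map_whiskerRight _ _ f).trans ?_
  have h := adj.unit_naturality₂ β
  refine (whiskerRight_hcongr rfl (adj.rho_naturality g).symm (adj.rho_naturality g').symm
    ?_).trans (whiskerRight_comp_heq β (adj.rho Z') (jMap Jt f)).symm
  exact ((heq_of_eq h).trans ((eqToHom_comp_heq _ _).trans (comp_eqToHom_heq _ _))).symm

theorem transpose_eps_comp {X Y : A} (f : X ⟶ Y) :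
    (adj.transpose _ Y).obj (adj.eps X ≫ f) = jMap Jt f := by
  rw [transpose_comp, transpose_obj, eps_rho, Bicategory.Strict.id_comp]

theorem transpose_map₂_eps {Z : B} {X Y : A} {g g' : Z ⟶ (jAlg Jt X).carrier} (β : g ⟶ g')
    (f : X ⟶ Y) :
    (adj.transpose Z Y).map ((E.map₂ β ▷ adj.eps X) ▷ f) ≍ β ▷ jMap Jt f :=
  (functor_map_hcongr _ (Bicategory.Strict.assoc _ _ _) (Bicategory.Strict.assoc _ _ _)
    (whiskerRight_comp_heq _ _ _).symm).trans
    ((adj.transpose_map₂_whiskerRight β _).trans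
      (whiskerRight_hcongr (adj.transpose_eps_comp f) rfl rfl .rfl))

variable {y : LaxAlg M} {X : A}

theorem diagram_map_arr (y : LaxAlg M) {a b : DObj} (e : DArr a b) :
    ((adj.diagram y).map (arr e)).unop = ((adj.diagramPre y).map e).unop :=
  Bicategory.Strict.comp_id _

variable {f : E.obj y.carrier ⟶ X}

theorem genCell_s20 (y : LaxAlg M) (f : E.obj y.carrier ⟶ X) :
    ∃ e, genCell (adj.diagram y) .s20 ▷ f = eqToHom e := by
  have h : genCell (adj.diagram y) .s20 = eqToHom ((adj.diagramPre_path₂ y DArr.d0 DArr.p2).trans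
      ((adj.actRho_naturality y.act).trans (adj.diagramPre_path₂ y DArr.d1 DArr.p0).symm)) := by
    refine (congrArg (eqToHom _ ≫ ·) (Category.id_comp _)).trans ?_
    exact eqToHom_trans _ _
  exact ⟨_, (congrArg (· ▷ f) h).trans (eqToHom_whiskerRight _ _)⟩

theorem transpose_s00 (f : E.obj y.carrier ⟶ X) :
    (adj.transpose _ X).map (genCell (adj.diagram y) .s00 ▷ f) ≍
      y.mulCell ▷ (adj.transpose _ X).obj f :=
  (map_conj_whiskerRight_heq _ ((adj.diagramPre_path₂ y .d0 .p0).trans (E.map_comp _ _).symm) _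
    ((E.map_comp _ _).trans (adj.diagramPre_path₂ y .d0 .p1).symm) f).trans
      (adj.transpose_map₂_whiskerRight y.mulCell f)

theorem transpose_n0 (f : E.obj y.carrier ⟶ X) :
    (adj.transpose _ X).map (genCell (adj.diagram y) .n0 ▷ f) ≍
      y.unitCell ▷ (adj.transpose _ X).obj f :=
  (map_conj_whiskerRight_heq _ (E.map_id _).symm _
    ((E.map_comp _ _).trans (adj.diagramPre_path₂ y .d0 .s0).symm) f).trans
      (adj.transpose_map₂_whiskerRight y.unitCell f)

theorem transpose_s21 (f : E.obj y.carrier ⟶ X) :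
    (adj.transpose _ X).map (genCell (adj.diagram y) .s21 ▷ f) ≍
      M.T.map (M.T.map ((adj.transpose _ X).obj f)) ◁ (jAlg Jt X).mulCell := by
  have h₁ := (adj.diagramPre_path₂ y DArr.d1 DArr.p2).trans (adj.actRho_actRho y.carrier)
  have h₂ := (adj.diagramPre_path₂ y DArr.d1 DArr.p1).trans (adj.mul_actRho y.carrier).symm
  refine (map_conj_whiskerRight_heq _ h₁ _ h₂.symm f).trans ?_
  refine (adj.transpose_map₂_eps _ f).trans ?_
  refine (whisker_assoc_heq _ _ _).trans ?_
  refine (whiskerLeft_hcongr rfl ?_ ?_ (jMap_mulCell Jt f).symm).trans ?_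
  · rw [Bicategory.Strict.assoc, ← jMap_act, ← M.map_map_comp, ← jMap_act, M.map_map_comp]
  · rw [Bicategory.Strict.assoc, ← jMap_act, M.mul_naturality_assoc]
  · refine (comp_whiskerLeft_heq _ _ _).symm.trans (whiskerLeft_hcongr ?_ rfl rfl .rfl)
    rw [transpose_obj, M.T.map_comp, M.T.map_comp]

theorem transpose_n1 (f : E.obj y.carrier ⟶ X) :
    (adj.transpose _ X).map (genCell (adj.diagram y) .n1 ▷ f) ≍
      (adj.transpose _ X).obj f ◁ (jAlg Jt X).unitCell := by
  have h₁ := (adj.rho_eps y.carrier).symm.trans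
    (congrArg (E.map · ≫ adj.eps _) (Bicategory.Strict.comp_id (adj.rho y.carrier)).symm)
  have h₂ := (adj.diagramPre_path₂ y DArr.d1 DArr.s0).trans (adj.unit_actRho y.carrier).symm
  refine (map_conj_whiskerRight_heq _ h₁ _ h₂.symm f).trans ?_
  refine (adj.transpose_map₂_eps _ f).trans ?_
  refine (whisker_assoc_heq _ _ _).trans ?_
  refine (whiskerLeft_hcongr rfl ?_ ?_ (jMap_unitCell Jt f).symm).trans ?_
  · rw [Bicategory.Strict.id_comp, Bicategory.Strict.comp_id]
  · rw [Bicategory.Strict.assoc, ← jMap_act, M.unit_naturality_assoc]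
  · exact (comp_whiskerLeft_heq _ _ _).symm

variable (θ : ((adj.diagram y).map (arr .d1)).unop ≫ f ⟶ ((adj.diagram y).map (arr .d0)).unop ≫ f)

theorem transpose_d1 (y : LaxAlg M) (f : E.obj y.carrier ⟶ X) :
    (adj.transpose _ X).obj (((adj.diagram y).map (arr .d1)).unop ≫ f) =
      M.T.map ((adj.transpose _ X).obj f) ≫ (jAlg Jt X).act :=
  (congrArg (fun g => (adj.transpose _ X).obj (g ≫ f)) (adj.diagram_map_arr y .d1)).trans
    (adj.transpose_actRho_comp f)

theorem transpose_d0 (y : LaxAlg M) (f : E.obj y.carrier ⟶ X) :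
    (adj.transpose _ X).obj (((adj.diagram y).map (arr .d0)).unop ≫ f) =
      y.act ≫ (adj.transpose _ X).obj f :=
  (congrArg (fun g => (adj.transpose _ X).obj (g ≫ f)) (adj.diagram_map_arr y .d0)).trans
    (adj.transpose_map_comp y.act f)

/-- The transpose of a `2`-cell `d¹ f ⇒ d⁰ f`. -/
def transposeCell : M.T.map ((adj.transpose _ X).obj f) ≫ (jAlg Jt X).act ⟶
    y.act ≫ (adj.transpose _ X).obj f :=
  eqToHom (adj.transpose_d1 y f).symm ≫ (adj.transpose _ X).map θ ≫ eqToHom (adj.transpose_d0 y f)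

theorem transposeCell_heq : (adj.transpose _ X).map θ ≍ adj.transposeCell θ :=
  ((eqToHom_comp_heq _ _).trans (comp_eqToHom_heq _ _)).symm

variable {θ}

theorem transpose_comp_of_eq_map {Z W : B} {g : Z ⟶ W} {g' : E.obj Z ⟶ E.obj W}
    (hg : g' = E.map g) (k : E.obj W ⟶ X) :
    (adj.transpose Z X).obj (g' ≫ k) = g ≫ (adj.transpose W X).obj k := by
  subst hg; exact adj.transpose_map_comp g k

theorem transpose_p2_comp (k : E.obj (M.T.obj y.carrier) ⟶ X) :
    (adj.transpose _ X).obj (((adj.diagram y).map (arr .p2)).unop ≫ k) =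
      M.T.map ((adj.transpose _ X).obj k) ≫ (jAlg Jt X).act :=
  (congrArg (fun g => (adj.transpose _ X).obj (g ≫ k)) (adj.diagram_map_arr y .p2)).trans
    (adj.transpose_actRho_comp k)

variable (θ)

theorem transpose_whiskerLeft_of_eq_map {Z : B} {g : Z ⟶ M.T.obj y.carrier}
    {g' : E.obj Z ⟶ E.obj (M.T.obj y.carrier)} (hg : g' = E.map g) :
    (adj.transpose Z X).map (g' ◁ θ) ≍ g ◁ adj.transposeCell θ := by
  subst hg
  exact (adj.transpose_whiskerLeft_map g θ).trans (whiskerLeft_hcongr rfl (adj.transpose_d1 y f)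
    (adj.transpose_d0 y f) (adj.transposeCell_heq θ))

theorem transpose_p2_whiskerLeft :
    (adj.transpose _ X).map (((adj.diagram y).map (arr .p2)).unop ◁ θ) ≍
      M.T.map₂ (adj.transposeCell θ) ▷ (jAlg Jt X).act :=
  have hp2 := adj.diagram_map_arr y .p2
  have hd1 := adj.transpose_d1 y f
  have hd0 := adj.transpose_d0 y f
  (functor_map_hcongr _ (congrArg (· ≫ _) hp2) (congrArg (· ≫ _) hp2)
    (whiskerLeft_hcongr hp2 rfl rfl .rfl)).trans ((adj.transpose_whiskerLeft_actRho θ).trans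
      (whiskerRight_hcongr rfl (congrArg _ hd1) (congrArg _ hd0)
        (map₂_hcongr M.T hd1 hd0 (adj.transposeCell_heq θ))))

theorem transpose_assoc_iff :
    genCell (adj.diagram y) .s21 ▷ f ≫ eqToHom (map_path₂_comp (adj.diagram y) .d1 .p1 f) ≫
        ((adj.diagram y).map (arr .p1)).unop ◁ θ =
      eqToHom (map_path₂_comp (adj.diagram y) .d1 .p2 f) ≫
        ((adj.diagram y).map (arr .p2)).unop ◁ θ ≫
        eqToHom (map_path₂_comp (adj.diagram y) .d0 .p2 f).symm ≫
          genCell (adj.diagram y) .s20 ▷ f ≫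
          eqToHom (map_path₂_comp (adj.diagram y) .d1 .p0 f) ≫
            ((adj.diagram y).map (arr .p0)).unop ◁ θ ≫
            eqToHom (map_path₂_comp (adj.diagram y) .d0 .p0 f).symm ≫
              genCell (adj.diagram y) .s00 ▷ f ≫
              eqToHom (map_path₂_comp (adj.diagram y) .d0 .p1 f) ↔
    M.T.map (M.T.map ((adj.transpose _ X).obj f)) ◁ (jAlg Jt X).mulCell ≫
        eqToHom (M.mul_naturality_assoc _ _) ≫ M.mul y.carrier ◁ adj.transposeCell θ =
      eqToHom (M.map_map_comp _ _ _).symm ≫ M.T.map₂ (adj.transposeCell θ) ▷ (jAlg Jt X).act ≫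
        eqToHom (M.map_map_comp _ _ _) ≫ M.T.map y.act ◁ adj.transposeCell θ ≫
          eqToHom (Bicategory.Strict.assoc _ _ _).symm ≫ y.mulCell ▷ (adj.transpose _ X).obj f ≫
            eqToHom (Bicategory.Strict.assoc _ _ _) := by
  obtain ⟨e, he⟩ := adj.genCell_s20 y f
  have e₂₀ := (map_path₂_comp (adj.diagram y) .d0 .p2 f).symm.trans
    (e.trans (map_path₂_comp (adj.diagram y) .d1 .p0 f))
  rw [he, eqToHom_trans_assoc, eqToHom_trans_assoc]
  let F := adj.transpose (M.T.obj (M.T.obj y.carrier)) X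
  have hp0 := adj.diagram_map_arr y .p0
  have hp1 := adj.diagram_map_arr y .p1
  have hd1 := adj.transpose_d1 y f
  have hd0 := adj.transpose_d0 y f
  have hp2d1 := (adj.transpose_p2_comp _).trans ((congrArg (M.T.map · ≫ _) hd1).trans
    (M.map_map_comp (M.T.map _) _ _))
  have hp2d0 := (adj.transpose_p2_comp _).trans (congrArg (M.T.map · ≫ _) hd0)
  have hp1d1 := (adj.transpose_comp_of_eq_map hp1 _).trans
    ((congrArg (M.mul _ ≫ ·) hd1).trans (M.mul_naturality_assoc _ _).symm)
  have hp1d0 := (adj.transpose_comp_of_eq_map hp1 _).trans (congrArg (M.mul _ ≫ ·) hd0)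
  have hp0d0 := (adj.transpose_comp_of_eq_map hp0 _).trans (congrArg (M.T.map y.act ≫ ·) hd0)
  have hp0d1 := (adj.transpose_comp_of_eq_map hp0 _).trans (congrArg (M.T.map y.act ≫ ·) hd1)
  have hs21 := (congrArg F.obj (map_path₂_comp (adj.diagram y) .d1 .p2 f)).trans hp2d1
  have lhs := map_comp_eqToHom_comp_heq F (map_path₂_comp (adj.diagram y) .d1 .p1 f)
    (M.mul_naturality_assoc _ _) hs21
    ((congrArg F.obj (map_path₂_comp (adj.diagram y) .d1 .p1 f)).trans hp1d1) hp1d0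
    (adj.transpose_s21 f) (adj.transpose_whiskerLeft_of_eq_map θ hp1)
  have hs00 := map_comp_eqToHom_heq F (map_path₂_comp (adj.diagram y) .d0 .p1 f)
    (Bicategory.Strict.assoc _ _ _) (adj.transpose_s00 f)
  have hp0s00 := map_comp_eqToHom_comp_heq F (map_path₂_comp (adj.diagram y) .d0 .p0 f).symm
    (Bicategory.Strict.assoc _ _ _).symm hp0d1 hp0d0 hp1d0
    (adj.transpose_whiskerLeft_of_eq_map θ hp0) hs00
  have rhs := map_eqToHom_comp_heq F (map_path₂_comp (adj.diagram y) .d1 .p2 f)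
    (M.map_map_comp _ _ _).symm (map_comp_eqToHom_comp_heq F e₂₀ (M.map_map_comp _ _ _)
      (hp2d1.trans (M.map_map_comp _ _ _).symm) hp2d0 hp1d0 (adj.transpose_p2_whiskerLeft θ) hp0s00)
  exact F.map_injective.eq_iff.symm.trans (eq_iff_of_heq hs21 hp1d0 lhs rhs)

theorem transpose_unit_iff :
    genCell (adj.diagram y) .n1 ▷ f ≫ eqToHom (map_path₂_comp (adj.diagram y) .d1 .s0 f) ≫
        ((adj.diagram y).map (arr .s0)).unop ◁ θ =
      genCell (adj.diagram y) .n0 ▷ f ≫ eqToHom (map_path₂_comp (adj.diagram y) .d0 .s0 f) ↔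
    eqToHom (Bicategory.Strict.comp_id _).symm ≫
        (adj.transpose _ X).obj f ◁ (jAlg Jt X).unitCell ≫
        eqToHom (M.unit_naturality_assoc _ _) ≫ M.unit y.carrier ◁ adj.transposeCell θ =
      eqToHom (Bicategory.Strict.id_comp _).symm ≫ y.unitCell ▷ (adj.transpose _ X).obj f ≫
        eqToHom (Bicategory.Strict.assoc _ _ _) := by
  let F := adj.transpose y.carrier X
  have hs0 := adj.diagram_map_arr y .s0
  have hs0d0 := (adj.transpose_comp_of_eq_map hs0 _).trans
    (congrArg (M.unit _ ≫ ·) (adj.transpose_d0 y f))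
  have hs0d1 := (adj.transpose_comp_of_eq_map hs0 _).trans
    ((congrArg (M.unit _ ≫ ·) (adj.transpose_d1 y f)).trans (M.unit_naturality_assoc _ _).symm)
  have hn1 := (congrArg F.obj (Bicategory.Strict.id_comp f)).trans
    (Bicategory.Strict.comp_id _).symm
  have lhs := (map_comp_eqToHom_comp_heq F (map_path₂_comp (adj.diagram y) .d1 .s0 f)
    (M.unit_naturality_assoc _ _) hn1
    ((congrArg F.obj (map_path₂_comp (adj.diagram y) .d1 .s0 f)).trans hs0d1) hs0d0
    (adj.transpose_n1 f) (adj.transpose_whiskerLeft_of_eq_map θ hs0)).trans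
      (eqToHom_comp_heq _ (Bicategory.Strict.comp_id _).symm).symm
  have rhs := (map_comp_eqToHom_heq F (map_path₂_comp (adj.diagram y) .d0 .s0 f)
    (Bicategory.Strict.assoc _ _ _) (adj.transpose_n0 f)).trans
      (eqToHom_comp_heq _ (Bicategory.Strict.id_comp _).symm).symm
  exact F.map_injective.eq_iff.symm.trans
    (eq_iff_of_heq (congrArg F.obj (Bicategory.Strict.id_comp f)) hs0d0 lhs rhs)

end TwoAdjunction

namespace LaxAlg

variable {B : Type u} [Bicategory.{w, v} B] [Bicategory.Strict B] {M : TwoMonad B}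

theorem Mor.ext_heq {y z : LaxAlg M} {f g : y ⟶ z} (h : f.hom = g.hom) (e : f.cell ≍ g.cell) :
    f = g := by
  obtain ⟨f, c, _, _⟩ := f
  obtain ⟨g, c', _, _⟩ := g
  obtain rfl : f = g := h
  cases e
  rfl

theorem Mor₂.heq_of_hom_heq {y z : LaxAlg M} {f g f' g' : y ⟶ z} (hf : f = f') (hg : g = g')
    {η : f ⟶ g} {η' : f' ⟶ g'} (e : η.hom ≍ η'.hom) : η ≍ η' := by
  subst hf hg
  exact heq_of_eq (Mor₂.ext (eq_of_heq e))

theorem comp_cell_heq_of_strict {x y z : LaxAlg M} (f : x ⟶ y) (g : y ⟶ z)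
    (hg : (strictMor M).mem g) : (f ≫ g).cell ≍ f.cell ▷ g.hom := by
  obtain ⟨h, hg⟩ := hg
  change eqToHom _ ≫ M.T.map f.hom ◁ g.cell ≫ eqToHom _ ≫ f.cell ▷ g.hom ≫ eqToHom _ ≍ _
  rw [hg, whiskerLeft_eqToHom]
  exact (eqToHom_comp_heq _ _).trans ((eqToHom_comp_heq _ _).trans
    ((eqToHom_comp_heq _ _).trans (comp_eqToHom_heq _ _)))

end LaxAlg

theorem LocallyFull.Mor₂.heq_of_hom_heq {B : Type u} [Bicategory.{w, v} B] {P : OneCells B}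
    {y z : LocallyFull P} {f g f' g' : y ⟶ z} (hf : f = f') (hg : g = g')
    {η : f ⟶ g} {η' : f' ⟶ g'} (e : η.hom ≍ η'.hom) : η ≍ η' := by
  subst hf hg
  exact heq_of_eq (Mor₂.ext (eq_of_heq e))

namespace TwoAdjunction

variable {A : Type u₁} [Bicategory.{w₁, v₁} A] [Bicategory.Strict A]
  {B : Type u} [Bicategory.{w, v} B] [Bicategory.Strict B] {M : TwoMonad B}
  {Jt : StrictPseudofunctor A (LaxAlgS M)} {E : StrictPseudofunctor B A}
  (adj : TwoAdjunction E ((Jt.comp (strictIncl M)).comp (forgetPs M)))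
  {y : LaxAlg M} {X : A}

theorem transpose_d0_whiskerLeft {f g : E.obj y.carrier ⟶ X} (η : f ⟶ g) :
    (adj.transpose _ X).map (((adj.diagram y).map (arr .d0)).unop ◁ η) ≍
      y.act ◁ (adj.transpose _ X).map η :=
  (functor_map_hcongr _ (congrArg (· ≫ f) (adj.diagram_map_arr y .d0))
    (congrArg (· ≫ g) (adj.diagram_map_arr y .d0))
    (whiskerLeft_hcongr (adj.diagram_map_arr y .d0) rfl rfl .rfl)).trans
    (adj.transpose_whiskerLeft_map y.act η)

theorem transpose_d1_whiskerLeft {f g : E.obj y.carrier ⟶ X} (η : f ⟶ g) :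
    (adj.transpose _ X).map (((adj.diagram y).map (arr .d1)).unop ◁ η) ≍
      M.T.map₂ ((adj.transpose _ X).map η) ▷ (jAlg Jt X).act :=
  (functor_map_hcongr _ (congrArg (· ≫ f) (adj.diagram_map_arr y .d1))
    (congrArg (· ≫ g) (adj.diagram_map_arr y .d1))
    (whiskerLeft_hcongr (adj.diagram_map_arr y .d1) rfl rfl .rfl)).trans
    (adj.transpose_whiskerLeft_actRho η)

theorem transposeCell_comm_iff {f g : E.obj y.carrier ⟶ X}
    (θ : ((adj.diagram y).map (arr .d1)).unop ≫ f ⟶ ((adj.diagram y).map (arr .d0)).unop ≫ f)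
    (κ : ((adj.diagram y).map (arr .d1)).unop ≫ g ⟶ ((adj.diagram y).map (arr .d0)).unop ≫ g)
    (η : f ⟶ g) :
    θ ≫ ((adj.diagram y).map (arr .d0)).unop ◁ η =
        ((adj.diagram y).map (arr .d1)).unop ◁ η ≫ κ ↔
      M.T.map₂ ((adj.transpose _ X).map η) ▷ (jAlg Jt X).act ≫ adj.transposeCell κ =
        adj.transposeCell θ ≫ y.act ◁ (adj.transpose _ X).map η := by
  have d1f := adj.transpose_d1 y f
  have d0g := adj.transpose_d0 y g
  have map_left := (heq_of_eq ((adj.transpose _ X).map_comp θ _)).trans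
    (heq_comp d1f (adj.transpose_d0 y f) d0g (adj.transposeCell_heq θ)
      (adj.transpose_d0_whiskerLeft η))
  have map_right := (heq_of_eq ((adj.transpose _ X).map_comp _ κ)).trans
    (heq_comp d1f (adj.transpose_d1 y g) d0g (adj.transpose_d1_whiskerLeft η)
      (adj.transposeCell_heq κ))
  exact (adj.transpose _ X).map_injective.eq_iff.symm.trans
    ((eq_iff_of_heq d1f d0g map_left map_right).trans eq_comm)

variable {i : Prop}

/-- The lax morphism `y ⟶ J X` corresponding to a cocone under `𝒜_y` with vertex `X`: the transpose
of the leg at `d`, with structure cell the transpose of the `2`-cell at `ϑ`. -/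
def morOfCocone (φ : WeightedCocone (descentWeight i) (adj.diagram y) X) : y ⟶ jAlg Jt X :=
  LaxAlg.Mor.mk ((adj.transpose _ X).obj φ.leg) (adj.transposeCell φ.legCell)
    ((adj.transpose_assoc_iff _).1 φ.isCodescentDatum.assoc)
    ((adj.transpose_unit_iff _).1 φ.isCodescentDatum.unit)

theorem morOfCocone_injective : Function.Injective
    (adj.morOfCocone : WeightedCocone (descentWeight i) (adj.diagram y) X → _) := by
  intro φ ψ h
  have leg_eq : φ.leg = ψ.leg := (adj.transpose _ X).bijective_obj.1 (congrArg (·.hom) h)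
  have cell_heq : adj.transposeCell φ.legCell ≍ adj.transposeCell ψ.legCell :=
    congr_arg_heq (fun f : y ⟶ jAlg Jt X => f.cell) h
  refine WeightedCocone.ext_of_leg leg_eq ((functor_map_heq_iff (adj.transpose _ X)
    (congrArg (_ ≫ ·) leg_eq) (congrArg (_ ≫ ·) leg_eq)).1 ?_)
  exact (adj.transposeCell_heq _).trans (cell_heq.trans (adj.transposeCell_heq _).symm)

theorem isIso_transposeCell_iff {f : E.obj y.carrier ⟶ X}
    (θ : ((adj.diagram y).map (arr .d1)).unop ≫ f ⟶ ((adj.diagram y).map (arr .d0)).unop ≫ f) :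
    IsIso (adj.transposeCell θ) ↔ IsIso θ :=
  (isIso_iff_of_heq (adj.transpose_d1 y f) (adj.transpose_d0 y f)
    (adj.transposeCell_heq θ)).symm.trans
    (isIso_iff_of_reflects_iso (C := E.obj (M.T.obj y.carrier) ⟶ X) θ (adj.transpose _ X))

theorem transposeCell_surjective (f : E.obj y.carrier ⟶ X) :
    Function.Surjective (adj.transposeCell : (_ ≫ f ⟶ _ ≫ f) → _) := fun c =>
  have ⟨θ, hθ⟩ := (adj.transpose _ X).map_surjective
    (eqToHom (adj.transpose_d1 y f) ≫ c ≫ eqToHom (adj.transpose_d0 y f).symm)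
  ⟨θ, eq_of_heq ((adj.transposeCell_heq θ).symm.trans
    ((heq_of_eq hθ).trans ((eqToHom_comp_heq _ _).trans (comp_eqToHom_heq _ _))))⟩

theorem exists_morOfCocone_eq (u : y ⟶ jAlg Jt X) (hu : i → IsIso u.cell) :
    ∃ φ : WeightedCocone (descentWeight i) (adj.diagram y) X, adj.morOfCocone φ = u := by
  obtain ⟨u, c, hc, hc'⟩ := u
  obtain ⟨f, rfl⟩ := (adj.transpose _ X).bijective_obj.2 u
  obtain ⟨θ, rfl⟩ := adj.transposeCell_surjective f c
  have datum : IsCodescentDatum (adj.diagram y) f θ :=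
    ⟨(adj.transpose_assoc_iff θ).2 hc, (adj.transpose_unit_iff θ).2 hc'⟩
  have hθ (hi : i) : IsIso θ := (adj.isIso_transposeCell_iff θ).1 (hu hi)
  have leg_eq := coconeOfDatum_leg hθ datum
  refine ⟨coconeOfDatum hθ datum,
    LaxAlg.Mor.ext_heq (congrArg (adj.transpose _ X).obj leg_eq) ?_⟩
  exact (adj.transposeCell_heq _).symm.trans ((functor_map_hcongr _ (congrArg (_ ≫ ·) leg_eq)
    (congrArg (_ ≫ ·) leg_eq) (coconeOfDatum_legCell hθ datum)).trans (adj.transposeCell_heq θ))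

/-- Cocones under `𝒜_y` with vertex `X` as lax morphisms `y ⟶ J X`. -/
def coconeFunctor (i : Prop) (y : LaxAlg M) (X : A) :
    WeightedCocone (descentWeight i) (adj.diagram y) X ⥤ (y ⟶ jAlg Jt X) where
  obj φ := adj.morOfCocone φ
  map {φ ψ} Γ := LaxAlg.Mor₂.mk (f := adj.morOfCocone φ) (h := adj.morOfCocone ψ)
    ((adj.transpose _ X).map (WeightedCocone.legHom Γ))
    ((adj.transposeCell_comm_iff _ _ _).1 (WeightedCocone.legHom_comm Γ))
  map_id φ := LaxAlg.Mor₂.ext ((adj.transpose _ X).map_id φ.leg)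
  map_comp Γ Θ := LaxAlg.Mor₂.ext
    ((adj.transpose _ X).map_comp (WeightedCocone.legHom Γ) (WeightedCocone.legHom Θ))

instance (y : LaxAlg M) (X : A) : (adj.coconeFunctor i y X).Faithful where
  map_injective h := WeightedCocone.hom_ext_of_legHom
    ((adj.transpose _ X).map_injective (congrArg (·.hom) h))

instance (y : LaxAlg M) (X : A) : (adj.coconeFunctor i y X).Full where
  map_surjective := by
    rintro φ ψ ⟨η, hη⟩
    obtain ⟨η, rfl⟩ := (adj.transpose _ X).map_surjective η
    obtain ⟨Γ, rfl⟩ :=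
      WeightedCocone.exists_legHom_eq ((adj.transposeCell_comm_iff _ _ η).2 hη)
    exact ⟨Γ, rfl⟩

instance (y : LaxAlg M) (X : A) : (adj.coconeFunctor False y X).IsIso where
  bijective_obj :=
    ⟨adj.morOfCocone_injective, fun u => adj.exists_morOfCocone_eq u False.elim⟩

theorem morOfCocone_post (φ : WeightedCocone (descentWeight i) (adj.diagram y) X) {Y : A}
    (k : X ⟶ Y) : adj.morOfCocone (φ.post k) = adj.morOfCocone φ ≫ (Jt.map k).hom := by
  refine LaxAlg.Mor.ext_heq (adj.transpose_comp φ.leg k) ?_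
  have cell_post : (adj.transpose _ Y).map (φ.post k).legCell ≍
      (adj.transpose _ Y).map (φ.legCell ▷ k) :=
    functor_map_hcongr (adj.transpose _ Y) (Bicategory.Strict.assoc _ _ _).symm
      (Bicategory.Strict.assoc _ _ _).symm (φ.post_legCell_heq k)
  have cell_comp : (adj.morOfCocone φ ≫ (Jt.map k).hom).cell ≍
      adj.transposeCell φ.legCell ▷ (Jt.map k).hom.hom :=
    LaxAlg.comp_cell_heq_of_strict (adj.morOfCocone φ) _ (Jt.map k).mem
  exact (adj.transposeCell_heq _).symm.trans (cell_post.trans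
    ((arrowFunctor_map_whiskerRight _ _ k).trans
      ((whiskerRight_hcongr rfl (adj.transpose_d1 y φ.leg) (adj.transpose_d0 y φ.leg)
        (adj.transposeCell_heq _)).trans cell_comp.symm)))

theorem coconeFunctor_map_postFunctor_map_heq
    (φ : WeightedCocone (descentWeight i) (adj.diagram y) X) {Y : A} {k l : X ⟶ Y} (η : k ⟶ l) :
    (adj.coconeFunctor i y Y).map ((φ.postFunctor Y).map η) ≍
      adj.morOfCocone φ ◁ (Jt.map₂ η).hom :=
  LaxAlg.Mor₂.heq_of_hom_heq (adj.morOfCocone_post φ k) (adj.morOfCocone_post φ l)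
    (arrowFunctor_map_whiskerLeft _ φ.leg η)

theorem postFunctor_comp_coconeFunctor
    (φ : WeightedCocone (descentWeight i) (adj.diagram y) X) (Y : A) :
    φ.postFunctor Y ⋙ adj.coconeFunctor i y Y =
      arrowFunctor ((Jt.comp (strictIncl M)).comp (ell M)) (adj.morOfCocone φ) Y :=
  CategoryTheory.Functor.hext (adj.morOfCocone_post φ) fun _ _ η =>
    adj.coconeFunctor_map_postFunctor_map_heq φ η

theorem isUniversal_iff_isUniversalArrow_morOfCocone
    (φ : WeightedCocone (descentWeight False) (adj.diagram y) X) :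
    φ.IsUniversal ↔
      IsUniversalArrow ((Jt.comp (strictIncl M)).comp (ell M)) (adj.morOfCocone φ) :=
  forall_congr' fun Y => (functor_isIso_iff _).symm.trans
    ((functor_isIso_comp_iff _ (adj.coconeFunctor False y Y)).symm.trans
      (iff_of_eq (congrArg Functor.IsIso (adj.postFunctor_comp_coconeFunctor φ Y))))

theorem isStrictLaxCodescentObject_iff (y : LaxAlg M) (c : A) :
    IsStrictLaxCodescentObject (adj.diagram y) c ↔
      ∃ u : y ⟶ jAlg Jt c, IsUniversalArrow ((Jt.comp (strictIncl M)).comp (ell M)) u where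
  mp := fun ⟨φ, hφ⟩ =>
    ⟨adj.morOfCocone φ, (adj.isUniversal_iff_isUniversalArrow_morOfCocone φ).1 hφ⟩
  mpr := by
    rintro ⟨u, hu⟩
    obtain ⟨φ, rfl⟩ := adj.exists_morOfCocone_eq (i := False) u False.elim
    exact ⟨φ, (adj.isUniversal_iff_isUniversalArrow_morOfCocone φ).2 hu⟩

/-- The pseudomorphism `y ⟶ J X` corresponding to a cocone under `𝒜_y` with vertex `X` for the
weight in which `ϑ` is invertible. -/
def pseudoMorOfCocone (φ : WeightedCocone (descentWeight True) (adj.diagram y) X) :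
    LocallyFull.mk y ⟶ (Jt.comp (strictIncl M)).obj X :=
  LocallyFull.Mor.mk (a := LocallyFull.mk y) (b := (Jt.comp (strictIncl M)).obj X)
    (adj.morOfCocone φ)
    ((adj.isIso_transposeCell_iff _).2 (φ.isIso_legCell trivial))

/-- Cocones under `𝒜_y` with vertex `X`, for the weight in which `ϑ` is invertible, as
pseudomorphisms `y ⟶ J X`. -/
def pseudoCoconeFunctor (y : LaxAlg M) (X : A) :
    WeightedCocone (descentWeight True) (adj.diagram y) X ⥤
      (LocallyFull.mk y ⟶ (Jt.comp (strictIncl M)).obj X) where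
  obj φ := adj.pseudoMorOfCocone φ
  map {φ ψ} Γ := LocallyFull.Mor₂.mk (f := adj.pseudoMorOfCocone φ) (g := adj.pseudoMorOfCocone ψ)
    ((adj.coconeFunctor True y X).map Γ)
  map_id φ := LocallyFull.Mor₂.ext ((adj.coconeFunctor True y X).map_id φ)
  map_comp Γ Θ := LocallyFull.Mor₂.ext ((adj.coconeFunctor True y X).map_comp Γ Θ)

theorem pseudoMorOfCocone_surjective : Function.Surjective
    (adj.pseudoMorOfCocone : WeightedCocone (descentWeight True) (adj.diagram y) X → _) := by
  intro u
  obtain ⟨φ, hφ⟩ := adj.exists_morOfCocone_eq (i := True) u.hom fun _ => u.mem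
  exact ⟨φ, LocallyFull.Mor.ext hφ⟩

instance (y : LaxAlg M) (X : A) : (adj.pseudoCoconeFunctor y X).IsIso where
  faithful := ⟨fun h => (adj.coconeFunctor True y X).map_injective (congrArg (·.hom) h)⟩
  full := ⟨fun η =>
    have ⟨Γ, hΓ⟩ := (adj.coconeFunctor True y X).map_surjective η.hom
    ⟨Γ, LocallyFull.Mor₂.ext hΓ⟩⟩
  bijective_obj := ⟨fun _ _ h => adj.morOfCocone_injective (congrArg (·.hom) h),
    adj.pseudoMorOfCocone_surjective⟩

theorem postFunctor_comp_pseudoCoconeFunctor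
    (φ : WeightedCocone (descentWeight True) (adj.diagram y) X) (Y : A) :
    φ.postFunctor Y ⋙ adj.pseudoCoconeFunctor y Y =
      arrowFunctor (Jt.comp (strictIncl M)) (adj.pseudoMorOfCocone φ) Y :=
  have obj_eq (k : X ⟶ Y) : adj.pseudoMorOfCocone (φ.post k) =
      adj.pseudoMorOfCocone φ ≫ (Jt.comp (strictIncl M)).map k :=
    LocallyFull.Mor.ext (adj.morOfCocone_post φ k)
  CategoryTheory.Functor.hext obj_eq fun k l η =>
    LocallyFull.Mor₂.heq_of_hom_heq (obj_eq k) (obj_eq l)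
      (adj.coconeFunctor_map_postFunctor_map_heq φ η)

theorem isUniversal_iff_isUniversalArrow_pseudoMorOfCocone
    (φ : WeightedCocone (descentWeight True) (adj.diagram y) X) :
    φ.IsUniversal ↔ IsUniversalArrow (Jt.comp (strictIncl M)) (adj.pseudoMorOfCocone φ) :=
  forall_congr' fun Y => (functor_isIso_iff _).symm.trans
    ((functor_isIso_comp_iff _ (adj.pseudoCoconeFunctor y Y)).symm.trans
      (iff_of_eq (congrArg Functor.IsIso (adj.postFunctor_comp_pseudoCoconeFunctor φ Y))))

theorem isStrictCodescentObject_iff (y : LaxAlg M) (c : A) :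
    IsStrictCodescentObject (adj.diagram y) c ↔
      ∃ u : LocallyFull.mk y ⟶ (Jt.comp (strictIncl M)).obj c,
        IsUniversalArrow (Jt.comp (strictIncl M)) u where
  mp := fun ⟨φ, hφ⟩ =>
    ⟨adj.pseudoMorOfCocone φ, (adj.isUniversal_iff_isUniversalArrow_pseudoMorOfCocone φ).1 hφ⟩
  mpr := by
    rintro ⟨u, hu⟩
    obtain ⟨φ, rfl⟩ := adj.pseudoMorOfCocone_surjective u
    exact ⟨φ, (adj.isUniversal_iff_isUniversalArrow_pseudoMorOfCocone φ).2 hu⟩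

end TwoAdjunction

end LaxAlgebras

theorem mainTheorem3 {A : Type u₁} [Bicategory.{w₁, v₁} A] [Bicategory.Strict A]
    {B : Type u} [Bicategory.{w, v} B] [Bicategory.Strict B]
    (M : LaxAlgebras.TwoMonad B)
    (E : StrictPseudofunctor B A) (R : StrictPseudofunctor A B)
    (adj : LaxAlgebras.TwoAdjunction E R)
    (J : StrictPseudofunctor A (LaxAlgebras.LaxAlgPs M))
    (Jt : StrictPseudofunctor A (LaxAlgebras.LaxAlgS M))
    (hR : J.comp (LaxAlgebras.forgetPs M) = R)
    (hJ : Jt.comp (LaxAlgebras.strictIncl M) = J) :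
    ((∃ G : StrictPseudofunctor (LaxAlgebras.LaxAlg M) A,
        Nonempty (LaxAlgebras.TwoAdjunction G (J.comp (LaxAlgebras.ell M)))) ↔
      ∀ y : LaxAlgebras.LaxAlg M, ∃ c : A, LaxAlgebras.IsStrictLaxCodescentObject
        (LaxAlgebras.codescentDiagram hJ hR adj y) c) ∧
    (∀ G : StrictPseudofunctor (LaxAlgebras.LaxAlg M) A,
      Nonempty (LaxAlgebras.TwoAdjunction G (J.comp (LaxAlgebras.ell M))) →
      ∀ y : LaxAlgebras.LaxAlg M, LaxAlgebras.IsStrictLaxCodescentObject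
        (LaxAlgebras.codescentDiagram hJ hR adj y) (G.obj y)) ∧
    (∀ C : LaxAlgebras.LaxAlg M → A,
      (∀ y : LaxAlgebras.LaxAlg M, LaxAlgebras.IsStrictLaxCodescentObject
        (LaxAlgebras.codescentDiagram hJ hR adj y) (C y)) →
      ∃ G : StrictPseudofunctor (LaxAlgebras.LaxAlg M) A, (∀ y, G.obj y = C y) ∧
        Nonempty (LaxAlgebras.TwoAdjunction G (J.comp (LaxAlgebras.ell M)))) ∧
    ((∃ G : StrictPseudofunctor (LaxAlgebras.LaxAlgPs M) A,
        Nonempty (LaxAlgebras.TwoAdjunction G J)) ↔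
      ∀ y : LaxAlgebras.LaxAlg M, ∃ c : A, LaxAlgebras.IsStrictCodescentObject
        (LaxAlgebras.codescentDiagram hJ hR adj y) c) := by
  subst hJ hR
  let P := Jt.comp (LaxAlgebras.strictIncl M)
  have lax_iff (y : LaxAlgebras.LaxAlg M) (c : A) :
      LaxAlgebras.IsStrictLaxCodescentObject (LaxAlgebras.codescentDiagram rfl rfl adj y) c ↔
        ∃ u : y ⟶ LaxAlgebras.jAlg Jt c,
          LaxAlgebras.IsUniversalArrow (P.comp (LaxAlgebras.ell M)) u :=
    adj.isStrictLaxCodescentObject_iff y c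
  refine ⟨?_, fun G ⟨adj'⟩ y => ?_, fun C hC => ?_, ?_⟩
  · exact LaxAlgebras.TwoAdjunction.exists_iff_exists_isUniversalArrow.trans
      (forall_congr' fun y => exists_congr fun c => (lax_iff y c).symm)
  · exact (lax_iff y (G.obj y)).2 ⟨adj'.unit y, adj'.isUniversalArrow_unit y⟩
  · choose u hu using fun y => (lax_iff y (C y)).1 (hC y)
    exact ⟨LaxAlgebras.IsUniversalArrow.leftAdjoint hu, fun _ => rfl,
      ⟨LaxAlgebras.IsUniversalArrow.twoAdjunction hu⟩⟩
  · exact LaxAlgebras.TwoAdjunction.exists_iff_exists_isUniversalArrow.trans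
      ⟨fun h y => (h ⟨y⟩).imp fun c => (adj.isStrictCodescentObject_iff y c).2,
        fun h y => (h y.obj).imp fun c => (adj.isStrictCodescentObject_iff y.obj c).1⟩
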